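/- **Setting.** Let $\Omega\subset\mathbb R^3$ be a bounded Lipschitz domain and $B\subset\Omega$ a Lipschitz domain. For a Banach space $F$, $\mathcal C^1(B,F)$ denotes the Banach space of continuously differentiable maps on $B$ with $\sup_B|g|+\sup_B|Dg|<\infty$. Let $\kappa\in\mathcal C^1(B)$ with $\kappa>0$, $E_d\in\mathcal C^1(B,\mathbb R^3)$, $j_c>0$, $f\in L^2(\Omega,\mathbb R^3)\cap\mathcal C^1(B,\mathbb R^3)$, and let $\varepsilon,\nu\in L^\infty(\Omega,\mathbb R^{3\times3})\cap\mathcal C^1(B,\mathbb R^{3\times3})$ be symmetric and uniformly positive definite (a.e. in $\Omega$). Let $\mathcal O$ be the set of open Lipschitz sets $\omega\subset B$ with Lipschitz constant $L$, where $L\ge0$ is given. $H(\mathrm{curl})$ is the space of $v\in L^2(\Omega,\mathbb R^3)$ with distributional curl in $L^2(\Omega,\mathbb R^3)$, and $H_0(\mathrm{curl})$ is the closure in it of the smooth fields with compact support in $\Omega$. Put $$a(v,w)=\int_\Omega \nu\,\mathrm{curl}\,v\cdot\mathrm{curl}\,w+\varepsilon v\cdot w\,dx .$$ For $\gamma>0$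 let $\max_\gamma\{1,x\}=x$ if $x-1\ge\frac1{2\gamma}$, $=1+\frac\gamma2\big(x-1+\frac1{2\gamma}\big)^2$ if $|x-1|\le\frac1{2\gamma}$, and $=1$ if $x-1\le-\frac1{2\gamma}$. For $e\in\mathbb R^3$ put $$\Lambda_\gamma(e)=\frac{j_c\gamma e}{\max_\gamma\{1,\gamma|e|\}},$$ $$\psi^\gamma(e)=\frac{j_c\gamma I_3}{\max_\gamma\{1,\gamma|e|\}}-\gamma\Big(\mathbb 1_{\{\gamma|e|\ge1+\frac1{2\gamma}\}}+\gamma\big(\gamma|e|-1+\tfrac1{2\gamma}\big)\mathbb 1_{\{|\gamma|e|-1|<\frac1{2\gamma}\}}\Big)\frac{e\otimes\Lambda_\gamma(e)}{\max_\gamma\{1,\gamma|e|\}\,|e|},$$ where the last term is $0$ for $e=0$. Here $x\otimes y=xy^{\mathsf T}$ and $A:B=\sum_{i,j}A_{ij}B_{ij}$. For open $\omega\subset B$, the state $E^\gamma(\omega)\in H_0(\mathrm{curl})$ is the solution of $$a(E,v)+\int_\omega\Lambda_\gamma(E)\cdot v\,dx=\int_\Omega f\cdot v\,dx\qquad\forall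 v\in H_0(\mathrm{curl}),\tag{1}$$ and $$J_\gamma(\omega)=\frac12\int_B\kappa|E^\gamma(\omega)-E_d|^2dx+|\omega| .$$ For $E=E^\gamma(\omega)$, the adjoint state $P^\gamma\in H_0(\mathrm{curl})$ is the solution of $$a(v,P)+\int_\omega\psi^\gamma(E)P\cdot v\,dx=-\int_B\kappa(E-E_d)\cdot v\,dx\qquad\forall v\in H_0(\mathrm{curl}).\tag{2}$$ Let $\mathcal C^{0,1}_c(B)$ be the space of Lipschitz fields $\theta:\Omega\to\mathbb R^3$ with compact support in $B$, with the norm $\|\theta\|_{\mathcal C^{0,1}}=\sup_\Omega|\theta|+\sup_{x\ne y}|\theta(x)-\theta(y)|/|x-y|$, and let $T_t$ be the flow of $\theta$ on a time interval $[0,\tau]$, $\tau>0$. The Lagrangian and the shape-Lagrangian are $$\mathcal L(\omega,u,v)=\frac12\int_B\kappa|u-E_d|^2dx+|\omega|+a(u,v)+\int_\omega\Lambda_\gamma(u)\cdot v\,dx-\int_\Omega f\cdot v\,dx,$$ $$G(t,u,v)=\mathcal L(T_t(\omega),\Psi_t(u),\Psi_t(v)),\qquad \Psi_t(u)=(DT_t^{-\mathsf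 T}u)\circ T_t^{-1}.$$ **Theorem.** Let $\gamma>0$ and $\omega\in\mathcal O$. Then (1) has a unique solution $E^\gamma\in H_0(\mathrm{curl})$ and (2), with $E=E^\gamma$, has a unique solution $P^\gamma\in H_0(\mathrm{curl})$. The functional $J_\gamma$ is shape differentiable at $\omega$: for every $\theta\in\mathcal C^{0,1}_c(B)$ the limit $$dJ_\gamma(\omega)(\theta)=\lim_{t\searrow0}\frac{J_\gamma(T_t(\omega))-J_\gamma(\omega)}t$$ exists, and it is linear in $\theta$ and continuous with respect to $\|\cdot\|_{\mathcal C^{0,1}}$. Moreover, for every such $\theta$, the one-sided derivative $\partial_tG(0,E^\gamma,P^\gamma)$ exists and $$dJ_\gamma(\omega)(\theta)=\partial_tG(0,E^\gamma,P^\gamma)=\int_BS_1^\gamma:D\theta+S_0^\gamma\cdot\theta\,dx,$$ where $S_1^\gamma\in L^1(B,\mathbb R^{3\times3})$ and $S_0^\gamma\in L^1(B,\mathbb R^3)$ are given by $$\begin{aligned}S_1^\gamma={}&\Big[\tfrac\kappa2|E^\gamma-E_d|^2+\chi_\omega-\nu\,\mathrm{curl}E^\gamma\cdot\mathrm{curl}P^\gamma+\varepsilon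 E^\gamma\cdot P^\gamma+\chi_\omega\Lambda_\gamma(E^\gamma)\cdot P^\gamma-f\cdot P^\gamma\Big]I_3\\&-\kappa E^\gamma\otimes(E^\gamma-E_d)+\nu\,\mathrm{curl}E^\gamma\otimes\mathrm{curl}P^\gamma+\nu^{\mathsf T}\mathrm{curl}P^\gamma\otimes\mathrm{curl}E^\gamma\\&-P^\gamma\otimes\varepsilon E^\gamma-E^\gamma\otimes\varepsilon^{\mathsf T}P^\gamma+P^\gamma\otimes f-\chi_\omega P^\gamma\otimes\Lambda_\gamma(E^\gamma)-\chi_\omega E^\gamma\otimes\psi^\gamma(E^\gamma)P^\gamma,\end{aligned}$$ $$S_0^\gamma=\tfrac{\nabla\kappa}2|E^\gamma-E_d|^2-\kappa\,DE_d^{\mathsf T}(E^\gamma-E_d)+(D\nu^{\mathsf T}\mathrm{curl}E^\gamma)\mathrm{curl}P^\gamma+(D\varepsilon^{\mathsf T}E^\gamma)P^\gamma-Df^{\mathsf T}P^\gamma,$$ and, for a third-order tensor $A$, $(A^{\mathsf T}x)y$ is the vector with $(A^{\mathsf T}x)y\cdot\theta=(A\theta)x\cdot y$ for all $\theta\in\mathbb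 R^3$. -/

import Mathlib

open MeasureTheory Filter Topology
open scoped NNReal ENNReal InnerProductSpace

noncomputable section

namespace HTS

/-- Euclidean three-space. -/
abbrev E3 : Type := EuclideanSpace ℝ (Fin 3)

/-- Second-order tensors (real `3 × 3` matrices), as linear maps of `E3`. -/
abbrev Tensor : Type := E3 →L[ℝ] E3

/-- Vector fields on space. Fields on an open set are represented by arbitrary extensions; only
their values on that set matter. -/
abbrev Field : Type := E3 → E3

/-- The `j`-th standard basis vector. -/
def e (j : Fin 3) : E3 := EuclideanSpace.single j (1 : ℝ)

/-- The outer product `x ⊗ y = x yᵀ`, that is `z ↦ (y · z) x`. -/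
def outer (x y : E3) : Tensor := InnerProductSpace.rankOne ℝ x y

/-- The Frobenius product `A : B` (sum over the columns). -/
def frob (A B : Tensor) : ℝ := ∑ j : Fin 3, ⟪A (e j), B (e j)⟫_ℝ

/-- The transpose of a second-order tensor. -/
def transp (A : Tensor) : Tensor := ContinuousLinearMap.adjoint A

/-- `(Aᵀ x) y` for a third-order tensor `A`: the vector `w` with `(A θ) x · y = w · θ` for all
`θ`. -/
def transp3 (A : E3 →L[ℝ] Tensor) (x y : E3) : E3 := ContinuousLinearMap.adjoint (A.flip x) y

/-! ### Domains -/

/-- `U` is open and, near each boundary point, it is the region strictly below the graph of a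
Lipschitz function with constant `L`, in suitable orthonormal coordinates centred at the point. -/
def IsLipschitzOpen (L : ℝ≥0) (U : Set E3) : Prop :=
  IsOpen U ∧ ∀ x ∈ frontier U, ∃ (R : E3 ≃ₗᵢ[ℝ] E3) (g : EuclideanSpace ℝ (Fin 2) → ℝ) (r : ℝ),
    0 < r ∧ LipschitzWith L g ∧
      ∀ y ∈ Metric.ball x r, (y ∈ U ↔ R (y - x) 2 < g !₂[R (y - x) 0, R (y - x) 1])

/-- A Lipschitz domain: connected, open, with a Lipschitz boundary. -/
def IsLipschitzDomain (U : Set E3) : Prop :=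
  IsConnected U ∧ ∃ L : ℝ≥0, IsLipschitzOpen L U

/-- The admissible shapes: open Lipschitz subsets of `B` with Lipschitz constant `L`. -/
def admissibleShapes (B : Set E3) (L : ℝ≥0) : Set (Set E3) :=
  {ω | ω ⊆ B ∧ IsLipschitzOpen L ω}

/-- Membership in the Banach space `C¹(B)` (with `B` open): continuously differentiable on `B`,
with finite norm `sup |g| + sup |Dg|`. -/
def MemC1 {F : Type*} [NormedAddCommGroup F] [NormedSpace ℝ F] (B : Set E3) (g : E3 → F) : Prop :=
  ContDiffOn ℝ 1 g B ∧ ∃ C : ℝ, ∀ x ∈ B, ‖g x‖ ≤ C ∧ ‖fderiv ℝ g x‖ ≤ C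

/-! ### The spaces `H(curl)` and `H₀(curl)` -/

/-- The classical curl. -/
def curl (u : Field) (x : E3) : E3 :=
  !₂[fderiv ℝ u x (e 1) 2 - fderiv ℝ u x (e 2) 1,
     fderiv ℝ u x (e 2) 0 - fderiv ℝ u x (e 0) 2,
     fderiv ℝ u x (e 0) 1 - fderiv ℝ u x (e 1) 0]

/-- Smooth vector fields with compact support in `Ω`. -/
def IsTestField (Ω : Set E3) (φ : Field) : Prop :=
  ContDiff ℝ ((⊤ : ℕ∞) : WithTop ℕ∞) φ ∧ HasCompactSupport φ ∧ tsupport φ ⊆ Ω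

/-- `c ∈ L²(Ω)` is the distributional curl of `u` on `Ω`. -/
def HasWeakCurl (Ω : Set E3) (u c : Field) : Prop :=
  MemLp c 2 (volume.restrict Ω) ∧
    ∀ φ : Field, IsTestField Ω φ → ∫ x in Ω, ⟪u x, curl φ x⟫_ℝ = ∫ x in Ω, ⟪c x, φ x⟫_ℝ

/-- `u ∈ H(curl)` on `Ω`. -/
def MemHcurl (Ω : Set E3) (u : Field) : Prop :=
  MemLp u 2 (volume.restrict Ω) ∧ ∃ c : Field, HasWeakCurl Ω u c

open Classical in
/-- The distributional curl on `Ω` of a field in `H(curl)`; it is determined almost everywhere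
in `Ω`. (The value is the zero field if there is no square integrable curl.) -/
def weakCurl (Ω : Set E3) (u : Field) : Field :=
  if h : ∃ c : Field, HasWeakCurl Ω u c then h.choose else 0

/-- `u ∈ H₀(curl)`: the field `u` is in the closure of the test fields for the `H(curl)`-norm. -/
def MemH0curl (Ω : Set E3) (u : Field) : Prop :=
  MemHcurl Ω u ∧ ∀ δ : ℝ≥0∞, 0 < δ → ∃ φ : Field, IsTestField Ω φ ∧
    eLpNorm (fun x => u x - φ x) 2 (volume.restrict Ω) ≤ δ ∧
    eLpNorm (fun x => weakCurl Ω u x - curl φ x) 2 (volume.restrict Ω) ≤ δ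

/-! ### The regularized nonlinearity -/

/-- The regularized maximum `max_γ {1, x}`. -/
def maxReg (γ x : ℝ) : ℝ :=
  if 1 / (2 * γ) ≤ x - 1 then x
  else if |x - 1| ≤ 1 / (2 * γ) then 1 + γ / 2 * (x - 1 + 1 / (2 * γ)) ^ 2
  else 1

/-- The dual variable map `Λ_γ(a) = j_c γ a / max_γ {1, γ |a|}`. -/
def Lam (jc γ : ℝ) (a : E3) : E3 := (jc * γ / maxReg γ (γ * ‖a‖)) • a

open Classical in
/-- The matrix-valued function `ψ^γ`, the transpose of the derivative of `Λ_γ`. -/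
def psi (jc γ : ℝ) (a : E3) : Tensor :=
  (jc * γ / maxReg γ (γ * ‖a‖)) • ContinuousLinearMap.id ℝ E3 -
    (γ * ((if 1 + 1 / (2 * γ) ≤ γ * ‖a‖ then 1 else 0) +
        γ * (γ * ‖a‖ - 1 + 1 / (2 * γ)) *
          (if |γ * ‖a‖ - 1| < 1 / (2 * γ) then 1 else 0)) /
      (maxReg γ (γ * ‖a‖) * ‖a‖)) • outer a (Lam jc γ a)

/-! ### The data, the state equation, the cost and the adjoint equation -/

/-- The data of the shape optimization problem. -/
structure Data where
  /-- the hold-all domain -/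
  Ω : Set E3
  /-- the region containing the shapes -/
  B : Set E3
  /-- the target field -/
  Ed : Field
  /-- the weight -/
  κ : E3 → ℝ
  /-- the critical current density -/
  jc : ℝ
  /-- the electric permittivity -/
  ε : E3 → Tensor
  /-- the magnetic reluctivity -/
  ν : E3 → Tensor
  /-- the applied current source -/
  f : Field

/-- Material parameters on `Ω`: essentially bounded, `C¹` on `B`, symmetric and uniformly positive
definite. -/
def IsMaterial (Ω B : Set E3) (m : E3 → Tensor) : Prop :=
  MemLp m ∞ (volume.restrict Ω) ∧ MemC1 B m ∧
    (∀ᵐ x ∂(volume.restrict Ω), transp (m x) = m x) ∧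
    ∃ c : ℝ, 0 < c ∧ ∀ᵐ x ∂(volume.restrict Ω), ∀ ξ : E3, c * ‖ξ‖ ^ 2 ≤ ⟪ξ, m x ξ⟫_ℝ

namespace Data

/-- The standing assumptions on the data. -/
structure Admissible (d : Data) : Prop where
  bounded : Bornology.IsBounded d.Ω
  lipschitz_Ω : IsLipschitzDomain d.Ω
  lipschitz_B : IsLipschitzDomain d.B
  subset : d.B ⊆ d.Ω
  target : MemC1 d.B d.Ed
  weight : MemC1 d.B d.κ
  weight_pos : ∀ x ∈ d.B, 0 < d.κ x
  jc_pos : 0 < d.jc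
  permittivity : IsMaterial d.Ω d.B d.ε
  reluctivity : IsMaterial d.Ω d.B d.ν
  source : MemLp d.f 2 (volume.restrict d.Ω) ∧ MemC1 d.B d.f

variable (d : Data) (γ : ℝ) (ω : Set E3)

/-- The bilinear form `a`. -/
def a (v w : Field) : ℝ :=
  (∫ x in d.Ω, ⟪d.ν x (weakCurl d.Ω v x), weakCurl d.Ω w x⟫_ℝ) +
    ∫ x in d.Ω, ⟪d.ε x (v x), w x⟫_ℝ

/-- `E` solves the penalized state equation for the shape `ω`. -/
def IsState (E : Field) : Prop :=
  MemH0curl d.Ω E ∧ ∀ v : Field, MemH0curl d.Ω v →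
    d.a E v + ∫ x in ω, ⟪Lam d.jc γ (E x), v x⟫_ℝ = ∫ x in d.Ω, ⟪d.f x, v x⟫_ℝ

open Classical in
/-- The state `E^γ(ω)`, a solution of the state equation. -/
def state : Field := if h : ∃ E : Field, d.IsState γ ω E then h.choose else 0

/-- The tracking term `½ ∫_B κ |E - E_d|²`. -/
def tracking (E : Field) : ℝ := 1 / 2 * ∫ x in d.B, d.κ x * ‖E x - d.Ed x‖ ^ 2

/-- The penalized cost functional `J_γ`. -/
def J : ℝ := d.tracking (d.state γ ω) + volume.real ω

/-- `P` solves the adjoint equation for the shape `ω` and the state `E`. -/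
def IsAdjoint (E P : Field) : Prop :=
  MemH0curl d.Ω P ∧ ∀ v : Field, MemH0curl d.Ω v →
    d.a v P + ∫ x in ω, ⟪psi d.jc γ (E x) (P x), v x⟫_ℝ =
      - ∫ x in d.B, d.κ x * ⟪E x - d.Ed x, v x⟫_ℝ

/-- The Lagrangian `𝓛(ω, u, v)`. -/
def lagrangian (u v : Field) : ℝ :=
  d.tracking u + volume.real ω + d.a u v + (∫ x in ω, ⟪Lam d.jc γ (u x), v x⟫_ℝ) -
    ∫ x in d.Ω, ⟪d.f x, v x⟫_ℝ

end Data

/-! ### Flows and shape derivatives -/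

/-- `T` is the flow of `θ` on the time interval `[0, τ]`. -/
def IsFlow (θ : Field) (τ : ℝ) (T : ℝ → E3 → E3) : Prop :=
  ∀ X : E3, T 0 X = X ∧ ∀ t ∈ Set.Icc (0 : ℝ) τ,
    HasDerivWithinAt (fun s => T s X) (θ (T t X)) (Set.Icc 0 τ) t

/-- The space of Lipschitz vector fields with compact support in `B`. A field on a domain
containing `B` is extended by zero to the whole space, which preserves the Lipschitz constant. -/
def lipFields (B : Set E3) : Submodule ℝ Field where
  carrier := {θ | (∃ K : ℝ≥0, LipschitzWith K θ) ∧ HasCompactSupport θ ∧ tsupport θ ⊆ B}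
  add_mem' := by
    rintro θ₁ θ₂ ⟨⟨K₁, h₁⟩, c₁, s₁⟩ ⟨⟨K₂, h₂⟩, c₂, s₂⟩
    exact ⟨⟨K₁ + K₂, h₁.add h₂⟩, c₁.add c₂,
      (tsupport_add θ₁ θ₂).trans (Set.union_subset s₁ s₂)⟩
  zero_mem' := by
    refine ⟨⟨0, LipschitzWith.const 0⟩, HasCompactSupport.zero, ?_⟩
    have h : tsupport (0 : Field) = ∅ := tsupport_eq_empty_iff.mpr rfl
    rw [h]
    exact Set.empty_subset B
  smul_mem' := by
    rintro c θ ⟨⟨K, h⟩, hc, hs⟩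
    have h0 : tsupport (c • θ) ⊆ tsupport θ :=
      closure_mono (Function.support_const_smul_subset c θ)
    refine ⟨⟨‖c‖₊ * K, ?_⟩, ?_, h0.trans hs⟩
    · exact (lipschitzWith_smul c).comp h
    · exact hc.of_isClosed_subset (isClosed_tsupport _) h0

/-- The norm of `C^{0,1}(Ω)`. -/
def lipNorm (Ω : Set E3) (θ : Field) : ℝ :=
  (⨆ x : Ω, ‖θ x‖) +
    ⨆ p : {p : E3 × E3 // p.1 ∈ Ω ∧ p.2 ∈ Ω ∧ p.1 ≠ p.2},
      ‖θ p.1.1 - θ p.1.2‖ / ‖p.1.1 - p.1.2‖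

/-- The Eulerian semiderivative of `K` at `ω` in direction `θ` exists and equals `l`. The flow of a
Lipschitz field is unique, so the existential quantifier over flows involves no choice. -/
def HasEulerianSemiderivative (K : Set E3 → ℝ) (ω : Set E3) (θ : Field) (l : ℝ) : Prop :=
  ∃ τ : ℝ, 0 < τ ∧ ∃ T : ℝ → E3 → E3, IsFlow θ τ T ∧
    Tendsto (fun t : ℝ => (K (T t '' ω) - K ω) / t) (𝓝[>] 0) (𝓝 l)

/-- `K` is shape differentiable at `ω` with shape derivative `dK`: the Eulerian semiderivative
exists in all directions, and it is linear and continuous in the direction for the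
`C^{0,1}(Ω)`-norm. -/
def HasShapeDerivative (Ω B : Set E3) (K : Set E3 → ℝ) (ω : Set E3)
    (dK : lipFields B →ₗ[ℝ] ℝ) : Prop :=
  (∀ θ : lipFields B, HasEulerianSemiderivative K ω θ (dK θ)) ∧
    ∃ C : ℝ, ∀ θ : lipFields B, |dK θ| ≤ C * lipNorm Ω θ

/-- The covariant transformation `Ψ(u) = (DT^{-⊤} u) ∘ T⁻¹`. -/
def covariant (T : E3 → E3) (u : Field) (x : E3) : E3 :=
  transp (ContinuousLinearMap.inverse (fderiv ℝ T (Function.invFun T x)))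
    (u (Function.invFun T x))

namespace Data

variable (d : Data) (γ : ℝ) (ω : Set E3)

/-- The shape-Lagrangian `G(t, u, v) = 𝓛(T_t(ω), Ψ_t(u), Ψ_t(v))`. -/
def shapeLagrangian (T : ℝ → E3 → E3) (t : ℝ) (u v : Field) : ℝ :=
  d.lagrangian γ (T t '' ω) (covariant (T t) u) (covariant (T t) v)

open Classical in
/-- The characteristic function of `ω`. -/
def chi (ω : Set E3) (x : E3) : ℝ := if x ∈ ω then 1 else 0

/-- The tensor `S₁^γ`. -/
def S1 (E P : Field) (x : E3) : Tensor :=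
  let cE := weakCurl d.Ω E x
  let cP := weakCurl d.Ω P x
  (d.κ x / 2 * ‖E x - d.Ed x‖ ^ 2 + chi ω x - ⟪d.ν x cE, cP⟫_ℝ + ⟪d.ε x (E x), P x⟫_ℝ
      + chi ω x * ⟪Lam d.jc γ (E x), P x⟫_ℝ - ⟪d.f x, P x⟫_ℝ) • ContinuousLinearMap.id ℝ E3
    - d.κ x • outer (E x) (E x - d.Ed x)
    + outer (d.ν x cE) cP + outer (transp (d.ν x) cP) cE
    - outer (P x) (d.ε x (E x)) - outer (E x) (transp (d.ε x) (P x))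
    + outer (P x) (d.f x)
    - chi ω x • outer (P x) (Lam d.jc γ (E x))
    - chi ω x • outer (E x) (psi d.jc γ (E x) (P x))

/-- The vector field `S₀^γ`. -/
def S0 (E P : Field) (x : E3) : E3 :=
  (‖E x - d.Ed x‖ ^ 2 / 2) • gradient d.κ x
    - d.κ x • transp (fderiv ℝ d.Ed x) (E x - d.Ed x)
    + transp3 (fderiv ℝ d.ν x) (weakCurl d.Ω E x) (weakCurl d.Ω P x)
    + transp3 (fderiv ℝ d.ε x) (E x) (P x)
    - transp (fderiv ℝ d.f x) (P x)

end Data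

end HTS

end

/-! Well-posedness is strong monotonicity. The map `Lam` is Lipschitz and monotone: its derivative
`psi` is symmetric, bounded and positive semidefinite, because `x * maxRegDeriv γ x ≤ maxReg γ x`.
Added to the uniformly elliptic ε and ν, it gives a Lipschitz, strongly monotone operator on L² ×
L². A contraction argument solves the equation on the closed subspace of pairs (u, curl u) with u in
H₀(curl). The linear adjoint equation is covered by the same argument. Pairs `H0Pair` are used
throughout instead of the chosen representative `weakCurl`.

For the shape derivative, everything on T_t(ω) is transported back to ω. The covariant pullback by a
bi-Lipschitz map preserves H₀(curl) and multiplies curls by an adjugate (`curl_pullback` for smooth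
maps, `h0Pair_pullback` in general, by mollification). After a change of variables the Lagrangian on
the moved shape is `lagrangianT`, a functional on fixed domains whose coefficients depend on t
through T_t and DT_t. Let u_t be the pullback of the state on T_t(ω). Strong monotonicity and the
O(t) closeness of the coefficients give ‖u_t − E‖ = O(t) in H(curl) (`transported_state_sub_le`).

The Lagrangian equals the cost at a state, whatever the second argument. Hence J(T_t ω) = G(t, u_t,
P), with G now read as `lagrangianT`, and the increment splits into [G(t, u_t, P) − G(t, E, P)] +
[G(t, E, P) − G(0, E, P)]. The first bracket is, up to o(t), the u-derivative of the Lagrangian in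
direction u_t − E, and the adjoint equation makes it vanish (`tendsto_lagrangianT_sub`). The only
delicate term there is the nonlinear one: `Lam` is differentiated pointwise, and its remainder is
controlled in L² along almost everywhere convergent subsequences.

The second bracket involves fixed fields only (`tendsto_lagrangianT_slope`). Since θ is merely
Lipschitz, no pointwise limit of R_t = (DT_t − I)/t is used. The coefficients are expanded to first
order with R_t kept as the coefficient, which yields the integral of S₁ : R_t + S₀ · θ up to o(1).
As (T_t − id)/t converges pointwise to θ with uniform Lipschitz bounds, R_t converges weakly to Dθ
against the integrable S₁. The same limit is the derivative of the shape Lagrangian, and the formula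
is visibly linear and continuous in θ. -/

namespace HTS

/-! ### Flows of Lipschitz fields -/

/-- `T` is `t`-close to the identity: it is the identity off `K`, and `T - id` is bounded by `M t`
and Lipschitz with constant `C t`. -/
structure IsNearId (K : Set E3) (C M t : ℝ) (T : E3 → E3) : Prop where
  off : ∀ x ∉ K, T x = x
  disp : ∀ x, ‖T x - x‖ ≤ M * t
  lip : ∀ x y, ‖(T x - x) - (T y - y)‖ ≤ C * t * ‖x - y‖

/-- The Picard–Lindelöf ball has radius `M`, the largest displacement possible in unit time, so the
time interval need not be shrunk. -/
theorem exists_isFlow {θ : Field} {k : ℝ≥0} (hθ : LipschitzWith k θ) {M : ℝ≥0}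
    (hM : ∀ x, ‖θ x‖ ≤ M) : ∃ T : ℝ → E3 → E3, IsFlow θ 1 T := by
  have h : ∀ X : E3, ∃ α : ℝ → E3, α 0 = X ∧ ∀ t ∈ Set.Icc (0 : ℝ) 1,
      HasDerivWithinAt α (θ (α t)) (Set.Icc 0 1) t := by
    intro X
    have hp : IsPicardLindelof (fun _ : ℝ => θ) (tmin := 0) (tmax := 1)
        ⟨0, Set.left_mem_Icc.2 zero_le_one⟩ X M 0 M k :=
      IsPicardLindelof.of_time_independent (fun x _ => hM x) (hθ.lipschitzOnWith) (by simp)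
    exact hp.exists_eq_forall_mem_Icc_hasDerivWithinAt₀
  choose α h0 h1 using h
  exact ⟨fun t X => α X t, fun X => ⟨h0 X, h1 X⟩⟩

section Flow

variable {θ : Field} {k : ℝ≥0} {τ : ℝ} {T : ℝ → E3 → E3}

theorem IsFlow.continuousOn (hT : IsFlow θ τ T) (X : E3) :
    ContinuousOn (fun s => T s X) (Set.Icc 0 τ) :=
  fun t ht => ((hT X).2 t ht).continuousWithinAt

theorem IsFlow.hasDerivWithinAt_Ici (hT : IsFlow θ τ T) (X : E3) {t : ℝ}
    (ht : t ∈ Set.Ico 0 τ) :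
    HasDerivWithinAt (fun s => T s X) (θ (T t X)) (Set.Ici t) t :=
  ((hT X).2 t (Set.Ico_subset_Icc_self ht)).mono_of_mem_nhdsWithin (Icc_mem_nhdsGE_of_mem ht)

theorem IsFlow.dist_le (hT : IsFlow θ τ T) (hθ : LipschitzWith k θ) (X Y : E3) {t : ℝ}
    (ht : t ∈ Set.Icc 0 τ) : ‖T t X - T t Y‖ ≤ ‖X - Y‖ * Real.exp (k * τ) := by
  have := dist_le_of_trajectories_ODE (v := fun _ => θ) (fun _ => hθ) (hT.continuousOn X)
    (fun t ht => hT.hasDerivWithinAt_Ici X ht) (hT.continuousOn Y)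
    (fun t ht => hT.hasDerivWithinAt_Ici Y ht) (le_refl _) t ht
  rw [(hT X).1, (hT Y).1, dist_eq_norm, dist_eq_norm, sub_zero] at this
  refine this.trans ?_
  gcongr
  exact ht.2

/-- The constant curve is also a trajectory, and trajectories of a Lipschitz field are unique. -/
theorem IsFlow.eq_of_eq_zero (hT : IsFlow θ τ T) (hθ : LipschitzWith k θ) {X : E3} (hX : θ X = 0)
    {t : ℝ} (ht : t ∈ Set.Icc 0 τ) : T t X = X := by
  have := dist_le_of_trajectories_ODE (v := fun _ => θ) (g := fun _ => X) (fun _ => hθ)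
    (hT.continuousOn X)
    (fun t ht => hT.hasDerivWithinAt_Ici X ht) continuousOn_const
    (fun t ht => by simpa only [hX] using hasDerivWithinAt_const t (Set.Ici t) X)
    (le_refl _) t ht
  rw [(hT X).1, dist_self, zero_mul] at this
  exact dist_le_zero.1 this

/-- By Gronwall the trajectories from `x` and `y` separate at speed at most `k * exp (k * τ) * ‖x -
y‖`. The mean value inequality turns this speed into the Lipschitz bound on `T t - id`, and the
bound `M` on the field into the displacement bound. -/
theorem IsFlow.isNearId (hT : IsFlow θ τ T) (hθ : LipschitzWith k θ) {M : ℝ}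
    (hM : ∀ x, ‖θ x‖ ≤ M) {t : ℝ} (ht : t ∈ Set.Icc 0 τ) :
    IsNearId (tsupport θ) (k * Real.exp (k * τ)) M t (T t) where
  off x hx := hT.eq_of_eq_zero hθ (image_eq_zero_of_notMem_tsupport hx) ht
  disp x := by
    have := norm_image_sub_le_of_norm_deriv_le_segment' (hT x).2 (fun s _ => hM _) t ht
    rwa [(hT x).1, sub_zero] at this
  lip x y := by
    have := norm_image_sub_le_of_norm_deriv_le_segment'
      (f := fun s => T s x - T s y) (C := k * Real.exp (k * τ) * ‖x - y‖)
      (fun s hs => ((hT x).2 s hs).sub ((hT y).2 s hs)) (fun s hs => by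
        refine (hθ.norm_sub_le _ _).trans ?_
        have := hT.dist_le hθ x y (Set.Ico_subset_Icc_self hs)
        calc (k : ℝ) * ‖T s x - T s y‖ ≤ k * (‖x - y‖ * Real.exp (k * τ)) := by gcongr
          _ = _ := by ring) t ht
    rw [(hT x).1, (hT y).1, sub_zero] at this
    calc ‖(T t x - x) - (T t y - y)‖ = ‖T t x - T t y - (x - y)‖ := by congr 1; abel
      _ ≤ _ := this
      _ = _ := by ring

theorem IsFlow.tendsto_slope (hT : IsFlow θ τ T) (hτ : 0 < τ) (X : E3) :
    Tendsto (fun t : ℝ => t⁻¹ • (T t X - X)) (𝓝[>] 0) (𝓝 (θ X)) := by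
  have h := hT.hasDerivWithinAt_Ici X (Set.left_mem_Ico.2 hτ)
  rw [(hT X).1] at h
  rw [← hasDerivWithinAt_Ioi_iff_Ici, hasDerivWithinAt_iff_tendsto_slope' (by simp)] at h
  refine h.congr fun t => ?_
  simp [slope, (hT X).1]

end Flow

/-! ### Bi-Lipschitz transformations -/

/-- `T` and `S` are mutually inverse Lipschitz maps which are the identity off the compact
set `K`. -/
structure IsLipEquiv (K : Set E3) (T S : E3 → E3) : Prop where
  left : ∀ x, S (T x) = x
  right : ∀ x, T (S x) = x
  lip : ∃ k : ℝ≥0, LipschitzWith k T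
  lip_inv : ∃ k : ℝ≥0, LipschitzWith k S
  compact : IsCompact K
  off : ∀ x ∉ K, T x = x

namespace IsLipEquiv

variable {K : Set E3} {T S : E3 → E3}

theorem symm (h : IsLipEquiv K T S) : IsLipEquiv K S T where
  left := h.right
  right := h.left
  lip := h.lip_inv
  lip_inv := h.lip
  compact := h.compact
  off x hx := by
    conv_lhs => rw [← h.off x hx]
    exact h.left x

theorem injective (h : IsLipEquiv K T S) : Function.Injective T :=
  Function.LeftInverse.injective h.left

theorem image_eq_preimage (h : IsLipEquiv K T S) (s : Set E3) : T '' s = S ⁻¹' s :=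
  congrFun (Set.image_eq_preimage_of_inverse h.left h.right) s

/-- A point of `s` cannot leave `s`: its image would lie off `K`, so the inverse would fix that
image, and the point would equal its own image. -/
theorem image_eq (h : IsLipEquiv K T S) {s : Set E3} (hs : K ⊆ s) : T '' s = s := by
  have key : ∀ {T S : E3 → E3}, IsLipEquiv K T S → ∀ x ∈ s, T x ∈ s := by
    intro T S h x hx
    by_contra hn
    have h1 := h.symm.off (T x) (fun hk => hn (hs hk))
    rw [h.left] at h1
    exact hn (h1 ▸ hx)
  refine Set.Subset.antisymm ?_ fun x hx => ⟨S x, key h.symm x hx, h.right x⟩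
  rintro _ ⟨x, hx, rfl⟩
  exact key h x hx

theorem preimage_eq (h : IsLipEquiv K T S) {s : Set E3} (hs : K ⊆ s) : T ⁻¹' s = s := by
  rw [← h.symm.image_eq_preimage, h.symm.image_eq hs]

theorem continuous (h : IsLipEquiv K T S) : Continuous T :=
  let ⟨_, hk⟩ := h.lip
  hk.continuous

theorem invFun_eq (h : IsLipEquiv K T S) : Function.invFun T = S := by
  funext x
  apply h.injective
  rw [Function.rightInverse_invFun (Function.RightInverse.surjective h.right), h.right]

end IsLipEquiv

/-- A perturbation of the identity with Lipschitz constant at most 1/2 is bijective, by the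
quantitative inverse function theorem on the whole space. -/
theorem IsNearId.isLipEquiv {K : Set E3} (hK : IsCompact K) {C M t : ℝ} {T : E3 → E3}
    (h : IsNearId K C M t T) (hC : 0 ≤ C * t) (hCt : C * t ≤ 1 / 2) :
    IsLipEquiv K T (Function.invFun T) := by
  obtain ⟨c, hc'⟩ : ∃ c : ℝ≥0, (c : ℝ) = C * t := ⟨⟨C * t, hC⟩, rfl⟩
  have ha : ApproximatesLinearOn T (ContinuousLinearEquiv.refl ℝ E3 : E3 →L[ℝ] E3) Set.univ
      c := by
    intro x _ y _
    have := h.lip x y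
    rw [hc']
    calc _ = ‖(T x - x) - (T y - y)‖ := by
          congr 1
          simp only [ContinuousLinearEquiv.coe_refl, ContinuousLinearMap.coe_id', id]
          abel
      _ ≤ _ := this
  have hn : ‖((ContinuousLinearEquiv.refl ℝ E3).symm : E3 →L[ℝ] E3)‖₊ = 1 := by
    apply NNReal.eq
    simp
  have hc : Subsingleton E3 ∨ c <
      ‖((ContinuousLinearEquiv.refl ℝ E3).symm : E3 →L[ℝ] E3)‖₊⁻¹ := by
    right
    rw [hn, inv_one, ← NNReal.coe_lt_coe]
    rw [hc', NNReal.coe_one]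
    linarith
  have hinj : Function.Injective T := Set.injOn_univ.1 (ha.injOn hc)
  have hsurj : Function.Surjective T := ha.surjective hc
  have hr : ∀ x, T (Function.invFun T x) = x := Function.rightInverse_invFun hsurj
  refine ⟨Function.leftInverse_invFun hinj, hr, ⟨c + 1, ?_⟩, ⟨2, ?_⟩, hK, h.off⟩
  · refine LipschitzWith.of_dist_le_mul fun x y => ?_
    rw [dist_eq_norm, dist_eq_norm]
    rw [NNReal.coe_add, hc', NNReal.coe_one]
    have := h.lip x y
    have h2 : T x - T y = ((T x - x) - (T y - y)) + (x - y) := by abel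
    rw [h2]
    linarith [norm_add_le ((T x - x) - (T y - y)) (x - y)]
  · refine LipschitzWith.of_dist_le_mul fun x y => ?_
    rw [dist_eq_norm, dist_eq_norm]
    have := h.lip (Function.invFun T x) (Function.invFun T y)
    rw [hr, hr] at this
    set a := Function.invFun T x
    set b := Function.invFun T y
    -- With at most half of `‖a - b‖` on the right, absorption gives the Lipschitz constant 2 for
    -- the inverse.
    have h2 : a - b = (x - y) - ((x - a) - (y - b)) := by abel
    have h3 := norm_sub_le (x - y) ((x - a) - (y - b))
    rw [← h2] at h3
    have h4 : C * t * ‖a - b‖ ≤ 1 / 2 * ‖a - b‖ := by gcongr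
    simp only [NNReal.coe_ofNat]
    linarith

end HTS

namespace HTS

/-! ### The `L²` seminorm and products of square integrable functions -/

section L2

variable {α F G : Type*} [MeasurableSpace α] {μ : Measure α} [NormedAddCommGroup F]
  [NormedAddCommGroup G]

/-- The `L²` seminorm as a real number. -/
noncomputable def l2 (μ : Measure α) (f : α → F) : ℝ := (eLpNorm f 2 μ).toReal

theorem l2_nonneg (f : α → F) : 0 ≤ l2 μ f := ENNReal.toReal_nonneg

theorem l2_congr {f g : α → F} (h : f =ᵐ[μ] g) : l2 μ f = l2 μ g := by
  rw [l2, l2, eLpNorm_congr_ae h]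

theorem eLpNorm_eq_l2 {f : α → F} (hf : MemLp f 2 μ) : eLpNorm f 2 μ = ENNReal.ofReal (l2 μ f) :=
  (ENNReal.ofReal_toReal hf.eLpNorm_ne_top).symm

theorem l2_add_le {f g : α → F} (hf : MemLp f 2 μ) (hg : MemLp g 2 μ) :
    l2 μ (f + g) ≤ l2 μ f + l2 μ g := by
  rw [l2, l2, l2, ← ENNReal.toReal_add hf.eLpNorm_ne_top hg.eLpNorm_ne_top]
  exact ENNReal.toReal_mono (ENNReal.add_ne_top.2 ⟨hf.eLpNorm_ne_top, hg.eLpNorm_ne_top⟩)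
    (eLpNorm_add_le hf.1 hg.1 one_le_two)

theorem l2_sq {f : α → F} (hf : MemLp f 2 μ) : l2 μ f ^ 2 = ∫ x, ‖f x‖ ^ 2 ∂μ := by
  rw [l2, hf.eLpNorm_eq_integral_rpow_norm two_ne_zero ENNReal.ofNat_ne_top]
  have h0 : 0 ≤ ∫ x, ‖f x‖ ^ 2 ∂μ := integral_nonneg fun x => by positivity
  simp only [ENNReal.toReal_ofNat, Real.rpow_two]
  rw [ENNReal.toReal_ofReal (by positivity), ← Real.rpow_natCast, ← Real.rpow_mul h0]
  norm_num

theorem integrable_norm_mul_norm {f : α → F} {g : α → G} (hf : MemLp f 2 μ) (hg : MemLp g 2 μ) :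
    Integrable (fun x => ‖f x‖ * ‖g x‖) μ := hf.norm.integrable_mul hg.norm

theorem integral_norm_mul_norm_le {f : α → F} {g : α → G} (hf : MemLp f 2 μ) (hg : MemLp g 2 μ) :
    ∫ x, ‖f x‖ * ‖g x‖ ∂μ ≤ l2 μ f * l2 μ g := by
  have := integral_mul_norm_le_Lp_mul_Lq (μ := μ) (f := fun x => ‖f x‖) (g := fun x => ‖g x‖)
    Real.HolderConjugate.two_two (by simpa using hf.norm) (by simpa using hg.norm)
  rw [l2, l2, hf.eLpNorm_eq_integral_rpow_norm two_ne_zero ENNReal.ofNat_ne_top,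
    hg.eLpNorm_eq_integral_rpow_norm two_ne_zero ENNReal.ofNat_ne_top,
    ENNReal.toReal_ofReal (by positivity), ENNReal.toReal_ofReal (by positivity)]
  simpa using this

theorem abs_integral_le_l2 {f : α → F} {g : α → G} {b : α → ℝ} {C : ℝ} (hC : 0 ≤ C)
    (hf : MemLp f 2 μ) (hg : MemLp g 2 μ) (hb : ∀ᵐ x ∂μ, |b x| ≤ C * (‖f x‖ * ‖g x‖)) :
    |∫ x, b x ∂μ| ≤ C * (l2 μ f * l2 μ g) := by
  rw [← Real.norm_eq_abs]
  refine (norm_integral_le_of_norm_le ((integrable_norm_mul_norm hf hg).const_mul C) hb).trans ?_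
  rw [integral_const_mul]
  gcongr
  exact integral_norm_mul_norm_le hf hg

theorem integrable_of_abs_le {f : α → F} {g : α → G} {b : α → ℝ} {C : ℝ}
    (hf : MemLp f 2 μ) (hg : MemLp g 2 μ) (hm : AEStronglyMeasurable b μ)
    (hb : ∀ᵐ x ∂μ, |b x| ≤ C * (‖f x‖ * ‖g x‖)) : Integrable b μ :=
  ((integrable_norm_mul_norm hf hg).const_mul C).mono' hm hb

theorem integrable_inner {f g : α → E3} (hf : MemLp f 2 μ) (hg : MemLp g 2 μ) :
    Integrable (fun x => ⟪f x, g x⟫_ℝ) μ :=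
  integrable_of_abs_le (C := 1) hf hg (hf.1.inner hg.1)
    (ae_of_all _ fun x => by rw [one_mul]; exact abs_real_inner_le_norm _ _)

theorem abs_integral_inner_le {f g : α → E3} (hf : MemLp f 2 μ) (hg : MemLp g 2 μ) :
    |∫ x, ⟪f x, g x⟫_ℝ ∂μ| ≤ l2 μ f * l2 μ g := by
  have := abs_integral_le_l2 (C := 1) zero_le_one hf hg (b := fun x => ⟪f x, g x⟫_ℝ)
    (ae_of_all _ fun x => by rw [one_mul]; exact abs_real_inner_le_norm _ _)
  rwa [one_mul] at this

end L2

/-! ### The curl -/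

/-- The curl as a linear function of the derivative. -/
noncomputable def curlOf : Tensor →ₗ[ℝ] E3 where
  toFun A := !₂[A (e 1) 2 - A (e 2) 1, A (e 2) 0 - A (e 0) 2, A (e 0) 1 - A (e 1) 0]
  map_add' A B := by
    ext i; fin_cases i <;> simp <;> ring
  map_smul' c A := by
    ext i; fin_cases i <;> simp <;> ring

theorem curl_eq (u : Field) (x : E3) : curl u x = curlOf (fderiv ℝ u x) := rfl

theorem continuous_curlOf : Continuous curlOf := curlOf.continuous_of_finiteDimensional

theorem inner_eq_sum (x y : E3) : ⟪x, y⟫_ℝ = x 0 * y 0 + x 1 * y 1 + x 2 * y 2 := by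
  simp [PiLp.inner_apply, Fin.sum_univ_three, mul_comm]

theorem IsTestField.continuous_curl {Ω : Set E3} {φ : Field} (h : IsTestField Ω φ) :
    Continuous (curl φ) :=
  continuous_curlOf.comp (h.1.continuous_fderiv (by simp))

theorem tsupport_curl_subset (φ : Field) : tsupport (curl φ) ⊆ tsupport φ := by
  refine (closure_mono ?_).trans (tsupport_fderiv_subset ℝ (f := φ))
  intro x hx h0
  apply hx
  rw [curl_eq, show fderiv ℝ φ x = 0 from h0, map_zero]

theorem IsTestField.hasCompactSupport_curl {Ω : Set E3} {φ : Field} (h : IsTestField Ω φ) :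
    HasCompactSupport (curl φ) :=
  h.2.1.of_isClosed_subset (isClosed_tsupport _) (tsupport_curl_subset φ)

theorem IsTestField.memLp {Ω : Set E3} {φ : Field} (h : IsTestField Ω φ) (μ : Measure E3)
    [IsFiniteMeasureOnCompacts μ] : MemLp φ 2 μ :=
  h.1.continuous.memLp_of_hasCompactSupport h.2.1

theorem IsTestField.memLp_curl {Ω : Set E3} {φ : Field} (h : IsTestField Ω φ) (μ : Measure E3)
    [IsFiniteMeasureOnCompacts μ] : MemLp (curl φ) 2 μ :=
  h.continuous_curl.memLp_of_hasCompactSupport h.hasCompactSupport_curl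

theorem integral_mul_fderiv_comp {Ω : Set E3} {φ ψ : Field} (hφ : IsTestField Ω φ)
    (hψ : IsTestField Ω ψ) (v : E3) (i j : Fin 3) :
    ∫ x, φ x i * fderiv ℝ ψ x v j = - ∫ x, fderiv ℝ φ x v i * ψ x j := by
  have hd : ∀ {φ : Field}, IsTestField Ω φ → ∀ i x, HasFDerivAt (fun x => φ x i)
      ((EuclideanSpace.proj i : E3 →L[ℝ] ℝ).comp (fderiv ℝ φ x)) x := by
    intro φ h i x
    exact (EuclideanSpace.proj i : E3 →L[ℝ] ℝ).hasFDerivAt.comp x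
      ((h.1.differentiable (by simp)) x).hasFDerivAt
  have hfd : ∀ {φ : Field}, IsTestField Ω φ → ∀ i x, fderiv ℝ (fun x => φ x i) x v =
      fderiv ℝ φ x v i := by
    intro φ h i x
    rw [(hd h i x).fderiv]; rfl
  have hc : ∀ {φ : Field}, IsTestField Ω φ → ∀ i, Continuous fun x => φ x i := by
    intro φ h i
    exact (EuclideanSpace.proj i : E3 →L[ℝ] ℝ).continuous.comp h.1.continuous
  have hcd : ∀ {φ : Field}, IsTestField Ω φ → ∀ i, Continuous fun x => fderiv ℝ φ x v i := by
    intro φ h i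
    exact (EuclideanSpace.proj i : E3 →L[ℝ] ℝ).continuous.comp
      ((h.1.continuous_fderiv (by simp)).clm_apply continuous_const)
  have hs : ∀ {φ : Field}, IsTestField Ω φ → ∀ i, HasCompactSupport fun x => φ x i := by
    intro φ h i
    exact h.2.1.comp_left (g := fun y : E3 => y i) rfl
  have hsd : ∀ {φ : Field}, IsTestField Ω φ → ∀ i, HasCompactSupport fun x => fderiv ℝ φ x v i := by
    intro φ h i
    exact (h.2.1.fderiv ℝ).comp_left (g := fun A : Tensor => A v i) rfl
  have := integral_mul_fderiv_eq_neg_fderiv_mul_of_integrable (μ := (volume : Measure E3))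
    (f := fun x => φ x i) (g := fun x => ψ x j) (v := v)
    (by simp only [hfd hφ]
        exact ((hcd hφ i).mul (hc hψ j)).integrable_of_hasCompactSupport ((hsd hφ i).mul_right))
    (by simp only [hfd hψ]
        exact ((hc hφ i).mul (hcd hψ j)).integrable_of_hasCompactSupport ((hs hφ i).mul_right))
    (((hc hφ i).mul (hc hψ j)).integrable_of_hasCompactSupport ((hs hφ i).mul_right))
    (fun x _ => (hd hφ i x).differentiableAt) (fun x _ => (hd hψ j x).differentiableAt)
  simpa only [hfd hφ, hfd hψ] using this

theorem IsTestField.setIntegral_eq {Ω : Set E3} {φ : Field} (hφ : IsTestField Ω φ) (g : E3 → ℝ)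
    (hg : ∀ x, φ x = 0 → g x = 0) : ∫ x in Ω, g x = ∫ x, g x := by
  apply setIntegral_eq_integral_of_forall_compl_eq_zero
  intro x hx
  exact hg x (image_eq_zero_of_notMem_tsupport fun h => hx (hφ.2.2 h))

/-- Integration by parts in each of the six products changes the sign, and the antisymmetry of the
curl changes it back. -/
theorem integral_inner_curl_comm {Ω : Set E3} {φ ψ : Field} (hφ : IsTestField Ω φ)
    (hψ : IsTestField Ω ψ) : ∫ x in Ω, ⟪φ x, curl ψ x⟫_ℝ = ∫ x in Ω, ⟪curl φ x, ψ x⟫_ℝ := by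
  rw [hφ.setIntegral_eq _ (fun x h => by simp [h]), hψ.setIntegral_eq _ (fun x h => by simp [h])]
  have hi : ∀ {φ ψ : Field}, IsTestField Ω φ → IsTestField Ω ψ → ∀ (v : E3) (i j : Fin 3),
      Integrable (fun x => φ x i * fderiv ℝ ψ x v j) := by
    intro φ ψ hφ hψ v i j
    have h1 : Continuous fun x => φ x i := by
      exact (EuclideanSpace.proj i : E3 →L[ℝ] ℝ).continuous.comp hφ.1.continuous
    have h2 : Continuous fun x => fderiv ℝ ψ x v j :=
      (EuclideanSpace.proj j : E3 →L[ℝ] ℝ).continuous.comp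
        ((hψ.1.continuous_fderiv (by simp)).clm_apply continuous_const)
    exact (h1.mul h2).integrable_of_hasCompactSupport
      ((hφ.2.1.comp_left (g := fun y : E3 => y i) rfl).mul_right)
  have hi' : ∀ (v : E3) (i j : Fin 3), Integrable (fun x => fderiv ℝ φ x v i * ψ x j) := by
    intro v i j
    simpa only [mul_comm] using hi hψ hφ v j i
  have e1 : ∀ x, ⟪φ x, curl ψ x⟫_ℝ =
      ((φ x 0 * fderiv ℝ ψ x (e 1) 2 - φ x 0 * fderiv ℝ ψ x (e 2) 1) +
      (φ x 1 * fderiv ℝ ψ x (e 2) 0 - φ x 1 * fderiv ℝ ψ x (e 0) 2)) +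
      (φ x 2 * fderiv ℝ ψ x (e 0) 1 - φ x 2 * fderiv ℝ ψ x (e 1) 0) := by
    intro x; rw [inner_eq_sum]; simp only [curl]; simp; ring
  have e2 : ∀ x, ⟪curl φ x, ψ x⟫_ℝ =
      ((fderiv ℝ φ x (e 1) 2 * ψ x 0 - fderiv ℝ φ x (e 2) 1 * ψ x 0) +
      (fderiv ℝ φ x (e 2) 0 * ψ x 1 - fderiv ℝ φ x (e 0) 2 * ψ x 1)) +
      (fderiv ℝ φ x (e 0) 1 * ψ x 2 - fderiv ℝ φ x (e 1) 0 * ψ x 2) := by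
    intro x; rw [inner_eq_sum]; simp only [curl]; simp; ring
  simp only [e1, e2]
  rw [integral_add, integral_add, integral_sub, integral_sub, integral_sub,
    integral_add, integral_add, integral_sub, integral_sub, integral_sub]
  · simp only [integral_mul_fderiv_comp hφ hψ]
    ring
  all_goals first
    | exact hi hφ hψ _ _ _
    | exact hi' _ _ _
    | exact (hi hφ hψ _ _ _).sub (hi hφ hψ _ _ _)
    | exact (hi' _ _ _).sub (hi' _ _ _)
    | exact ((hi hφ hψ _ _ _).sub (hi hφ hψ _ _ _)).add ((hi hφ hψ _ _ _).sub (hi hφ hψ _ _ _))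
    | exact ((hi' _ _ _).sub (hi' _ _ _)).add ((hi' _ _ _).sub (hi' _ _ _))

/-! ### The graph of the curl on `H₀(curl)` -/

/-- `(u, c)` is in the closure in `L² × L²` of the pairs `(φ, curl φ)` with `φ` a test field. -/
def H0Pair (Ω : Set E3) (u c : Field) : Prop :=
  MemLp u 2 (volume.restrict Ω) ∧ MemLp c 2 (volume.restrict Ω) ∧
    ∀ δ : ℝ≥0∞, 0 < δ → ∃ φ : Field, IsTestField Ω φ ∧
      eLpNorm (u - φ) 2 (volume.restrict Ω) ≤ δ ∧ eLpNorm (c - curl φ) 2 (volume.restrict Ω) ≤ δ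

variable {Ω : Set E3} {u v c w : Field}

theorem IsTestField.h0Pair {φ : Field} (h : IsTestField Ω φ) : H0Pair Ω φ (curl φ) :=
  ⟨h.memLp _, h.memLp_curl _, fun δ _ => ⟨φ, h, by simp, by simp⟩⟩

theorem H0Pair.congr (h : H0Pair Ω u c) (hu : u =ᵐ[volume.restrict Ω] v)
    (hc : c =ᵐ[volume.restrict Ω] w) : H0Pair Ω v w := by
  refine ⟨h.1.ae_eq hu, h.2.1.ae_eq hc, fun δ hδ => ?_⟩
  obtain ⟨φ, hφ, h1, h2⟩ := h.2.2 δ hδ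
  refine ⟨φ, hφ, ?_, ?_⟩
  · rwa [eLpNorm_congr_ae (hu.symm.sub (ae_eq_refl φ))]
  · rwa [eLpNorm_congr_ae (hc.symm.sub (ae_eq_refl _))]

/-- A closure is closed. This gives the closedness of the curl graph and the passage from test
fields to general pairs under pullback. -/
theorem h0Pair_of_approx (hu : MemLp u 2 (volume.restrict Ω)) (hc : MemLp c 2 (volume.restrict Ω))
    (h : ∀ δ : ℝ≥0∞, 0 < δ → ∃ v w : Field, H0Pair Ω v w ∧
      eLpNorm (u - v) 2 (volume.restrict Ω) ≤ δ ∧ eLpNorm (c - w) 2 (volume.restrict Ω) ≤ δ) :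
    H0Pair Ω u c := by
  refine ⟨hu, hc, fun δ hδ => ?_⟩
  have hδ2 : 0 < δ / 2 := ENNReal.half_pos hδ.ne'
  obtain ⟨v, w, hvw, h1, h2⟩ := h _ hδ2
  obtain ⟨φ, hφ, h3, h4⟩ := hvw.2.2 _ hδ2
  have key : ∀ {a b d : Field}, MemLp a 2 (volume.restrict Ω) → MemLp b 2 (volume.restrict Ω) →
      MemLp d 2 (volume.restrict Ω) → eLpNorm (a - b) 2 (volume.restrict Ω) ≤ δ / 2 →
      eLpNorm (b - d) 2 (volume.restrict Ω) ≤ δ / 2 →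
      eLpNorm (a - d) 2 (volume.restrict Ω) ≤ δ := by
    intro a b d ha hb hd h1 h2
    rw [show a - d = (a - b) + (b - d) by abel, ← ENNReal.add_halves δ]
    exact (eLpNorm_add_le (ha.1.sub hb.1) (hb.1.sub hd.1) one_le_two).trans (add_le_add h1 h2)
  exact ⟨φ, hφ, key hu hvw.1 (hφ.memLp _) h1 h3, key hc hvw.2.1 (hφ.memLp_curl _) h2 h4⟩

theorem curl_sub_smul {φ ψ : Field} (hφ : IsTestField Ω φ) (hψ : IsTestField Ω ψ) (a : ℝ) :
    curl (φ + a • ψ) = curl φ + a • curl ψ := by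
  funext x
  have h1 := (hφ.1.differentiable (by simp)) x
  have h2 := (hψ.1.differentiable (by simp)) x
  rw [Pi.add_apply, Pi.smul_apply, curl_eq, curl_eq, curl_eq, fderiv_add h1 (h2.const_smul a),
    fderiv_const_smul h2, map_add, map_smul]

theorem IsTestField.add_smul {φ ψ : Field} (hφ : IsTestField Ω φ) (hψ : IsTestField Ω ψ) (a : ℝ) :
    IsTestField Ω (φ + a • ψ) := by
  have h0 : tsupport (a • ψ) ⊆ tsupport ψ :=
    closure_mono (Function.support_const_smul_subset a ψ)
  refine ⟨hφ.1.add (contDiff_const.smul hψ.1), hφ.2.1.add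
    (hψ.2.1.of_isClosed_subset (isClosed_tsupport _) h0),
    (tsupport_add _ _).trans (Set.union_subset hφ.2.2 (h0.trans hψ.2.2))⟩

theorem H0Pair.add_smul {u₂ c₂ : Field} (h : H0Pair Ω u c) (h₂ : H0Pair Ω u₂ c₂) (a : ℝ) :
    H0Pair Ω (u + a • u₂) (c + a • c₂) := by
  refine ⟨h.1.add (h₂.1.const_smul a), h.2.1.add (h₂.2.1.const_smul a), fun δ hδ => ?_⟩
  have hδ2 : 0 < δ / 2 := ENNReal.half_pos hδ.ne'
  -- Adding 1 to the divisor covers `a = 0`.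
  have hη : 0 < δ / 2 / (‖a‖ₑ + 1) := ENNReal.div_pos hδ2.ne' (by simp)
  obtain ⟨φ, hφ, h1, h2⟩ := h.2.2 _ hδ2
  obtain ⟨ψ, hψ, h3, h4⟩ := h₂.2.2 _ hη
  have key : ∀ {f g f' g' : Field}, MemLp f 2 (volume.restrict Ω) → MemLp g 2 (volume.restrict Ω) →
      MemLp f' 2 (volume.restrict Ω) → MemLp g' 2 (volume.restrict Ω) →
      eLpNorm (f - f') 2 (volume.restrict Ω) ≤ δ / 2 →
      eLpNorm (g - g') 2 (volume.restrict Ω) ≤ δ / 2 / (‖a‖ₑ + 1) →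
      eLpNorm ((f + a • g) - (f' + a • g')) 2 (volume.restrict Ω) ≤ δ := by
    intro f g f' g' hf hg hf' hg' h1 h2
    rw [show (f + a • g) - (f' + a • g') = (f - f') + a • (g - g') by rw [smul_sub]; abel]
    refine (eLpNorm_add_le (hf.1.sub hf'.1) ((hg.1.sub hg'.1).const_smul a) one_le_two).trans ?_
    rw [eLpNorm_const_smul]
    refine (add_le_add h1 (mul_le_mul (le_self_add : ‖a‖ₑ ≤ ‖a‖ₑ + 1) h2 zero_le zero_le)).trans ?_
    rw [ENNReal.mul_div_cancel (by simp) (by simp), ENNReal.add_halves]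
  refine ⟨φ + a • ψ, hφ.add_smul hψ a, key h.1 h₂.1 (hφ.memLp _) (hψ.memLp _) h1 h3, ?_⟩
  rw [curl_sub_smul hφ hψ]
  exact key h.2.1 h₂.2.1 (hφ.memLp_curl _) (hψ.memLp_curl _) h2 h4

theorem H0Pair.sub {u₂ c₂ : Field} (h : H0Pair Ω u c) (h₂ : H0Pair Ω u₂ c₂) :
    H0Pair Ω (u - u₂) (c - c₂) := by
  simpa [sub_eq_add_neg] using h.add_smul h₂ (-1)

/-- The identity `integral_inner_curl_comm` for test fields is stable under L² convergence of the
field and of its curl. -/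
theorem H0Pair.hasWeakCurl (h : H0Pair Ω u c) : HasWeakCurl Ω u c := by
  refine ⟨h.2.1, fun ψ hψ => ?_⟩
  set μ := volume.restrict Ω
  have hψ1 := hψ.memLp μ
  have hψ2 := hψ.memLp_curl μ
  have key : ∀ r : ℝ, 0 < r →
      |∫ x, ⟪u x, curl ψ x⟫_ℝ ∂μ - ∫ x, ⟪c x, ψ x⟫_ℝ ∂μ| ≤ r * (l2 μ (curl ψ) + l2 μ ψ) := by
    intro r hr
    obtain ⟨φ, hφ, h1, h2⟩ := h.2.2 _ (ENNReal.ofReal_pos.2 hr)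
    have h3 : l2 μ (u - φ) ≤ r := ENNReal.toReal_le_of_le_ofReal hr.le h1
    have h4 : l2 μ (c - curl φ) ≤ r := ENNReal.toReal_le_of_le_ofReal hr.le h2
    have e1 := abs_integral_inner_le (h.1.sub (hφ.memLp μ)) hψ2
    have e2 := abs_integral_inner_le (h.2.1.sub (hφ.memLp_curl μ)) hψ1
    have e3 := integral_inner_curl_comm hφ hψ
    simp only [Pi.sub_apply, inner_sub_left] at e1 e2
    rw [integral_sub (integrable_inner h.1 hψ2) (integrable_inner (hφ.memLp μ) hψ2)] at e1
    rw [integral_sub (integrable_inner h.2.1 hψ1) (integrable_inner (hφ.memLp_curl μ) hψ1)] at e2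
    have b1 : l2 μ (u - φ) * l2 μ (curl ψ) ≤ r * l2 μ (curl ψ) := by gcongr; exact l2_nonneg _
    have b2 : l2 μ (c - curl φ) * l2 μ ψ ≤ r * l2 μ ψ := by gcongr; exact l2_nonneg _
    change (∫ x, ⟪φ x, curl ψ x⟫_ℝ ∂μ) = ∫ x, ⟪curl φ x, ψ x⟫_ℝ ∂μ at e3
    rw [abs_le] at e1 e2 ⊢
    constructor <;> linarith [e1.1, e1.2, e2.1, e2.2]
  have hz : |∫ x, ⟪u x, curl ψ x⟫_ℝ ∂μ - ∫ x, ⟪c x, ψ x⟫_ℝ ∂μ| ≤ 0 := by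
    have ht : Tendsto (fun r : ℝ => r * (l2 μ (curl ψ) + l2 μ ψ)) (𝓝[>] 0) (𝓝 0) := by
      have : Tendsto (fun r : ℝ => r * (l2 μ (curl ψ) + l2 μ ψ)) (𝓝 0)
        (𝓝 (0 * (l2 μ (curl ψ) + l2 μ ψ))) := tendsto_id.mul_const _
      rw [zero_mul] at this
      exact this.mono_left nhdsWithin_le_nhds
    refine ge_of_tendsto ht ?_
    filter_upwards [self_mem_nhdsWithin] with r hr using key r hr
  exact sub_eq_zero.1 (abs_nonpos_iff.1 hz)

/-- Fundamental lemma of the calculus of variations, one coordinate at a time with the test fields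
`g • e i`. -/
theorem HasWeakCurl.unique (hΩ : IsOpen Ω) (h : HasWeakCurl Ω u c) (h₂ : HasWeakCurl Ω u w) :
    c =ᵐ[volume.restrict Ω] w := by
  have hcw := h.1.sub h₂.1
  have h0 : ∀ᵐ x ∂volume, x ∈ Ω → (c - w) x = 0 := by
    refine hΩ.ae_eq_zero_of_integral_contDiff_smul_eq_zero ?_ ?_
    · exact locallyIntegrableOn_of_locallyIntegrable_restrict
        (hcw.locallyIntegrable one_le_two)
    · intro g hg hgc hgs
      have ht : ∀ i, IsTestField Ω (fun x => g x • e i) := fun i =>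
        ⟨hg.smul contDiff_const, hgc.smul_right,
          (closure_mono (Function.support_smul_subset_left g _)).trans hgs⟩
      have hs : ∫ x, g x • (c - w) x = ∫ x in Ω, g x • (c - w) x := by
        symm
        apply setIntegral_eq_integral_of_forall_compl_eq_zero
        intro x hx
        rw [image_eq_zero_of_notMem_tsupport fun h => hx (hgs h), zero_smul]
      have hgi : Integrable (fun x => g x • (c - w) x) (volume.restrict Ω) := by
        have := (hg.continuous.memLp_of_hasCompactSupport (p := 2) (μ := volume.restrict Ω) hgc)
        exact memLp_one_iff_integrable.1 (hcw.smul this)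
      rw [hs]
      ext i
      have hp := (EuclideanSpace.proj i : E3 →L[ℝ] ℝ).integral_comp_comm hgi
      change _ = (0 : ℝ)
      rw [show ∀ y : E3, y i = (EuclideanSpace.proj i : E3 →L[ℝ] ℝ) y from fun _ => rfl, ← hp]
      have e1 := (h.2 _ (ht i)).symm.trans (h₂.2 _ (ht i))
      rw [← sub_eq_zero, ← integral_sub (integrable_inner h.1 ((ht i).memLp _))
        (integrable_inner h₂.1 ((ht i).memLp _))] at e1
      rw [← e1]
      congr 1
      funext x
      simp [e, inner_smul_right, EuclideanSpace.inner_single_right, mul_sub]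
  filter_upwards [ae_restrict_of_ae h0, ae_restrict_mem hΩ.measurableSet] with x hx hxΩ
  exact sub_eq_zero.1 (hx hxΩ)

theorem hasWeakCurl_weakCurl (h : ∃ c, HasWeakCurl Ω u c) : HasWeakCurl Ω u (weakCurl Ω u) := by
  rw [weakCurl, dif_pos h]
  exact h.choose_spec

theorem MemH0curl.h0Pair (h : MemH0curl Ω u) : H0Pair Ω u (weakCurl Ω u) :=
  ⟨h.1.1, (hasWeakCurl_weakCurl h.1.2).1, h.2⟩

/-- With this, the arbitrary choice in `weakCurl` never matters: any second component of a pair may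
replace it under an integral. -/
theorem H0Pair.weakCurl_ae_eq (hΩ : IsOpen Ω) (h : H0Pair Ω u c) :
    weakCurl Ω u =ᵐ[volume.restrict Ω] c :=
  (hasWeakCurl_weakCurl ⟨c, h.hasWeakCurl⟩).unique hΩ h.hasWeakCurl

theorem H0Pair.memH0curl (hΩ : IsOpen Ω) (h : H0Pair Ω u c) : MemH0curl Ω u := by
  have := h.congr (ae_eq_refl u) (h.weakCurl_ae_eq hΩ).symm
  exact ⟨⟨h.1, c, h.hasWeakCurl⟩, this.2.2⟩

end HTS

namespace HTS

/-! ### Strongly monotone operators -/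

/-- A Lipschitz, strongly monotone map of a real Hilbert space is onto. -/
theorem surjective_of_stronglyMonotone {H : Type*} [NormedAddCommGroup H] [InnerProductSpace ℝ H]
    [CompleteSpace H] {A : H → H} {m L : ℝ} (hm : 0 < m) (hL : ∀ u v, ‖A u - A v‖ ≤ L * ‖u - v‖)
    (hA : ∀ u v, m * ‖u - v‖ ^ 2 ≤ ⟪A u - A v, u - v⟫_ℝ) : Function.Surjective A := by
  intro f
  -- Enlarging the Lipschitz constant makes it positive and forces `m / l ≤ 1`, so the square root
  -- below has a nonnegative argument.
  set l := max L m with hl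
  have hml : m ≤ l := le_max_right _ _
  have hl0 : 0 < l := hm.trans_le hml
  have hL' : ∀ u v, ‖A u - A v‖ ≤ l * ‖u - v‖ := fun u v =>
    (hL u v).trans (by gcongr; exact le_max_left _ _)
  -- This step size minimises `1 - 2 ρ m + ρ² l²`, the bound for the squared contraction factor; the
  -- minimum is `1 - (m / l) ^ 2`.
  set ρ := m / l ^ 2 with hρ
  have hρ0 : 0 < ρ := by positivity
  have hq : (m / l) ^ 2 ≤ 1 := by
    rw [sq_le_one_iff₀ (by positivity), div_le_one hl0]; exact hml
  set k : ℝ := Real.sqrt (1 - (m / l) ^ 2) with hk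
  have hk1 : k < 1 := by
    rw [hk, Real.sqrt_lt' one_pos]
    have : 0 < (m / l) ^ 2 := by positivity
    linarith
  have hkk : k ^ 2 = 1 - (m / l) ^ 2 := Real.sq_sqrt (by linarith)
  have hc : ContractingWith k.toNNReal (fun u => u - ρ • (A u - f)) := by
    refine ⟨by rw [← NNReal.coe_lt_coe, Real.coe_toNNReal _ (Real.sqrt_nonneg _)]; exact hk1, ?_⟩
    refine LipschitzWith.of_dist_le_mul fun u v => ?_
    rw [dist_eq_norm, dist_eq_norm, Real.coe_toNNReal _ (Real.sqrt_nonneg _)]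
    refine abs_le_of_sq_le_sq' ?_ (by positivity) |>.2
    have e1 : u - ρ • (A u - f) - (v - ρ • (A v - f)) = (u - v) - ρ • (A u - A v) := by
      simp only [smul_sub]; abel
    rw [e1, norm_sub_sq_real, inner_smul_right, real_inner_comm, norm_smul, mul_pow, mul_pow, hkk,
      Real.norm_eq_abs, sq_abs]
    have h1 : ‖A u - A v‖ ^ 2 ≤ (l * ‖u - v‖) ^ 2 := by gcongr; exact hL' u v
    have h2 := mul_le_mul_of_nonneg_left (hA u v) hρ0.le
    have h3 := mul_le_mul_of_nonneg_left h1 (sq_nonneg ρ)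
    have h4 : ρ * (m * ‖u - v‖ ^ 2) = (m / l) ^ 2 * ‖u - v‖ ^ 2 := by
      rw [hρ]; field_simp
    have h5 : ρ ^ 2 * (l * ‖u - v‖) ^ 2 = (m / l) ^ 2 * ‖u - v‖ ^ 2 := by
      rw [hρ]; field_simp
    rw [h4] at h2
    rw [h5] at h3
    linarith
  obtain ⟨u, hu⟩ : ∃ u, u - ρ • (A u - f) = u := ⟨_, hc.fixedPoint_isFixedPt⟩
  refine ⟨u, ?_⟩
  rw [sub_eq_self, smul_eq_zero] at hu
  exact sub_eq_zero.1 (hu.resolve_left hρ0.ne')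

/-- Galerkin form: a Lipschitz, strongly monotone operator equation is solvable in every closed
subspace. -/
theorem exists_mem_forall_inner_eq {H : Type*} [NormedAddCommGroup H] [InnerProductSpace ℝ H]
    [CompleteSpace H] (V : Submodule ℝ H) (hV : IsClosed (V : Set H)) {A : H → H} {m L : ℝ}
    (hm : 0 < m) (hL : ∀ u v, ‖A u - A v‖ ≤ L * ‖u - v‖)
    (hA : ∀ u v, m * ‖u - v‖ ^ 2 ≤ ⟪A u - A v, u - v⟫_ℝ) (f : H) :
    ∃ p ∈ V, ∀ q ∈ V, ⟪A p, q⟫_ℝ = ⟪f, q⟫_ℝ := by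
  have : CompleteSpace V := hV.completeSpace_coe
  -- Compressing `A` to `V` by the orthogonal projection keeps both constants, since the projection
  -- is a contraction and is invisible in inner products with elements of `V`.
  obtain ⟨p, hp⟩ := surjective_of_stronglyMonotone (A := fun p : V => V.orthogonalProjectionOnto (A p))
    (L := L) hm (fun u v => by
      rw [← map_sub]
      exact (V.norm_orthogonalProjectionOnto_apply_le _).trans (hL u v))
    (fun u v => by
      rw [← map_sub, Submodule.inner_orthogonalProjectionOnto_eq_of_mem_right]
      exact hA u v)
    (V.orthogonalProjectionOnto f)
  refine ⟨p, p.2, fun q hq => ?_⟩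
  have h := congrArg (fun r => ⟪r, (⟨q, hq⟩ : V)⟫_ℝ) hp
  simpa only [Submodule.inner_orthogonalProjectionOnto_eq_of_mem_right] using h

/-- `N` induces a Lipschitz, strongly monotone superposition operator on `L²`. -/
structure IsMonotoneOp (μ : Measure E3) (N : E3 → E3 → E3) (m L : ℝ) : Prop where
  meas : ∀ u : Field, AEStronglyMeasurable u μ → AEStronglyMeasurable (fun x => N x (u x)) μ
  zero : ∀ᵐ x ∂μ, N x 0 = 0
  lip : ∀ᵐ x ∂μ, ∀ a b, ‖N x a - N x b‖ ≤ L * ‖a - b‖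
  mono : ∀ᵐ x ∂μ, ∀ a b, m * ‖a - b‖ ^ 2 ≤ ⟪N x a - N x b, a - b⟫_ℝ

namespace IsMonotoneOp

variable {μ : Measure E3} {N : E3 → E3 → E3} {m L : ℝ}

theorem memLp (h : IsMonotoneOp μ N m L) {u : Field} (hu : MemLp u 2 μ) :
    MemLp (fun x => N x (u x)) 2 μ := by
  refine hu.of_le_mul (c := L) (h.meas u hu.1) ?_
  filter_upwards [h.zero, h.lip] with x h0 h1
  simpa [h0] using h1 (u x) 0

theorem le_integral (h : IsMonotoneOp μ N m L) {u v : Field} (hu : MemLp u 2 μ)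
    (hv : MemLp v 2 μ) :
    m * l2 μ (u - v) ^ 2 ≤ ∫ x, ⟪N x (u x) - N x (v x), u x - v x⟫_ℝ ∂μ := by
  rw [l2_sq (hu.sub hv), ← integral_const_mul]
  refine integral_mono_ae ((hu.sub hv).integrable_norm_pow (by norm_num) |>.const_mul m)
    (integrable_inner ((h.memLp hu).sub (h.memLp hv)) (hu.sub hv)) ?_
  filter_upwards [h.mono] with x hx using hx _ _

/-- The superposition operator on `L²`. -/
noncomputable def op (h : IsMonotoneOp μ N m L) (u : Lp E3 2 μ) : Lp E3 2 μ :=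
  (h.memLp (Lp.memLp u)).toLp _

theorem coeFn_op (h : IsMonotoneOp μ N m L) (u : Lp E3 2 μ) : h.op u =ᵐ[μ] fun x => N x (u x) :=
  MemLp.coeFn_toLp _

theorem norm_op_sub_le (h : IsMonotoneOp μ N m L) (u v : Lp E3 2 μ) :
    ‖h.op u - h.op v‖ ≤ L * ‖u - v‖ := by
  refine Lp.norm_le_mul_norm_of_ae_le_mul ?_
  filter_upwards [h.lip, h.coeFn_op u, h.coeFn_op v, Lp.coeFn_sub u v,
    Lp.coeFn_sub (h.op u) (h.op v)] with x h1 h2 h3 h4 h5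
  rw [h4, h5, Pi.sub_apply, Pi.sub_apply, h2, h3]
  exact h1 _ _

theorem le_inner_op (h : IsMonotoneOp μ N m L) (u v : Lp E3 2 μ) :
    m * ‖u - v‖ ^ 2 ≤ ⟪h.op u - h.op v, u - v⟫_ℝ := by
  have h1 := h.le_integral (Lp.memLp u) (Lp.memLp v)
  have e1 : l2 μ (⇑u - ⇑v) = ‖u - v‖ := by
    rw [Lp.norm_def, ← l2, l2_congr (Lp.coeFn_sub u v)]
  rw [e1] at h1
  refine h1.trans_eq ?_
  rw [L2.inner_def]
  refine integral_congr_ae ?_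
  filter_upwards [h.coeFn_op u, h.coeFn_op v, Lp.coeFn_sub u v,
    Lp.coeFn_sub (h.op u) (h.op v)] with x h2 h3 h4 h5
  rw [h4, h5, Pi.sub_apply, Pi.sub_apply, h2, h3]

end IsMonotoneOp

/-! ### Solvability of monotone curl-curl equations -/

/-- The graph of the curl on `H₀(curl)`, as a subspace of `L² × L²`. -/
noncomputable def h0Graph (Ω : Set E3) :
    Submodule ℝ (WithLp 2 (Lp E3 2 (volume.restrict Ω) × Lp E3 2 (volume.restrict Ω))) where
  carrier := {p | H0Pair Ω p.fst p.snd}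
  add_mem' := by
    intro p q hp hq
    have := H0Pair.add_smul hp hq 1
    simp only [one_smul] at this
    exact this.congr (Lp.coeFn_add _ _).symm (Lp.coeFn_add _ _).symm
  zero_mem' := by
    have h : IsTestField Ω 0 :=
      ⟨contDiff_const, HasCompactSupport.zero, by
        rw [show tsupport (0 : Field) = ∅ from tsupport_eq_empty_iff.mpr rfl]
        exact Set.empty_subset _⟩
    have hc : curl 0 = 0 := by
      funext x
      rw [curl_eq, show (0 : Field) = fun _ => 0 from rfl, fderiv_fun_const]
      simp
    have := h.h0Pair
    rw [hc] at this
    exact this.congr (Lp.coeFn_zero _ _ _).symm (Lp.coeFn_zero _ _ _).symm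
  smul_mem' := by
    intro a p hp
    have h := (H0Pair.add_smul hp hp (a - 1))
    have e : ∀ f : Field, f + (a - 1) • f = a • f := fun f => by rw [sub_smul, one_smul]; abel
    rw [e, e] at h
    exact h.congr (Lp.coeFn_smul _ _).symm (Lp.coeFn_smul _ _).symm

theorem isClosed_h0Graph (Ω : Set E3) : IsClosed (h0Graph Ω : Set (WithLp 2 (Lp E3 2
    (volume.restrict Ω) × Lp E3 2 (volume.restrict Ω)))) := by
  refine isClosed_of_closure_subset fun p hp => ?_
  refine h0Pair_of_approx (Lp.memLp _) (Lp.memLp _) fun δ hδ => ?_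
  rw [EMetric.mem_closure_iff] at hp
  obtain ⟨q, hq, hpq⟩ := hp δ hδ
  have hle : ∀ f g : Lp E3 2 (volume.restrict Ω), ‖f - g‖ ≤ ‖p - q‖ →
      eLpNorm (⇑f - ⇑g) 2 (volume.restrict Ω) ≤ δ := by
    intro f g h
    rw [← Lp.edist_def]
    refine le_trans ?_ hpq.le
    rw [edist_eq_enorm_sub, edist_eq_enorm_sub, ← ofReal_norm, ← ofReal_norm]
    exact ENNReal.ofReal_le_ofReal h
  have hs : ‖p - q‖ ^ 2 = ‖p.fst - q.fst‖ ^ 2 + ‖p.snd - q.snd‖ ^ 2 := by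
    rw [WithLp.prod_norm_sq_eq_of_L2]; rfl
  exact ⟨q.fst, q.snd, hq,
    hle _ _ (abs_le_of_sq_le_sq' (by rw [hs]; linarith [sq_nonneg ‖p.snd - q.snd‖])
      (norm_nonneg _)).2,
    hle _ _ (abs_le_of_sq_le_sq' (by rw [hs]; linarith [sq_nonneg ‖p.fst - q.fst‖])
      (norm_nonneg _)).2⟩

/-- The weak form is an operator equation for the diagonal operator `(N₁, N₂)` on L² × L², tested on
the graph of the curl. Monotonicity in both components gives coercivity in the graph norm, so no
Poincaré inequality enters. -/
theorem exists_h0Pair_solution {Ω : Set E3} {N₁ N₂ : E3 → E3 → E3} {m L : ℝ}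
    (hm : 0 < m) (h₁ : IsMonotoneOp (volume.restrict Ω) N₁ m L)
    (h₂ : IsMonotoneOp (volume.restrict Ω) N₂ m L) {g : Field}
    (hg : MemLp g 2 (volume.restrict Ω)) :
    ∃ u c : Field, H0Pair Ω u c ∧ ∀ v d : Field, H0Pair Ω v d →
      (∫ x in Ω, ⟪N₂ x (c x), d x⟫_ℝ) + ∫ x in Ω, ⟪N₁ x (u x), v x⟫_ℝ =
        ∫ x in Ω, ⟪g x, v x⟫_ℝ := by
  have hin : ∀ x y : WithLp 2 (Lp E3 2 (volume.restrict Ω) × Lp E3 2 (volume.restrict Ω)),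
      ⟪x, y⟫_ℝ = ⟪x.fst, y.fst⟫_ℝ + ⟪x.snd, y.snd⟫_ℝ := fun x y => WithLp.prod_inner_apply x y
  have hnorm : ∀ x : WithLp 2 (Lp E3 2 (volume.restrict Ω) × Lp E3 2 (volume.restrict Ω)),
      ‖x‖ ^ 2 = ‖x.fst‖ ^ 2 + ‖x.snd‖ ^ 2 := fun x => WithLp.prod_norm_sq_eq_of_L2 x
  obtain ⟨p, hp, hpq⟩ := exists_mem_forall_inner_eq (h0Graph Ω) (isClosed_h0Graph Ω)
    (A := fun p => WithLp.toLp 2 (h₁.op p.fst, h₂.op p.snd)) (L := |L|) hm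
    (fun u v => by
      refine (abs_le_of_sq_le_sq' ?_ (by positivity)).2
      rw [mul_pow, hnorm, hnorm, mul_add, ← mul_pow, ← mul_pow]
      have e1 := (h₁.norm_op_sub_le u.fst v.fst).trans
        (mul_le_mul_of_nonneg_right (le_abs_self L) (norm_nonneg _))
      have e2 := (h₂.norm_op_sub_le u.snd v.snd).trans
        (mul_le_mul_of_nonneg_right (le_abs_self L) (norm_nonneg _))
      exact add_le_add (pow_le_pow_left₀ (norm_nonneg _) e1 2)
        (pow_le_pow_left₀ (norm_nonneg _) e2 2))
    (fun u v => by
      rw [hin, hnorm, mul_add]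
      exact add_le_add (h₁.le_inner_op _ _) (h₂.le_inner_op _ _))
    (WithLp.toLp 2 (hg.toLp g, 0))
  refine ⟨p.fst, p.snd, hp, fun v d hvd => ?_⟩
  obtain ⟨hv, hd⟩ : MemLp v 2 (volume.restrict Ω) ∧ MemLp d 2 (volume.restrict Ω) :=
    ⟨hvd.1, hvd.2.1⟩
  have c1 := hv.coeFn_toLp
  have c2 := hd.coeFn_toLp
  have hq : WithLp.toLp 2 (hv.toLp v, hd.toLp d) ∈ h0Graph Ω := hvd.congr c1.symm c2.symm
  have h : ⟪h₁.op p.fst, hv.toLp v⟫_ℝ + ⟪h₂.op p.snd, hd.toLp d⟫_ℝ =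
      ⟪hg.toLp g, hv.toLp v⟫_ℝ + ⟪0, hd.toLp d⟫_ℝ :=
    (hin _ _).symm.trans ((hpq _ hq).trans (hin _ _))
  rw [inner_zero_left, add_zero, L2.inner_def, L2.inner_def, L2.inner_def, add_comm] at h
  have e1 : ∫ x in Ω, ⟪h₂.op p.snd x, hd.toLp d x⟫_ℝ = ∫ x in Ω, ⟪N₂ x (p.snd x), d x⟫_ℝ :=
    integral_congr_ae (by filter_upwards [c2, h₂.coeFn_op p.snd] with x a b; rw [a, b])
  have e2 : ∫ x in Ω, ⟪h₁.op p.fst x, hv.toLp v x⟫_ℝ = ∫ x in Ω, ⟪N₁ x (p.fst x), v x⟫_ℝ :=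
    integral_congr_ae (by filter_upwards [c1, h₁.coeFn_op p.fst] with x a b; rw [a, b])
  have e3 : ∫ x in Ω, ⟪hg.toLp g x, hv.toLp v x⟫_ℝ = ∫ x in Ω, ⟪g x, v x⟫_ℝ :=
    integral_congr_ae (by filter_upwards [c1, hg.coeFn_toLp] with x a b; rw [a, b])
  rw [e1, e2, e3] at h
  exact h

end HTS

namespace HTS

/-! ### The regularized maximum and the dual variable map -/

/-- The derivative of the regularized maximum. -/
noncomputable def maxRegDeriv (γ x : ℝ) : ℝ :=
  (if 1 + 1 / (2 * γ) ≤ x then 1 else 0) +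
    γ * (x - 1 + 1 / (2 * γ)) * (if |x - 1| < 1 / (2 * γ) then 1 else 0)

section MaxReg

variable {γ : ℝ}

/-- In terms of squared positive parts the three branches merge into one formula, and continuous
differentiability across the two junctions becomes that of `max 0 t ^ 2`. -/
theorem maxReg_eq (hγ : 0 < γ) (x : ℝ) :
    maxReg γ x = 1 + γ / 2 * max 0 (x - 1 + 1 / (2 * γ)) ^ 2 -
      γ / 2 * max 0 (x - 1 - 1 / (2 * γ)) ^ 2 := by
  have h0 : 0 < 1 / (2 * γ) := by positivity
  rw [maxReg]
  split_ifs with h1 h2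
  · rw [max_eq_right (by linarith), max_eq_right (by linarith)]
    field_simp; ring
  · rw [abs_le] at h2
    rw [max_eq_right (by linarith), max_eq_left (by linarith)]
    ring
  · rw [max_eq_left, max_eq_left]
    · ring
    · linarith
    · by_contra hc
      exact h2 (abs_le.2 ⟨by linarith, by linarith⟩)

theorem maxRegDeriv_eq (hγ : 0 < γ) (x : ℝ) :
    maxRegDeriv γ x = γ * max 0 (x - 1 + 1 / (2 * γ)) - γ * max 0 (x - 1 - 1 / (2 * γ)) := by
  have h0 : 0 < 1 / (2 * γ) := by positivity
  rw [maxRegDeriv]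
  by_cases h1 : 1 + 1 / (2 * γ) ≤ x
  · have h2 : ¬ |x - 1| < 1 / (2 * γ) := fun h => by rw [abs_lt] at h; linarith
    rw [if_pos h1, if_neg h2, max_eq_right (by linarith), max_eq_right (by linarith)]
    field_simp; ring
  · rw [if_neg h1, max_eq_left (a := 0) (b := x - 1 - 1 / (2 * γ)) (by linarith)]
    split_ifs with h2
    · rw [abs_lt] at h2
      rw [max_eq_right (by linarith)]; ring
    · rw [max_eq_left]
      · ring
      · by_contra hc
        exact h2 (abs_lt.2 ⟨by linarith, by linarith⟩)

theorem hasDerivAt_max_zero_sq (x : ℝ) :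
    HasDerivAt (fun t : ℝ => max 0 t ^ 2) (2 * max 0 x) x := by
  rcases lt_trichotomy x 0 with h | h | h
  · rw [max_eq_left h.le, mul_zero]
    refine (hasDerivAt_const x (0 : ℝ)).congr_of_eventuallyEq ?_
    filter_upwards [gt_mem_nhds h] with t ht
    rw [max_eq_left (le_of_lt ht)]; norm_num
  · subst h
    rw [max_self, mul_zero, hasDerivAt_iff_isLittleO]
    simp only [max_self, sub_zero, smul_zero]
    have h1 : (fun t : ℝ => max 0 t ^ 2 - 0 ^ 2) =O[𝓝 0] fun t : ℝ => t ^ 2 := by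
      refine Asymptotics.IsBigO.of_bound 1 (Eventually.of_forall fun t => ?_)
      rw [one_mul, Real.norm_eq_abs, Real.norm_eq_abs]
      refine abs_le_abs_of_nonneg (by simp) ?_
      rcases le_total t 0 with ht | ht
      · rw [max_eq_left ht]; simpa using sq_nonneg t
      · rw [max_eq_right ht]; simp
    exact h1.trans_isLittleO (by simpa using Asymptotics.isLittleO_pow_id (𝕜 := ℝ) one_lt_two)
  · rw [max_eq_right h.le]
    have := (hasDerivAt_id x).pow 2
    simp only [id, Nat.cast_ofNat, Nat.add_one_sub_one, pow_one, mul_one] at this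
    refine HasDerivAt.congr_of_eventuallyEq this ?_
    filter_upwards [lt_mem_nhds h] with t ht
    simp [max_eq_right (le_of_lt ht)]

theorem hasDerivAt_maxReg (hγ : 0 < γ) (x : ℝ) : HasDerivAt (maxReg γ) (maxRegDeriv γ x) x := by
  rw [show maxReg γ = _ from funext (maxReg_eq hγ), maxRegDeriv_eq hγ]
  have h1 := (hasDerivAt_max_zero_sq (x - 1 + 1 / (2 * γ))).comp x
    (((hasDerivAt_id x).sub_const 1).add_const (1 / (2 * γ)))
  have h2 := (hasDerivAt_max_zero_sq (x - 1 - 1 / (2 * γ))).comp x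
    (((hasDerivAt_id x).sub_const 1).sub_const (1 / (2 * γ)))
  have h3 := ((h1.const_mul (γ / 2)).const_add 1).sub (h2.const_mul (γ / 2))
  exact h3.congr_deriv (by ring)

theorem one_le_maxReg (hγ : 0 < γ) (x : ℝ) : 1 ≤ maxReg γ x := by
  have h0 : 0 < 1 / (2 * γ) := by positivity
  rw [maxReg]
  split_ifs with h1 h2
  · linarith
  · have : 0 ≤ γ / 2 * (x - 1 + 1 / (2 * γ)) ^ 2 := by positivity
    linarith
  · exact le_rfl

theorem maxRegDeriv_nonneg (hγ : 0 < γ) (x : ℝ) : 0 ≤ maxRegDeriv γ x := by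
  have h0 : 0 < 1 / (2 * γ) := by positivity
  rw [maxRegDeriv_eq hγ, ← mul_sub]
  refine mul_nonneg hγ.le (sub_nonneg.2 (max_le_max le_rfl (by linarith)))

/-- This inequality is what makes `Lam` monotone: the radial slope of `s / maxReg γ s` has the sign
of `maxReg γ s - s * maxRegDeriv γ s`. On the linear branch there is equality. -/
theorem mul_maxRegDeriv_le (hγ : 0 < γ) (x : ℝ) : x * maxRegDeriv γ x ≤ maxReg γ x := by
  have h0 : 0 < 1 / (2 * γ) := by positivity
  have hg : γ * (1 / (2 * γ)) = 1 / 2 := by field_simp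
  rw [maxRegDeriv_eq hγ, maxReg_eq hγ]
  set b := 1 / (2 * γ)
  rcases le_total (x - 1 + b) 0 with h1 | h1
  · rw [max_eq_left h1, max_eq_left (by linarith)]; simp
  · rw [max_eq_right h1]
    rcases le_total (x - 1 - b) 0 with h2 | h2
    · rw [max_eq_left h2]
      -- On the quadratic branch, with `s = x - 1 + b` in `[0, 2b]` and `γ b = 1/2`, the difference
      -- factors as `(1 - γ s)(1 + s / 2)`, and both factors are nonnegative.
      have e : 1 + γ / 2 * (x - 1 + b) ^ 2 - γ / 2 * 0 ^ 2 - x * (γ * (x - 1 + b) - γ * 0) =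
          (1 - γ * (x - 1 + b)) * (1 + (x - 1 + b) / 2) +
            (x - 1 + b) * (γ * b - 1 / 2) := by ring
      have h3 : γ * (x - 1 + b) ≤ γ * (b + b) := by gcongr; linarith
      have h4 : 0 ≤ (1 - γ * (x - 1 + b)) * (1 + (x - 1 + b) / 2) :=
        mul_nonneg (by linarith) (by linarith)
      rw [hg, sub_self, mul_zero] at e
      linarith
    · rw [max_eq_right h2]
      have e : 1 + γ / 2 * (x - 1 + b) ^ 2 - γ / 2 * (x - 1 - b) ^ 2 -
          x * (γ * (x - 1 + b) - γ * (x - 1 - b)) = 1 - 2 * (γ * b) := by ring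
      rw [hg] at e
      linarith

end MaxReg

section Lam

variable {jc γ : ℝ}

/-- The coefficient of `-a ⊗ a` in `ψ^γ(a)`. -/
noncomputable def psiCoeff (jc γ : ℝ) (a : E3) : ℝ :=
  γ * maxRegDeriv γ (γ * ‖a‖) / (maxReg γ (γ * ‖a‖) * ‖a‖) * (jc * γ / maxReg γ (γ * ‖a‖))

/-- Since `Lam` is radial, `psi` is a multiple of the identity minus a multiple of `a ⊗ a`.
Symmetry, sign and norm bounds are all read off from this form. -/
theorem psi_apply (a z : E3) :
    psi jc γ a z = (jc * γ / maxReg γ (γ * ‖a‖)) • z - (psiCoeff jc γ a * ⟪a, z⟫_ℝ) • a := by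
  simp only [psi, Lam, outer, psiCoeff, maxRegDeriv, _root_.sub_apply,
    _root_.smul_apply, ContinuousLinearMap.id_apply,
    InnerProductSpace.rankOne_apply, real_inner_smul_left, smul_smul]
  congr 2
  ring

theorem psiCoeff_nonneg (hj : 0 < jc) (hγ : 0 < γ) (a : E3) : 0 ≤ psiCoeff jc γ a := by
  have h1 := one_le_maxReg hγ (γ * ‖a‖)
  have h2 := maxRegDeriv_nonneg hγ (γ * ‖a‖)
  have h3 : 0 < maxReg γ (γ * ‖a‖) := by linarith
  rw [psiCoeff]
  positivity

/-- The eigenvalue of `psi` in the radial direction is the right side minus the left side, so this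
is `mul_maxRegDeriv_le` in disguise. At `a = 0` the division by the norm gives 0. -/
theorem psiCoeff_mul_le (hj : 0 < jc) (hγ : 0 < γ) (a : E3) :
    psiCoeff jc γ a * ‖a‖ ^ 2 ≤ jc * γ / maxReg γ (γ * ‖a‖) := by
  have h1 := one_le_maxReg hγ (γ * ‖a‖)
  have h2 := mul_maxRegDeriv_le hγ (γ * ‖a‖)
  have h3 : 0 < maxReg γ (γ * ‖a‖) := by linarith
  have hc : 0 ≤ jc * γ / maxReg γ (γ * ‖a‖) := by positivity
  rcases eq_or_ne a 0 with h | h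
  · subst h; simpa using hc
  · have h4 : 0 < ‖a‖ := norm_pos_iff.2 h
    rw [psiCoeff]
    calc _ = (γ * ‖a‖ * maxRegDeriv γ (γ * ‖a‖) / maxReg γ (γ * ‖a‖)) *
          (jc * γ / maxReg γ (γ * ‖a‖)) := by field_simp
      _ ≤ 1 * (jc * γ / maxReg γ (γ * ‖a‖)) := by
          gcongr
          rw [div_le_one h3]; exact h2
      _ = _ := one_mul _

theorem inner_psi_nonneg (hj : 0 < jc) (hγ : 0 < γ) (a z : E3) : 0 ≤ ⟪psi jc γ a z, z⟫_ℝ := by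
  rw [psi_apply, inner_sub_left, real_inner_smul_left, real_inner_smul_left,
    real_inner_self_eq_norm_sq]
  have h1 := psiCoeff_mul_le hj hγ a
  have h2 : ⟪a, z⟫_ℝ * ⟪a, z⟫_ℝ ≤ ‖a‖ ^ 2 * ‖z‖ ^ 2 := by
    have := abs_real_inner_le_norm a z
    rw [← pow_two, ← mul_pow]
    exact sq_le_sq.2 (by rwa [abs_of_nonneg (by positivity : 0 ≤ ‖a‖ * ‖z‖)])
  have h3 := mul_le_mul_of_nonneg_left h2 (psiCoeff_nonneg hj hγ a)
  have h4 := mul_le_mul_of_nonneg_right h1 (sq_nonneg ‖z‖)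
  linarith

theorem inner_psi_comm (a y z : E3) : ⟪psi jc γ a y, z⟫_ℝ = ⟪y, psi jc γ a z⟫_ℝ := by
  rw [psi_apply, psi_apply, inner_sub_left, inner_sub_right]
  simp only [real_inner_smul_left, real_inner_smul_right]
  rw [real_inner_comm y a]
  ring

theorem norm_psi_apply_le (hj : 0 < jc) (hγ : 0 < γ) (a z : E3) :
    ‖psi jc γ a z‖ ≤ 2 * (jc * γ) * ‖z‖ := by
  have h1 := psiCoeff_mul_le hj hγ a
  have h0 := one_le_maxReg hγ (γ * ‖a‖)
  have hc : jc * γ / maxReg γ (γ * ‖a‖) ≤ jc * γ := div_le_self (by positivity) h0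
  have hc0 : 0 ≤ jc * γ / maxReg γ (γ * ‖a‖) := by positivity
  rw [psi_apply]
  refine (norm_sub_le _ _).trans ?_
  rw [norm_smul, norm_smul, norm_mul, Real.norm_of_nonneg hc0,
    Real.norm_of_nonneg (psiCoeff_nonneg hj hγ a)]
  have h2 : psiCoeff jc γ a * ‖⟪a, z⟫_ℝ‖ * ‖a‖ ≤ psiCoeff jc γ a * (‖a‖ * ‖z‖) * ‖a‖ := by
    gcongr
    · exact psiCoeff_nonneg hj hγ a
    · exact norm_inner_le_norm a z
  have h3 : psiCoeff jc γ a * (‖a‖ * ‖z‖) * ‖a‖ = psiCoeff jc γ a * ‖a‖ ^ 2 * ‖z‖ := by ring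
  have h4 : psiCoeff jc γ a * ‖a‖ ^ 2 * ‖z‖ ≤ jc * γ * ‖z‖ :=
    mul_le_mul_of_nonneg_right (h1.trans hc) (norm_nonneg z)
  have h5 : jc * γ / maxReg γ (γ * ‖a‖) * ‖z‖ ≤ jc * γ * ‖z‖ := by gcongr
  linarith

/-- Away from the origin this is the chain rule. At the origin the norm is not differentiable, and
for small `γ` the scalar factor need not be constant nearby. Continuity of that factor suffices,
because it multiplies a vector that vanishes there. -/
theorem hasFDerivAt_Lam (hγ : 0 < γ) (a : E3) : HasFDerivAt (Lam jc γ) (psi jc γ a) a := by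
  have hM : ∀ x, maxReg γ x ≠ 0 := fun x => by linarith [one_le_maxReg hγ x]
  rcases eq_or_ne a 0 with h | h
  · subst h
    rw [hasFDerivAt_iff_isLittleO_nhds_zero]
    have hcont : Continuous fun b : E3 => jc * γ / maxReg γ (γ * ‖b‖) :=
      continuous_const.div ((continuous_iff_continuousAt.2 fun x =>
        (hasDerivAt_maxReg hγ x).continuousAt).comp (continuous_const.mul continuous_norm))
        fun _ => hM _
    have h1 : (fun b : E3 => jc * γ / maxReg γ (γ * ‖b‖) - jc * γ / maxReg γ (γ * ‖(0 : E3)‖))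
        =o[𝓝 0] fun _ => (1 : ℝ) := by
      rw [Asymptotics.isLittleO_one_iff]
      have := (hcont.tendsto 0).sub_const (jc * γ / maxReg γ (γ * ‖(0 : E3)‖))
      rwa [sub_self] at this
    have h2 := h1.smul_isBigO (Asymptotics.isBigO_refl (fun b : E3 => b) (𝓝 0))
    simp only [one_smul] at h2
    refine h2.congr (fun b => ?_) fun _ => rfl
    rw [psi_apply, smul_zero, sub_zero, zero_add, Lam, Lam, smul_zero, sub_zero, sub_smul]
  · have hn : HasFDerivAt (fun x : E3 => ‖x‖) (‖a‖⁻¹ • innerSL ℝ a) a := by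
      have h1 := (hasStrictFDerivAt_norm_sq a).hasFDerivAt.sqrt (by positivity)
      simp only [Real.sqrt_sq (norm_nonneg _)] at h1
      refine h1.congr_fderiv ?_
      ext z
      simp
      field_simp
    have h1 := (hasDerivAt_maxReg hγ (γ * ‖a‖)).comp_hasFDerivAt a (hn.const_mul γ)
    have h2 := (((hasDerivAt_inv (hM (γ * ‖a‖))).comp_hasFDerivAt a h1).const_mul (jc * γ)).smul
      (hasFDerivAt_id a)
    refine (h2.congr_fderiv ?_).congr_of_eventuallyEq (Eventually.of_forall fun b => ?_)
    · ext1 z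
      rw [psi_apply, psiCoeff]
      simp only [_root_.add_apply, _root_.smul_apply,
        ContinuousLinearMap.smulRight_apply, ContinuousLinearMap.id_apply, innerSL_apply_apply,
        smul_eq_mul, id, Function.comp, div_eq_mul_inv, ← neg_smul, sub_eq_add_neg]
      congr 2
      have := hM (γ * ‖a‖)
      field_simp
    · simp [Lam, div_eq_mul_inv]

theorem psi_eq_fderiv (hγ : 0 < γ) : psi jc γ = fderiv ℝ (Lam jc γ) :=
  funext fun a => (hasFDerivAt_Lam hγ a).fderiv.symm

theorem norm_Lam_sub_le (hj : 0 < jc) (hγ : 0 < γ) (a b : E3) :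
    ‖Lam jc γ a - Lam jc γ b‖ ≤ 2 * (jc * γ) * ‖a - b‖ :=
  Convex.norm_image_sub_le_of_norm_hasFDerivWithin_le
    (fun x _ => (hasFDerivAt_Lam hγ x).hasFDerivWithinAt)
    (fun x _ => ContinuousLinearMap.opNorm_le_bound _ (by positivity) (norm_psi_apply_le hj hγ x))
    convex_univ (Set.mem_univ b) (Set.mem_univ a)

theorem Lam_zero : Lam jc γ 0 = 0 := by rw [Lam, smul_zero]

theorem norm_Lam_le (hj : 0 < jc) (hγ : 0 < γ) (a : E3) : ‖Lam jc γ a‖ ≤ 2 * (jc * γ) * ‖a‖ := by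
  simpa [Lam_zero] using norm_Lam_sub_le hj hγ a 0

theorem continuous_Lam (hγ : 0 < γ) : Continuous (Lam jc γ) :=
  continuous_iff_continuousAt.2 fun a => (hasFDerivAt_Lam hγ a).continuousAt

/-- Along the segment from `b` to `a` the pairing with `a - b` has derivative `⟪psi (a - b), a - b⟫
≥ 0`. -/
theorem inner_Lam_sub_nonneg (hj : 0 < jc) (hγ : 0 < γ) (a b : E3) :
    0 ≤ ⟪Lam jc γ a - Lam jc γ b, a - b⟫_ℝ := by
  have hd : ∀ s : ℝ, HasDerivAt (fun s : ℝ => ⟪Lam jc γ (b + s • (a - b)), a - b⟫_ℝ)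
      ⟪psi jc γ (b + s • (a - b)) (a - b), a - b⟫_ℝ s := by
    intro s
    have h1 : HasDerivAt (fun s : ℝ => b + s • (a - b)) (a - b) s := by
      simpa using ((hasDerivAt_id s).smul_const (a - b)).const_add b
    have h2 := ((hasFDerivAt_Lam (jc := jc) hγ (b + s • (a - b))).comp_hasDerivAt s h1).inner ℝ
      (hasDerivAt_const s (a - b))
    simpa using h2
  have hm : Monotone fun s : ℝ => ⟪Lam jc γ (b + s • (a - b)), a - b⟫_ℝ :=
    monotone_of_deriv_nonneg (fun s => (hd s).differentiableAt) fun s => by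
      rw [(hd s).deriv]; exact inner_psi_nonneg hj hγ _ _
  have := hm zero_le_one
  simp only [zero_smul, add_zero, one_smul, add_sub_cancel] at this
  rw [inner_sub_left]
  linarith

/-- As a derivative, `psi` is measurable without inspecting its case distinctions. -/
theorem measurable_psi (hγ : 0 < γ) : Measurable (psi jc γ) := by
  rw [psi_eq_fderiv hγ]; exact measurable_fderiv ℝ _

end Lam

end HTS

namespace HTS

/-! ### The adjugate of a tensor -/

/-- The matrix of a tensor in the standard basis. -/
noncomputable def toMat : Tensor ≃⋆ₐ[ℝ] Matrix (Fin 3) (Fin 3) ℝ :=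
  (Matrix.toEuclideanCLM (n := Fin 3) (𝕜 := ℝ)).symm

theorem toMat_toEuclideanCLM (B : Matrix (Fin 3) (Fin 3) ℝ) :
    toMat (Matrix.toEuclideanCLM (n := Fin 3) (𝕜 := ℝ) B) = B :=
  (Matrix.toEuclideanCLM (n := Fin 3) (𝕜 := ℝ)).symm_apply_apply B

theorem exists_eq_toEuclideanCLM (A : Tensor) :
    ∃ B, A = Matrix.toEuclideanCLM (n := Fin 3) (𝕜 := ℝ) B :=
  ⟨toMat A, ((Matrix.toEuclideanCLM (n := Fin 3) (𝕜 := ℝ)).apply_symm_apply A).symm⟩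

theorem toMat_apply (A : Tensor) (i j : Fin 3) : toMat A i j = A (e j) i := by
  obtain ⟨B, rfl⟩ := exists_eq_toEuclideanCLM A
  rw [toMat_toEuclideanCLM, e, EuclideanSpace.single]
  rw [Matrix.toEuclideanCLM_toLp]
  simp

theorem apply_eq_mulVec (A : Tensor) (x : E3) (i : Fin 3) :
    A x i = toMat A i 0 * x 0 + toMat A i 1 * x 1 + toMat A i 2 * x 2 := by
  obtain ⟨B, rfl⟩ := exists_eq_toEuclideanCLM A
  rw [toMat_toEuclideanCLM, Matrix.ofLp_toEuclideanCLM]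
  simp [Matrix.mulVec, dotProduct, Fin.sum_univ_three]

theorem det_eq (A : Tensor) : A.det = (toMat A).det := by
  obtain ⟨B, rfl⟩ := exists_eq_toEuclideanCLM A
  rw [toMat_toEuclideanCLM, ContinuousLinearMap.det,
    Matrix.coe_toEuclideanCLM_eq_toEuclideanLin]
  change LinearMap.det (Matrix.toLpLin 2 2 B) = _
  rw [Matrix.toLpLin_eq_toLin, LinearMap.det_toLin]

theorem continuous_toMat : Continuous toMat :=
  (toMat.toAlgEquiv.toLinearMap : Tensor →ₗ[ℝ] Matrix (Fin 3) (Fin 3) ℝ).continuous_of_finiteDimensional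

theorem continuous_toMat_symm : Continuous toMat.symm :=
  (toMat.symm.toAlgEquiv.toLinearMap :
    Matrix (Fin 3) (Fin 3) ℝ →ₗ[ℝ] Tensor).continuous_of_finiteDimensional

/-- The adjugate tensor. -/
noncomputable def adj (A : Tensor) : Tensor := toMat.symm (toMat A).adjugate

theorem continuous_adj : Continuous adj :=
  continuous_toMat_symm.comp continuous_toMat.matrix_adjugate

theorem mul_adj (A : Tensor) : A * adj A = A.det • (1 : Tensor) := by
  refine EquivLike.injective toMat ?_
  rw [map_mul, adj, StarAlgEquiv.apply_symm_apply, Matrix.mul_adjugate, map_smul, map_one, det_eq]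

theorem adj_eq_of_mul_eq_one {A W : Tensor} (h : W * A = 1) : adj A = A.det • W := by
  have := congrArg (W * ·) (mul_adj A)
  simp only [← mul_assoc, h, one_mul] at this
  rw [this]
  ext1 x
  simp

theorem transp_apply_coord (A : Tensor) (x : E3) (i : Fin 3) : transp A x i = ⟪A (e i), x⟫_ℝ := by
  rw [transp, ← ContinuousLinearMap.adjoint_inner_right, e, EuclideanSpace.inner_single_left]
  simp

theorem transp_mul (A B : Tensor) : transp (A * B) = transp B * transp A :=
  ContinuousLinearMap.adjoint_comp A B

theorem transp_one : transp 1 = 1 := by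
  rw [transp, ContinuousLinearMap.one_def, ContinuousLinearMap.adjoint_id]

theorem inner_transp_left (A : Tensor) (x y : E3) : ⟪transp A x, y⟫_ℝ = ⟪x, A y⟫_ℝ :=
  ContinuousLinearMap.adjoint_inner_left A y x

theorem inner_transp_right (A : Tensor) (x y : E3) : ⟪x, transp A y⟫_ℝ = ⟪A x, y⟫_ℝ :=
  ContinuousLinearMap.adjoint_inner_right A x y

theorem norm_transp (A : Tensor) : ‖transp A‖ = ‖A‖ :=
  LinearIsometryEquiv.norm_map ContinuousLinearMap.adjoint A

/-- The transpose as a continuous linear map. -/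
noncomputable def transpL : Tensor →L[ℝ] Tensor :=
  LinearMap.toContinuousLinearMap
    { toFun := transp
      map_add' := fun A B => map_add ContinuousLinearMap.adjoint A B
      map_smul' := fun c A => by
        simp [transp] }

theorem transpL_apply (A : Tensor) : transpL A = transp A := rfl

/-- The algebra behind the transformation of curls: `curlOf A` is the axial vector of the
antisymmetric part of `A`, and a congruence by `M` acts on axial vectors through the adjugate. It is
a polynomial identity in the entries, so `M` need not be invertible. -/
theorem curlOf_conj (M A : Tensor) : curlOf (transp M * A * M) = adj M (curlOf A) := by
  have hadj : ∀ i j, toMat (adj M) i j = (toMat M).adjugate i j := fun i j => by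
    rw [adj, StarAlgEquiv.apply_symm_apply]
  have hA : ∀ j i, A (e j) i = toMat A i j := fun j i => (toMat_apply A i j).symm
  have hM : ∀ j i, M (e j) i = toMat M i j := fun j i => (toMat_apply M i j).symm
  ext i
  rw [apply_eq_mulVec, hadj, hadj, hadj, Matrix.adjugate_fin_three]
  fin_cases i <;>
  · simp only [curlOf, LinearMap.coe_mk, AddHom.coe_mk, mul_apply_eq_comp,
      transp_apply_coord, inner_eq_sum, apply_eq_mulVec A (M _), hA, hM]
    simp
    ring

theorem curlOf_eq_zero {A : Tensor} (h : ∀ i j, A (e i) j = A (e j) i) : curlOf A = 0 := by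
  ext i
  fin_cases i <;> simp [curlOf, h 1 2, h 2 0, h 0 1]

/-! ### Measure theory of Lipschitz transformations -/

/-- Lebesgue measure is a multiple of the three-dimensional Hausdorff measure, for which the bound
is immediate from the definition. -/
theorem volume_image_le {k : ℝ≥0} {T : E3 → E3} (hT : LipschitzWith k T) (s : Set E3) :
    volume (T '' s) ≤ (k : ℝ≥0∞) ^ 3 * volume s := by
  have h := hT.hausdorffMeasure_image_le (d := (3 : ℕ)) (by positivity) s
  rw [ENNReal.rpow_natCast] at h
  have hv := Measure.isAddLeftInvariant_eq_smul (volume : Measure E3) (μH[(3 : ℕ)] : Measure E3)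
  rw [hv, Measure.smul_apply, Measure.smul_apply, ENNReal.smul_def, ENNReal.smul_def, smul_eq_mul,
    smul_eq_mul, mul_left_comm]
  gcongr

namespace IsLipEquiv

variable {K Ω : Set E3} {T S : E3 → E3}

theorem exists_map_le (h : IsLipEquiv K T S) :
    ∃ c : ℝ≥0, Measure.map T (volume : Measure E3) ≤ c • volume := by
  obtain ⟨k, hk⟩ := h.lip_inv
  refine ⟨k ^ 3, Measure.le_iff.2 fun s hs => ?_⟩
  rw [Measure.map_apply h.continuous.measurable hs, ← h.symm.image_eq_preimage,
    Measure.smul_apply, ENNReal.smul_def, smul_eq_mul, ENNReal.coe_pow]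
  exact volume_image_le hk s

theorem exists_map_restrict_le (h : IsLipEquiv K T S) (hK : K ⊆ Ω) (hΩ : MeasurableSet Ω) :
    ∃ c : ℝ≥0, Measure.map T (volume.restrict Ω) ≤ c • volume.restrict Ω := by
  obtain ⟨c, hc⟩ := h.exists_map_le
  refine ⟨c, ?_⟩
  have := Measure.restrict_mono_measure hc Ω
  rwa [Measure.restrict_map h.continuous.measurable hΩ, h.preimage_eq hK,
    Measure.restrict_smul] at this

theorem quasiMeasurePreserving (h : IsLipEquiv K T S) (hK : K ⊆ Ω) (hΩ : MeasurableSet Ω) :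
    Measure.QuasiMeasurePreserving T (volume.restrict Ω) (volume.restrict Ω) := by
  obtain ⟨c, hc⟩ := h.exists_map_restrict_le hK hΩ
  exact ⟨h.continuous.measurable,
    hc.absolutelyContinuous.trans Measure.smul_absolutelyContinuous⟩

theorem quasiMeasurePreserving_volume (h : IsLipEquiv K T S) :
    Measure.QuasiMeasurePreserving T volume volume := by
  obtain ⟨c, hc⟩ := h.exists_map_le
  exact ⟨h.continuous.measurable, hc.absolutelyContinuous.trans Measure.smul_absolutelyContinuous⟩

theorem exists_eLpNorm_comp_le (h : IsLipEquiv K T S) (hK : K ⊆ Ω) (hΩ : MeasurableSet Ω) :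
    ∃ c : ℝ≥0, ∀ u : Field, AEStronglyMeasurable u (volume.restrict Ω) →
      eLpNorm (u ∘ T) 2 (volume.restrict Ω) ≤ c * eLpNorm u 2 (volume.restrict Ω) := by
  obtain ⟨c, hc⟩ := h.exists_map_restrict_le hK hΩ
  -- A bound `c` on the density of the pushforward enters the L² norm with exponent 1/2.
  refine ⟨c ^ (1 / 2 : ℝ), fun u hu => ?_⟩
  have hu' : AEStronglyMeasurable u (Measure.map T (volume.restrict Ω)) :=
    hu.mono_ac (h.quasiMeasurePreserving hK hΩ).absolutelyContinuous
  rw [← eLpNorm_map_measure hu' h.continuous.aemeasurable]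
  refine (eLpNorm_mono_measure u hc).trans ?_
  rw [show (c • volume.restrict Ω : Measure E3) = (c : ℝ≥0∞) • volume.restrict Ω from rfl,
    eLpNorm_smul_measure_of_ne_top ENNReal.ofNat_ne_top, smul_eq_mul]
  gcongr
  rw [ENNReal.coe_rpow_of_nonneg _ (by norm_num)]
  simp

theorem memLp_comp (h : IsLipEquiv K T S) (hK : K ⊆ Ω) (hΩ : MeasurableSet Ω) {u : Field}
    (hu : MemLp u 2 (volume.restrict Ω)) : MemLp (u ∘ T) 2 (volume.restrict Ω) := by
  obtain ⟨c, hc⟩ := h.exists_eLpNorm_comp_le hK hΩ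
  exact ⟨hu.1.comp_quasiMeasurePreserving (h.quasiMeasurePreserving hK hΩ),
    (hc u hu.1).trans_lt (ENNReal.mul_lt_top ENNReal.coe_lt_top hu.2)⟩

theorem ae_differentiableAt (h : IsLipEquiv K T S) : ∀ᵐ x, DifferentiableAt ℝ T x := by
  obtain ⟨k, hk⟩ := h.lip
  exact hk.ae_differentiableAt

theorem fderiv_mul_fderiv (h : IsLipEquiv K T S) {x : E3} (h1 : DifferentiableAt ℝ T x)
    (h2 : DifferentiableAt ℝ S (T x)) : fderiv ℝ S (T x) * fderiv ℝ T x = 1 := by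
  have := (h2.hasFDerivAt.comp x h1.hasFDerivAt).fderiv
  rw [show S ∘ T = id from funext h.left, fderiv_id] at this
  exact this.symm

/-- Rademacher gives differentiability of `T` at almost every `x`. Because preimages of null sets
under `T` are null, `S` is also differentiable at `T x` for almost every `x`, and the chain rule
applies. -/
theorem ae_fderiv_mul_fderiv (h : IsLipEquiv K T S) :
    ∀ᵐ x, fderiv ℝ S (T x) * fderiv ℝ T x = 1 ∧ fderiv ℝ T x * fderiv ℝ S (T x) = 1 := by
  filter_upwards [h.ae_differentiableAt,
    h.quasiMeasurePreserving_volume.ae h.symm.ae_differentiableAt] with x h1 h2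
  have h3 : DifferentiableAt ℝ T (S (T x)) := by rwa [h.left]
  have := h.symm.fderiv_mul_fderiv h2 h3
  rw [h.left] at this
  exact ⟨h.fderiv_mul_fderiv h1 h2, this⟩

/-- The change of variables formula is applied on the set where `T` is differentiable. The remaining
points form a null set by Rademacher, and a Lipschitz map sends it to a null set. -/
theorem setIntegral_image (h : IsLipEquiv K T S) {s : Set E3} (hs : MeasurableSet s) (g : E3 → ℝ) :
    ∫ x in T '' s, g x = ∫ x in s, |(fderiv ℝ T x).det| * g (T x) := by
  set D := {x | DifferentiableAt ℝ T x}
  have hD : MeasurableSet D := measurableSet_of_differentiableAt ℝ T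
  have hDc : volume Dᶜ = 0 := h.ae_differentiableAt
  have h0 : volume (T '' (s \ D)) = 0 := by
    obtain ⟨k, hk⟩ := h.lip
    refine le_antisymm ((volume_image_le hk _).trans ?_) zero_le
    rw [measure_mono_null (fun x hx => hx.2) hDc, mul_zero]
  have e1 : ∫ x in T '' s, g x = ∫ x in T '' (s ∩ D), g x := by
    refine setIntegral_congr_set ?_
    refine Filter.EventuallyEq.symm (ae_eq_set.2 ⟨?_, ?_⟩)
    · rw [Set.sdiff_eq_empty.2 (Set.image_mono Set.inter_subset_left)]
      exact measure_empty
    · refine measure_mono_null ?_ h0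
      rintro _ ⟨⟨x, hx, rfl⟩, hn⟩
      exact ⟨x, ⟨hx, fun hd => hn ⟨x, ⟨hx, hd⟩, rfl⟩⟩, rfl⟩
  have e2 : ∫ x in s, |(fderiv ℝ T x).det| * g (T x) =
      ∫ x in s ∩ D, |(fderiv ℝ T x).det| * g (T x) := by
    refine setIntegral_congr_set (Filter.EventuallyEq.symm (ae_eq_set.2 ⟨?_, ?_⟩))
    · rw [Set.sdiff_eq_empty.2 Set.inter_subset_left]; exact measure_empty
    · exact measure_mono_null (fun x hx => fun hd => hx.2 ⟨hx.1, hd⟩) hDc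
  rw [e1, e2, integral_image_eq_integral_abs_det_fderiv_smul volume (hs.inter hD)
    (fun x hx => (DifferentiableAt.hasFDerivAt hx.2).hasFDerivWithinAt) h.injective.injOn]
  rfl

end IsLipEquiv

end HTS

/-! ### Mollification, and pullback of H₀(curl) by bi-Lipschitz maps. -/

namespace HTS

theorem aestronglyMeasurable_apply {μ : Measure E3} {A : E3 → Tensor} {u : Field}
    (hA : AEStronglyMeasurable A μ) (hu : AEStronglyMeasurable u μ) :
    AEStronglyMeasurable (fun x => A x (u x)) μ :=
  (isBoundedBilinearMap_apply (𝕜 := ℝ) (E := E3) (F := E3)).continuous.comp_aestronglyMeasurable₂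
    hA hu

theorem tendsto_apply {ι : Type*} {l : Filter ι} {A : ι → Tensor} {A₀ : Tensor} {y : ι → E3}
    {y₀ : E3} (hA : Tendsto A l (𝓝 A₀)) (hy : Tendsto y l (𝓝 y₀)) :
    Tendsto (fun i => A i (y i)) l (𝓝 (A₀ y₀)) :=
  ((isBoundedBilinearMap_apply (𝕜 := ℝ) (E := E3) (F := E3)).continuous.tendsto (A₀, y₀)).comp
    (hA.prodMk_nhds hy)

theorem aestronglyMeasurable_transp {μ : Measure E3} {A : E3 → Tensor}
    (hA : AEStronglyMeasurable A μ) : AEStronglyMeasurable (fun x => transp (A x)) μ :=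
  transpL.continuous.comp_aestronglyMeasurable hA

/-- Dominated convergence in `L²`. -/
theorem tendsto_l2_zero {α F : Type*} [MeasurableSpace α] {μ : Measure α} [NormedAddCommGroup F]
    {f : ℕ → α → F} {h : α → ℝ} (hh : MemLp h 2 μ) (hf : ∀ n, AEStronglyMeasurable (f n) μ)
    (hle : ∀ n, ∀ᵐ x ∂μ, ‖f n x‖ ≤ h x)
    (hlim : ∀ᵐ x ∂μ, Tendsto (fun n => f n x) atTop (𝓝 0)) :
    Tendsto (fun n => l2 μ (f n)) atTop (𝓝 0) := by
  have hm : ∀ n, MemLp (f n) 2 μ := fun n => hh.mono' (hf n) (hle n)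
  have h1 : Tendsto (fun n => ∫ x, ‖f n x‖ ^ 2 ∂μ) atTop (𝓝 (∫ _, (0 : ℝ) ∂μ)) := by
    refine tendsto_integral_of_dominated_convergence (fun x => h x ^ 2)
      (fun n => (hf n).norm.pow 2) hh.integrable_sq (fun n => ?_) ?_
    · filter_upwards [hle n] with x hx
      rw [Real.norm_of_nonneg (by positivity)]
      gcongr
    · filter_upwards [hlim] with x hx
      simpa using hx.norm.pow 2
  rw [integral_zero] at h1
  have h2 := h1.sqrt
  rw [Real.sqrt_zero] at h2
  refine h2.congr fun n => ?_
  rw [← l2_sq (hm n), Real.sqrt_sq (l2_nonneg _)]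

/-! ### Mollification of Lipschitz fields -/

/-- Convolution with shrinking bumps of mass one. The derivative of the mollified field is the
mollified derivative: it inherits the bound `k`, and it converges almost everywhere by Lebesgue
differentiation. -/
theorem exists_smooth_approx {g : Field} {k : ℝ≥0} (hg : LipschitzWith k g) :
    ∃ G : ℕ → Field, (∀ n, ContDiff ℝ ((⊤ : ℕ∞) : WithTop ℕ∞) (G n)) ∧
      (∀ n x, ‖fderiv ℝ (G n) x‖ ≤ k) ∧ (∀ x, Tendsto (fun n => G n x) atTop (𝓝 (g x))) ∧
      (∀ᵐ x, Tendsto (fun n => fderiv ℝ (G n) x) atTop (𝓝 (fderiv ℝ g x))) ∧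
      ∀ δ : ℝ, 0 < δ → ∀ᶠ n in atTop, ∀ x ∉ Metric.cthickening δ (tsupport g), G n x = 0 := by
  let φ : ℕ → ContDiffBump (0 : E3) := fun n =>
    -- The fixed ratio of outer to inner radius is what the Lebesgue differentiation theorem for
    -- bump functions requires.
    ⟨1 / (n + 1) / 2, 1 / (n + 1), by positivity, half_lt_self (by positivity)⟩
  have hφ : Tendsto (fun n => (φ n).rOut) atTop (𝓝 0) := tendsto_one_div_add_atTop_nhds_zero_nat
  have hd : ∀ x, ‖fderiv ℝ g x‖ ≤ k := fun x => norm_fderiv_le_of_lipschitz ℝ hg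
  have hdm : Measurable (fderiv ℝ g) := measurable_fderiv ℝ g
  have hgl : LocallyIntegrable g (volume : Measure E3) := hg.continuous.locallyIntegrable
  have hdl : LocallyIntegrable (fderiv ℝ g) (volume : Measure E3) :=
    (memLp_top_of_bound hdm.aestronglyMeasurable k (ae_of_all _ hd)).locallyIntegrable le_top
  let ρ : ℕ → E3 → ℝ := fun n => (φ n).normed volume
  have hρc : ∀ n, Continuous (ρ n) := fun n => (φ n).continuous_normed
  have hρs : ∀ n, HasCompactSupport (ρ n) := fun n => (φ n).hasCompactSupport_normed
  have hρi : ∀ n, Integrable (ρ n) := fun n => (hρc n).integrable_of_hasCompactSupport (hρs n)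
  let G : ℕ → Field := fun n => convolution (ρ n) g (ContinuousLinearMap.lsmul ℝ ℝ) volume
  have hGx : ∀ n x, G n x = ∫ t, ρ n t • g (x - t) := fun n x => rfl
  have hder : ∀ n x, HasFDerivAt (G n) (∫ t, ρ n t • fderiv ℝ g (x - t)) x := by
    intro n x
    -- The derivative falls on `g` and not on the bump. The version for Lipschitz integrands needs
    -- differentiability at `x` only for almost every `t`, which Rademacher provides.
    refine (hasFDerivAt_integral_of_dominated_loc_of_lip (𝕜 := ℝ)
      (F := fun x t => ρ n t • g (x - t))
      (s := Set.univ) (bound := fun t => ρ n t * k)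
      Filter.univ_mem ?_ ?_ ?_ ?_ ?_ ?_).2
    · refine Eventually.of_forall fun y => ?_
      exact ((hρc n).smul (hg.continuous.comp (continuous_const.sub continuous_id))).aestronglyMeasurable
    · exact ((hρc n).smul (hg.continuous.comp (continuous_const.sub
        continuous_id))).integrable_of_hasCompactSupport (hρs n).smul_right
    · exact ((hρc n).measurable.smul
        (hdm.comp (measurable_const.sub measurable_id))).aestronglyMeasurable
    · refine ae_of_all _ fun t => LipschitzOnWith.of_dist_le_mul fun y _ z _ => ?_
      have hnn : 0 ≤ ρ n t := (φ n).nonneg_normed t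
      rw [dist_eq_norm, ← smul_sub, norm_smul, Real.norm_of_nonneg hnn, Real.coe_nnabs,
        abs_of_nonneg (by positivity), mul_assoc]
      gcongr
      have := hg.norm_sub_le (y - t) (z - t)
      rwa [sub_sub_sub_cancel_right, ← dist_eq_norm y z] at this
    · exact (hρi n).mul_const _
    · have h1 : ∀ᵐ y, DifferentiableAt ℝ g y := hg.ae_differentiableAt
      have h2 : ∀ᵐ t, DifferentiableAt ℝ g (x - t) :=
        (Measure.measurePreserving_sub_left volume x).quasiMeasurePreserving.ae h1
      filter_upwards [h2] with t ht
      have h3 : HasFDerivAt (fun y => y - t) (ContinuousLinearMap.id ℝ E3) x :=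
        (hasFDerivAt_id x).sub_const t
      exact (ht.hasFDerivAt.comp x h3).const_smul (ρ n t)
  refine ⟨G, fun n => ?_, fun n x => ?_, fun x => ?_, ?_, fun δ hδ => ?_⟩
  · exact (hρs n).contDiff_convolution_left _ (φ n).contDiff_normed hgl
  · rw [(hder n x).fderiv]
    refine (norm_integral_le_of_norm_le ((hρi n).mul_const (k : ℝ)) (ae_of_all _ fun t => ?_)).trans ?_
    · have hnn : 0 ≤ ρ n t := (φ n).nonneg_normed t
      rw [norm_smul, Real.norm_of_nonneg hnn]
      gcongr
      exact hd _
    · rw [integral_mul_const, show ∫ t, ρ n t = 1 from (φ n).integral_normed, one_mul]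
  · exact ContDiffBump.convolution_tendsto_right_of_continuous hφ hg.continuous x
  · have h2 : ∀ᶠ n in atTop, (φ n).rOut ≤ 2 * (φ n).rIn := Eventually.of_forall fun n => by
      change (1 / ((n : ℝ) + 1)) ≤ 2 * (1 / (n + 1) / 2)
      linarith
    filter_upwards [ContDiffBump.ae_convolution_tendsto_right_of_locallyIntegrable hφ h2 hdl]
      with x hx
    refine hx.congr fun n => ?_
    rw [(hder n x).fderiv]
    rfl
  · filter_upwards [hφ.eventually_lt_const hδ] with n hn x hx
    rw [hGx]
    refine integral_eq_zero_of_ae (ae_of_all _ fun t => ?_)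
    by_cases ht : t ∈ Function.support (ρ n)
    · rw [(φ n).support_normed_eq, Metric.mem_ball, dist_zero_right] at ht
      have : x - t ∉ tsupport g := fun h => hx (Metric.mem_cthickening_of_dist_le x (x - t) δ _ h
        (by rw [dist_eq_norm, sub_sub_cancel]; linarith))
      simp [image_eq_zero_of_notMem_tsupport this]
    · simp [Function.notMem_support.1 ht]

/-! ### Pullbacks of fields -/

/-- The pullback of a field as a one-form. -/
noncomputable def pullback (S : E3 → E3) (u : Field) (x : E3) : E3 :=
  transp (fderiv ℝ S x) (u (S x))

/-- The pullback of a field as a two-form. -/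
noncomputable def pullbackCurl (S : E3 → E3) (c : Field) (x : E3) : E3 :=
  adj (fderiv ℝ S x) (c (S x))

theorem contDiff_pullback {S : E3 → E3} {φ : Field}
    (hS : ContDiff ℝ ((⊤ : ℕ∞) : WithTop ℕ∞) S) (hφ : ContDiff ℝ ((⊤ : ℕ∞) : WithTop ℕ∞) φ) :
    ContDiff ℝ ((⊤ : ℕ∞) : WithTop ℕ∞) (pullback S φ) := by
  have h1 : ContDiff ℝ ((⊤ : ℕ∞) : WithTop ℕ∞) (fderiv ℝ S) := hS.fderiv_right (by simp)
  exact (transpL.contDiff.comp h1).clm_apply (hφ.comp hS)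

/-- The derivative of `DSᵀ (φ ∘ S)` has two parts. The one with the second derivative of `S` is
symmetric, so its curl vanishes; the other is `DSᵀ (Dφ) DS`, handled by `curlOf_conj`. -/
theorem curl_pullback {S : E3 → E3} {φ : Field}
    (hS : ContDiff ℝ ((⊤ : ℕ∞) : WithTop ℕ∞) S) (hφ : ContDiff ℝ ((⊤ : ℕ∞) : WithTop ℕ∞) φ) :
    curl (pullback S φ) = pullbackCurl S (curl φ) := by
  funext x
  have h1 : ContDiff ℝ ((⊤ : ℕ∞) : WithTop ℕ∞) (fderiv ℝ S) := hS.fderiv_right (by simp)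
  have h2 : HasFDerivAt (fderiv ℝ S) (fderiv ℝ (fderiv ℝ S) x) x :=
    (h1.differentiable (by simp) x).hasFDerivAt
  have h3 : HasFDerivAt (fun y => φ (S y)) ((fderiv ℝ φ (S x)).comp (fderiv ℝ S x)) x :=
    (hφ.differentiable (by simp) (S x)).hasFDerivAt.comp x
      (hS.differentiable (by simp) x).hasFDerivAt
  have h4 := ((transpL.hasFDerivAt.comp x h2).clm_apply h3).fderiv
  have h5 : fderiv ℝ (pullback S φ) x = _ := h4
  have hsym : IsSymmSndFDerivAt ℝ S x :=
    hS.contDiffAt.isSymmSndFDerivAt (by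
      rw [minSmoothness_of_isRCLikeNormedField]
      exact WithTop.coe_le_coe.2 (le_top : (2 : ℕ∞) ≤ ⊤))
  rw [curl_eq, h5, map_add, pullbackCurl, curl_eq, ← curlOf_conj]
  have hz : curlOf ((transpL.comp (fderiv ℝ (fderiv ℝ S) x)).flip (φ (S x))) = 0 := by
    apply curlOf_eq_zero
    intro i j
    change transp (fderiv ℝ (fderiv ℝ S) x (e i)) (φ (S x)) j =
      transp (fderiv ℝ (fderiv ℝ S) x (e j)) (φ (S x)) i
    rw [transp_apply_coord, transp_apply_coord, hsym.eq]
  rw [hz, add_zero]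
  rfl

theorem pullback_sub (S : E3 → E3) (u v : Field) :
    pullback S (u - v) = pullback S u - pullback S v := by
  funext x
  simp [pullback, map_sub]

theorem pullbackCurl_sub (S : E3 → E3) (u v : Field) :
    pullbackCurl S (u - v) = pullbackCurl S u - pullbackCurl S v := by
  funext x
  simp [pullbackCurl, map_sub]

theorem exists_norm_adj_le (k : ℝ) : ∃ C : ℝ, 0 ≤ C ∧ ∀ A : Tensor, ‖A‖ ≤ k → ‖adj A‖ ≤ C := by
  obtain ⟨C, hC⟩ := (isCompact_closedBall (0 : Tensor) k).exists_bound_of_continuousOn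
    continuous_adj.continuousOn
  refine ⟨max C 0, le_max_right _ _, fun A hA => (hC A ?_).trans (le_max_left _ _)⟩
  rwa [mem_closedBall_zero_iff]

namespace IsLipEquiv

variable {K Ω : Set E3} {T S : E3 → E3} {u c : Field}

theorem exists_eLpNorm_comp_tensor_le (h : IsLipEquiv K T S) (hK : K ⊆ Ω) (hΩ : MeasurableSet Ω)
    {A : E3 → Tensor} (hA : Measurable A) {k : ℝ} (hk : ∀ x, ‖A x‖ ≤ k) :
    ∃ C : ℝ≥0, ∀ u : Field, MemLp u 2 (volume.restrict Ω) →
      MemLp (fun x => A x (u (T x))) 2 (volume.restrict Ω) ∧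
      eLpNorm (fun x => A x (u (T x))) 2 (volume.restrict Ω) ≤
        C * eLpNorm u 2 (volume.restrict Ω) := by
  obtain ⟨c, hc⟩ := h.exists_eLpNorm_comp_le hK hΩ
  refine ⟨k.toNNReal * c, fun u hu => ?_⟩
  have hu' := h.memLp_comp hK hΩ hu
  have hle : ∀ x, ‖A x (u (T x))‖ ≤ k * ‖(u ∘ T) x‖ := fun x =>
    ((A x).le_opNorm _).trans (mul_le_mul_of_nonneg_right (hk x) (norm_nonneg _))
  refine ⟨hu'.of_le_mul (aestronglyMeasurable_apply hA.aestronglyMeasurable hu'.1)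
    (ae_of_all _ hle), ?_⟩
  refine (eLpNorm_le_mul_eLpNorm_of_ae_le_mul (ae_of_all _ hle) 2).trans ?_
  rw [ENNReal.coe_mul, mul_assoc]
  exact mul_le_mul' le_rfl (hc u hu.1)

/-- For Lipschitz `T` the pulled back test field is only bounded and measurable, so `T - id` is
mollified. The pullbacks by the smooth maps `R n` are eventually test fields with known curls, and
both sequences converge in L² by dominated convergence. The maps `R n` need not be invertible. -/
theorem h0Pair_pullback_test (h : IsLipEquiv K T S) (hK : K ⊆ Ω) (hΩ : IsOpen Ω)
    (hb : Bornology.IsBounded Ω) {φ : Field} (hφ : IsTestField Ω φ) :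
    H0Pair Ω (pullback T φ) (pullbackCurl T (curl φ)) := by
  obtain ⟨k, hk⟩ := h.lip
  have : IsFiniteMeasure (volume.restrict Ω) := ⟨by
    rw [Measure.restrict_apply_univ]; exact hb.measure_lt_top⟩
  set g : Field := fun x => T x - x
  have hgk : LipschitzWith (k + 1) g := hk.sub LipschitzWith.id
  have hgK : tsupport g ⊆ K := by
    refine closure_minimal (fun x hx => ?_) h.compact.isClosed
    by_contra hn
    exact hx (by simp [g, h.off x hn])
  have hgc : HasCompactSupport g := h.compact.of_isClosed_subset (isClosed_tsupport _) hgK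
  obtain ⟨G, hG1, hG2, hG3, hG4, hG5⟩ := exists_smooth_approx hgk
  obtain ⟨δ, hδ, hδΩ⟩ := hgc.isCompact.exists_cthickening_subset_open hΩ (hgK.trans hK)
  -- Outside `C` and for large `n`, the map `R n` fixes the point and `φ` vanishes there, so this
  -- one compact subset of `Ω` contains all the supports.
  set C := Metric.cthickening δ (tsupport g) ∪ tsupport φ
  have hC : IsCompact C := (hgc.isCompact.cthickening).union hφ.2.1
  have hCΩ : C ⊆ Ω := Set.union_subset hδΩ hφ.2.2
  let R : ℕ → E3 → E3 := fun n x => x + G n x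
  have hR1 : ∀ n, ContDiff ℝ ((⊤ : ℕ∞) : WithTop ℕ∞) (R n) := fun n => contDiff_id.add (hG1 n)
  have hRd : ∀ n x, fderiv ℝ (R n) x = 1 + fderiv ℝ (G n) x := fun n x =>
    ((hasFDerivAt_id x).add ((hG1 n).differentiable (by simp) x).hasFDerivAt).fderiv
  have hone : ‖(1 : Tensor)‖ ≤ 1 := ContinuousLinearMap.norm_id_le
  have hR2 : ∀ n x, ‖fderiv ℝ (R n) x‖ ≤ k + 2 := fun n x => by
    rw [hRd]
    refine (norm_add_le _ _).trans ?_
    have := hG2 n x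
    rw [NNReal.coe_add, NNReal.coe_one] at this
    linarith
  have hR3 : ∀ x, Tendsto (fun n => R n x) atTop (𝓝 (T x)) := fun x => by
    have := (hG3 x).const_add x
    simpa [g] using this
  have hR4 : ∀ᵐ x, Tendsto (fun n => fderiv ℝ (R n) x) atTop (𝓝 (fderiv ℝ T x)) := by
    filter_upwards [hG4, h.ae_differentiableAt] with x hx hd
    simp only [hRd]
    have := hx.const_add 1
    have e1 : fderiv ℝ g x = fderiv ℝ T x - 1 := (hd.hasFDerivAt.sub (hasFDerivAt_id x)).fderiv
    rwa [e1, add_sub_cancel] at this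
  have htest : ∀ᶠ n in atTop, IsTestField Ω (pullback (R n) φ) := by
    filter_upwards [hG5 δ hδ] with n hn
    have hs : tsupport (pullback (R n) φ) ⊆ C := by
      refine closure_minimal (fun x hx => ?_) hC.isClosed
      by_contra hxC
      rw [Set.mem_union, not_or] at hxC
      apply hx
      have : R n x = x := by simp [R, hn x hxC.1]
      rw [pullback, this, image_eq_zero_of_notMem_tsupport hxC.2, map_zero]
    exact ⟨contDiff_pullback (hR1 n) hφ.1, hC.of_isClosed_subset (isClosed_tsupport _) hs,
      hs.trans hCΩ⟩
  have hTd : ∀ x, ‖fderiv ℝ T x‖ ≤ k := fun x => norm_fderiv_le_of_lipschitz ℝ hk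
  obtain ⟨D, hD0, hD⟩ := exists_norm_adj_le ((k : ℝ) + 2)
  -- Taking `Θ` to be the transpose treats the fields and taking it to be the adjugate treats the
  -- curls.
  have key : ∀ (Θ : Tensor → Tensor) (_ : Continuous Θ) (M : ℝ)
      (_ : ∀ A : Tensor, ‖A‖ ≤ (k : ℝ) + 2 → ‖Θ A‖ ≤ M) (ψ : Field) (_ : Continuous ψ)
      (_ : HasCompactSupport ψ), MemLp (fun x => Θ (fderiv ℝ T x) (ψ (T x))) 2 (volume.restrict Ω) ∧
        ∀ ε : ℝ≥0∞, 0 < ε → ∀ᶠ n in atTop, eLpNorm ((fun x => Θ (fderiv ℝ T x) (ψ (T x))) -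
          fun x => Θ (fderiv ℝ (R n) x) (ψ (R n x))) 2 (volume.restrict Ω) ≤ ε := by
    intro Θ hΘ M hM ψ hψ hψc
    obtain ⟨N, hN⟩ := hψ.bounded_above_of_compact_support hψc
    have hM0 : 0 ≤ M := (norm_nonneg _).trans (hM 0 (by rw [norm_zero]; positivity))
    have b : ∀ (A : Tensor) (x : E3), ‖A‖ ≤ (k : ℝ) + 2 → ‖Θ A (ψ x)‖ ≤ M * N := fun A x hA =>
      ((Θ A).le_opNorm _).trans (mul_le_mul (hM A hA) (hN x) (norm_nonneg _) hM0)
    have m : ∀ (Q : E3 → E3), Continuous Q →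
        AEStronglyMeasurable (fun x => Θ (fderiv ℝ Q x) (ψ (Q x))) (volume.restrict Ω) :=
      fun Q hQ => aestronglyMeasurable_apply
        (hΘ.measurable.comp (measurable_fderiv ℝ Q)).aestronglyMeasurable
        (hψ.comp hQ).aestronglyMeasurable
    have hT2 : ∀ x, ‖fderiv ℝ T x‖ ≤ (k : ℝ) + 2 := fun x => (hTd x).trans (by linarith)
    have hmem : MemLp (fun x => Θ (fderiv ℝ T x) (ψ (T x))) 2 (volume.restrict Ω) :=
      MemLp.of_bound (m T h.continuous) (M * N) (ae_of_all _ fun x => b _ _ (hT2 x))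
    have hmem' : ∀ n, MemLp (fun x => Θ (fderiv ℝ (R n) x) (ψ (R n x))) 2 (volume.restrict Ω) :=
      fun n => MemLp.of_bound (m _ (hR1 n).continuous) (M * N) (ae_of_all _ fun x => b _ _ (hR2 n x))
    refine ⟨hmem, fun ε hε => ?_⟩
    have hlim := tendsto_l2_zero (μ := volume.restrict Ω)
      (f := fun n => (fun x => Θ (fderiv ℝ T x) (ψ (T x))) -
          fun x => Θ (fderiv ℝ (R n) x) (ψ (R n x))) (h := fun _ => M * N + M * N)
      (memLp_const _) (fun n => hmem.1.sub (hmem' n).1)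
      (fun n => ae_of_all _ fun x => (norm_sub_le _ _).trans
        (add_le_add (b _ _ (hT2 x)) (b _ _ (hR2 n x))))
      (by
        filter_upwards [ae_restrict_of_ae hR4] with x hx
        have h0 : Tendsto (fun n => Θ (fderiv ℝ (R n) x)) atTop (𝓝 (Θ (fderiv ℝ T x))) :=
          (hΘ.tendsto _).comp hx
        have h1 := tendsto_apply h0 ((hψ.tendsto _).comp (hR3 x))
        have h2 := h1.const_sub (Θ (fderiv ℝ T x) (ψ (T x)))
        rw [sub_self] at h2
        exact h2)
    have hlim' := ENNReal.tendsto_ofReal hlim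
    rw [ENNReal.ofReal_zero] at hlim'
    filter_upwards [hlim'.eventually_le_const hε] with n hn
    rwa [← eLpNorm_eq_l2 (hmem.sub (hmem' n))] at hn
  obtain ⟨hm1, hl1⟩ := key transp transpL.continuous (k + 2)
    (fun A hA => by rwa [norm_transp]) φ hφ.1.continuous hφ.2.1
  obtain ⟨hm2, hl2⟩ := key adj continuous_adj D hD (curl φ) hφ.continuous_curl
    hφ.hasCompactSupport_curl
  refine ⟨hm1, hm2, fun ε hε => ?_⟩
  obtain ⟨n, hn1, hn2, hn3⟩ := (htest.and ((hl1 ε hε).and (hl2 ε hε))).exists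
  refine ⟨_, hn1, hn2, ?_⟩
  rw [curl_pullback (hR1 n) hφ.1]
  exact hn3

/-- Both pullbacks are bounded on L², so the case of test fields extends by density. -/
theorem h0Pair_pullback (h : IsLipEquiv K T S) (hK : K ⊆ Ω) (hΩ : IsOpen Ω)
    (hb : Bornology.IsBounded Ω) (hu : H0Pair Ω u c) :
    H0Pair Ω (pullback T u) (pullbackCurl T c) := by
  obtain ⟨k, hk⟩ := h.lip
  have hTd : ∀ x, ‖fderiv ℝ T x‖ ≤ k := fun x => norm_fderiv_le_of_lipschitz ℝ hk
  obtain ⟨D, hD0, hD⟩ := exists_norm_adj_le k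
  obtain ⟨C₁, hC₁⟩ := h.exists_eLpNorm_comp_tensor_le hK hΩ.measurableSet
    (A := fun x => transp (fderiv ℝ T x))
    (transpL.continuous.measurable.comp (measurable_fderiv ℝ T))
    (fun x => by rw [norm_transp]; exact hTd x)
  obtain ⟨C₂, hC₂⟩ := h.exists_eLpNorm_comp_tensor_le hK hΩ.measurableSet
    (A := fun x => adj (fderiv ℝ T x)) (continuous_adj.measurable.comp (measurable_fderiv ℝ T))
    (fun x => hD _ (hTd x))
  refine h0Pair_of_approx (hC₁ u hu.1).1 (hC₂ c hu.2.1).1 fun δ hδ => ?_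
  have hη : 0 < δ / ((C₁ + C₂ : ℝ≥0) + 1 : ℝ≥0∞) :=
    ENNReal.div_pos hδ.ne' (by simp)
  obtain ⟨φ, hφ, h1, h2⟩ := hu.2.2 _ hη
  have hle : ∀ C : ℝ≥0, C ≤ C₁ + C₂ → (C : ℝ≥0∞) * (δ / ((C₁ + C₂ : ℝ≥0) + 1 : ℝ≥0∞)) ≤ δ := by
    intro C hC
    refine (mul_le_mul' (?_ : (C : ℝ≥0∞) ≤ ((C₁ + C₂ : ℝ≥0) + 1 : ℝ≥0∞)) le_rfl).trans
      (ENNReal.mul_div_cancel (by simp) (by simp)).le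
    exact (ENNReal.coe_le_coe.2 hC).trans le_self_add
  refine ⟨_, _, h.h0Pair_pullback_test hK hΩ hb hφ, ?_, ?_⟩
  · rw [← pullback_sub]
    exact (hC₁ _ (hu.1.sub (hφ.memLp _))).2.trans
      ((mul_le_mul' le_rfl h1).trans (hle C₁ le_self_add))
  · rw [← pullbackCurl_sub]
    exact (hC₂ _ (hu.2.1.sub (hφ.memLp_curl _))).2.trans
      ((mul_le_mul' le_rfl h2).trans (hle C₂ le_add_self))

end IsLipEquiv

end HTS

namespace HTS

open Data

/-! ### The monotone operators of the state and adjoint equations -/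

namespace IsMonotoneOp

variable {μ : Measure E3} {N N' : E3 → E3 → E3} {m m' L L' : ℝ}

theorem weaken (h : IsMonotoneOp μ N m L) (hm : m' ≤ m) (hL : L ≤ L') :
    IsMonotoneOp μ N m' L' where
  meas := h.meas
  zero := h.zero
  lip := by
    filter_upwards [h.lip] with x hx a b
    exact (hx a b).trans (by gcongr)
  mono := by
    filter_upwards [h.mono] with x hx a b
    exact le_trans (by gcongr) (hx a b)

theorem add (h : IsMonotoneOp μ N m L) (h' : IsMonotoneOp μ N' m' L') :
    IsMonotoneOp μ (fun x a => N x a + N' x a) (m + m') (L + L') where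
  meas u hu := (h.meas u hu).add (h'.meas u hu)
  zero := by
    filter_upwards [h.zero, h'.zero] with x h1 h2
    rw [h1, h2, add_zero]
  lip := by
    filter_upwards [h.lip, h'.lip] with x h1 h2 a b
    rw [add_sub_add_comm, add_mul]
    exact (norm_add_le _ _).trans (add_le_add (h1 a b) (h2 a b))
  mono := by
    filter_upwards [h.mono, h'.mono] with x h1 h2 a b
    rw [add_sub_add_comm, add_mul, inner_add_left]
    exact add_le_add (h1 a b) (h2 a b)

/-- Strong monotonicity in integrated form, for a pair of operators. -/
theorem stability {N₁ N₂ : E3 → E3 → E3} (h₁ : IsMonotoneOp μ N₁ m L)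
    (h₂ : IsMonotoneOp μ N₂ m L) {u u' c c' : Field} (hu : MemLp u 2 μ) (hu' : MemLp u' 2 μ)
    (hc : MemLp c 2 μ) (hc' : MemLp c' 2 μ) :
    m * (l2 μ (u - u') ^ 2 + l2 μ (c - c') ^ 2) ≤
      ((∫ x, ⟪N₂ x (c x), (c - c') x⟫_ℝ ∂μ) + ∫ x, ⟪N₁ x (u x), (u - u') x⟫_ℝ ∂μ) -
        ((∫ x, ⟪N₂ x (c' x), (c - c') x⟫_ℝ ∂μ) + ∫ x, ⟪N₁ x (u' x), (u - u') x⟫_ℝ ∂μ) := by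
  have e1 := h₁.le_integral hu hu'
  have e2 := h₂.le_integral hc hc'
  simp only [inner_sub_left] at e1 e2
  have i1 := integral_sub (integrable_inner (h₁.memLp hu) (hu.sub hu'))
    (integrable_inner (h₁.memLp hu') (hu.sub hu'))
  have i2 := integral_sub (integrable_inner (h₂.memLp hc) (hc.sub hc'))
    (integrable_inner (h₂.memLp hc') (hc.sub hc'))
  simp only [Pi.sub_apply] at i1 i2 ⊢
  rw [i1] at e1
  rw [i2] at e2
  linarith

end IsMonotoneOp

theorem ae_eq_of_isMonotoneOp {μ : Measure E3} {N₁ N₂ : E3 → E3 → E3} {m L : ℝ}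
    (hm : 0 < m) (h₁ : IsMonotoneOp μ N₁ m L) (h₂ : IsMonotoneOp μ N₂ m L) {u u' c c' : Field}
    (hu : MemLp u 2 μ) (hu' : MemLp u' 2 μ) (hc : MemLp c 2 μ) (hc' : MemLp c' 2 μ)
    (h : (∫ x, ⟪N₂ x (c x), (c - c') x⟫_ℝ ∂μ) + ∫ x, ⟪N₁ x (u x), (u - u') x⟫_ℝ ∂μ =
      (∫ x, ⟪N₂ x (c' x), (c - c') x⟫_ℝ ∂μ) + ∫ x, ⟪N₁ x (u' x), (u - u') x⟫_ℝ ∂μ) :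
    u =ᵐ[μ] u' := by
  have := h₁.stability h₂ hu hu' hc hc'
  rw [h, sub_self] at this
  have h0 : l2 μ (u - u') ^ 2 + l2 μ (c - c') ^ 2 ≤ 0 := by
    by_contra hn
    exact absurd this (not_le.2 (mul_pos hm (not_le.1 hn)))
  have h3 : l2 μ (u - u') = 0 := by
    have : l2 μ (u - u') ^ 2 = 0 := by
      have := sq_nonneg (l2 μ (u - u'))
      have := sq_nonneg (l2 μ (c - c'))
      linarith
    exact pow_eq_zero_iff two_ne_zero |>.1 this
  have h4 : eLpNorm (u - u') 2 μ = 0 := by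
    rw [eLpNorm_eq_l2 (hu.sub hu'), h3, ENNReal.ofReal_zero]
  rw [eLpNorm_eq_zero_iff (hu.sub hu').1 two_ne_zero] at h4
  filter_upwards [h4] with x hx
  exact sub_eq_zero.1 hx

theorem ae_norm_le_of_memLp_top {F : Type*} [NormedAddCommGroup F] {μ : Measure E3} {g : E3 → F}
    (hg : MemLp g ∞ μ) : ∃ C : ℝ, 0 ≤ C ∧ ∀ᵐ x ∂μ, ‖g x‖ ≤ C := by
  refine ⟨(eLpNorm g ∞ μ).toReal, ENNReal.toReal_nonneg, ?_⟩
  filter_upwards [ae_le_eLpNormEssSup (f := g) (μ := μ)] with x hx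
  rw [← eLpNorm_exponent_top] at hx
  rw [← toReal_enorm]
  exact ENNReal.toReal_mono hg.eLpNorm_ne_top hx

theorem IsMaterial.isMonotoneOp {Ω B : Set E3} {M : E3 → Tensor} (h : IsMaterial Ω B M) :
    ∃ c C : ℝ, 0 < c ∧ 0 ≤ C ∧ IsMonotoneOp (volume.restrict Ω) (fun x a => M x a) c C := by
  obtain ⟨c, hc, hcM⟩ := h.2.2.2
  obtain ⟨C, hC, hCM⟩ := ae_norm_le_of_memLp_top h.1
  refine ⟨c, C, hc, hC, ⟨fun u hu => aestronglyMeasurable_apply h.1.1 hu,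
    ae_of_all _ fun x => map_zero _, ?_, ?_⟩⟩
  · filter_upwards [hCM] with x hx a b
    rw [← map_sub]
    exact ((M x).le_opNorm _).trans (by gcongr)
  · filter_upwards [hcM] with x hx a b
    rw [← map_sub, real_inner_comm]
    exact hx _

theorem measurable_chi {ω : Set E3} (hω : MeasurableSet ω) : Measurable (chi ω) :=
  Measurable.ite hω measurable_const measurable_const

theorem chi_nonneg (ω : Set E3) (x : E3) : 0 ≤ chi ω x := by
  rw [chi]; split_ifs <;> norm_num

theorem chi_le_one (ω : Set E3) (x : E3) : chi ω x ≤ 1 := by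
  rw [chi]; split_ifs <;> norm_num

theorem norm_chi_le_one (ω : Set E3) (x : E3) : ‖chi ω x‖ ≤ 1 := by
  rw [Real.norm_of_nonneg (chi_nonneg ω x)]; exact chi_le_one ω x

theorem setIntegral_chi_mul {Ω ω : Set E3} (hω : MeasurableSet ω) (hs : ω ⊆ Ω) (g : E3 → ℝ) :
    ∫ x in Ω, chi ω x * g x = ∫ x in ω, g x := by
  have : (fun x => chi ω x * g x) = ω.indicator g := by
    funext x
    by_cases hx : x ∈ ω <;> simp [chi, hx]
  rw [this, setIntegral_indicator hω, Set.inter_eq_right.2 hs]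

/-- The superconducting term is monotone with constant 0 only: it adds nothing to the coercivity
supplied by ε and destroys none of it. -/
theorem isMonotoneOp_chi {μ : Measure E3} {ω : Set E3} (hω : MeasurableSet ω)
    {Q : E3 → E3 → E3} {L : ℝ}
    (hQ : ∀ u : Field, AEStronglyMeasurable u μ → AEStronglyMeasurable (fun x => Q x (u x)) μ)
    (h0 : ∀ x, Q x 0 = 0) (hL : ∀ x a b, ‖Q x a - Q x b‖ ≤ L * ‖a - b‖)
    (hm : ∀ x a b, 0 ≤ ⟪Q x a - Q x b, a - b⟫_ℝ) :
    IsMonotoneOp μ (fun x a => chi ω x • Q x a) 0 L where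
  meas u hu := (measurable_chi hω).aestronglyMeasurable.smul (hQ u hu)
  zero := ae_of_all _ fun x => by rw [h0, smul_zero]
  lip := ae_of_all _ fun x a b => by
    rw [← smul_sub, norm_smul]
    refine le_trans ?_ (hL x a b)
    exact mul_le_of_le_one_left (norm_nonneg _) (norm_chi_le_one ω x)
  mono := ae_of_all _ fun x a b => by
    rw [← smul_sub, real_inner_smul_left, zero_mul]
    exact mul_nonneg (chi_nonneg ω x) (hm x a b)

/-! ### Well-posedness of the state and adjoint equations. -/

namespace Data

variable {d : Data} {γ : ℝ} {ω : Set E3} {E P : Field}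

/-- The zero order part of the operator in the state equation. -/
noncomputable def stateOp (d : Data) (γ : ℝ) (ω : Set E3) (x a : E3) : E3 :=
  d.ε x a + chi ω x • Lam d.jc γ a

/-- The zero order part of the operator in the adjoint equation. -/
noncomputable def adjointOp (d : Data) (γ : ℝ) (ω : Set E3) (E : Field) (x a : E3) : E3 :=
  d.ε x a + chi ω x • psi d.jc γ (E x) a

namespace Admissible

theorem isOpen_Ω (hd : d.Admissible) : IsOpen d.Ω := hd.lipschitz_Ω.2.choose_spec.1

theorem isOpen_B (hd : d.Admissible) : IsOpen d.B := hd.lipschitz_B.2.choose_spec.1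

theorem isFiniteMeasure (hd : d.Admissible) : IsFiniteMeasure (volume.restrict d.Ω) := ⟨by
  rw [Measure.restrict_apply_univ]; exact hd.bounded.measure_lt_top⟩

theorem isFiniteMeasure_B (hd : d.Admissible) : IsFiniteMeasure (volume.restrict d.B) := ⟨by
  rw [Measure.restrict_apply_univ]; exact (hd.bounded.subset hd.subset).measure_lt_top⟩

theorem exists_isMonotoneOp (hd : d.Admissible) (hγ : 0 < γ) :
    ∃ m L : ℝ, 0 < m ∧ IsMonotoneOp (volume.restrict d.Ω) (fun x a => d.ν x a) m L ∧
      (∀ ω : Set E3, MeasurableSet ω →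
        IsMonotoneOp (volume.restrict d.Ω) (d.stateOp γ ω) m L) ∧
      ∀ (ω : Set E3) (E : Field), MeasurableSet ω → AEStronglyMeasurable E (volume.restrict d.Ω) →
        IsMonotoneOp (volume.restrict d.Ω) (d.adjointOp γ ω E) m L := by
  obtain ⟨c₁, C₁, hc₁, hC₁, h₁⟩ := hd.permittivity.isMonotoneOp
  obtain ⟨c₂, C₂, hc₂, hC₂, h₂⟩ := hd.reluctivity.isMonotoneOp
  have hj := hd.jc_pos
  have hjγ : 0 ≤ 2 * (d.jc * γ) := by positivity
  refine ⟨min c₁ c₂, C₁ + C₂ + 2 * (d.jc * γ), lt_min hc₁ hc₂,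
    h₂.weaken (min_le_right _ _) (by linarith), fun ω hω => ?_, fun ω E hω hE => ?_⟩
  · refine (h₁.add (isMonotoneOp_chi hω (Q := fun _ => Lam d.jc γ) (L := 2 * (d.jc * γ))
      (fun u hu => (continuous_Lam hγ).comp_aestronglyMeasurable hu) (fun _ => Lam_zero)
      (fun _ => norm_Lam_sub_le hj hγ) (fun _ => inner_Lam_sub_nonneg hj hγ))).weaken ?_ ?_
    · rw [add_zero]; exact min_le_left _ _
    · linarith
  · refine (h₁.add (isMonotoneOp_chi hω (Q := fun x => psi d.jc γ (E x)) (L := 2 * (d.jc * γ))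
      (fun u hu => aestronglyMeasurable_apply ?_ hu) (fun _ => map_zero _)
      (fun x a b => ?_) (fun x a b => ?_))).weaken ?_ ?_
    · exact ((measurable_psi hγ).comp_aemeasurable hE.aemeasurable).aestronglyMeasurable
    · rw [← map_sub]; exact norm_psi_apply_le hj hγ _ _
    · rw [← map_sub]; exact inner_psi_nonneg hj hγ _ _
    · rw [add_zero]; exact min_le_left _ _
    · linarith

theorem exists_bounds_B (hd : d.Admissible) : ∃ C : ℝ, 0 ≤ C ∧ ∀ x ∈ d.B, |d.κ x| ≤ C ∧ ‖fderiv ℝ d.κ x‖ ≤ C ∧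
    ‖d.Ed x‖ ≤ C ∧ ‖fderiv ℝ d.Ed x‖ ≤ C ∧ ‖fderiv ℝ d.f x‖ ≤ C ∧
    ‖d.ε x‖ ≤ C ∧ ‖fderiv ℝ d.ε x‖ ≤ C ∧ ‖d.ν x‖ ≤ C ∧ ‖fderiv ℝ d.ν x‖ ≤ C := by
  obtain ⟨C₁, h₁⟩ := hd.weight.2
  obtain ⟨C₂, h₂⟩ := hd.target.2
  obtain ⟨C₃, h₃⟩ := hd.source.2.2
  obtain ⟨C₄, h₄⟩ := hd.permittivity.2.1.2
  obtain ⟨C₅, h₅⟩ := hd.reluctivity.2.1.2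
  have a1 := le_abs_self C₁
  have a2 := le_abs_self C₂
  have a3 := le_abs_self C₃
  have a4 := le_abs_self C₄
  have a5 := le_abs_self C₅
  have b1 := abs_nonneg C₁
  have b2 := abs_nonneg C₂
  have b3 := abs_nonneg C₃
  have b4 := abs_nonneg C₄
  have b5 := abs_nonneg C₅
  refine ⟨|C₁| + |C₂| + |C₃| + |C₄| + |C₅|, by linarith, fun x hx => ?_⟩
  have k1 := h₁ x hx
  have k2 := h₂ x hx
  have k3 := h₃ x hx
  have k4 := h₄ x hx
  have k5 := h₅ x hx
  rw [Real.norm_eq_abs] at k1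
  refine ⟨?_, ?_, ?_, ?_, ?_, ?_, ?_, ?_, ?_⟩ <;> linarith

theorem memLp_target (hd : d.Admissible) : MemLp d.Ed 2 (volume.restrict d.B) := by
  have := hd.isFiniteMeasure_B
  obtain ⟨C, -, hC⟩ := hd.exists_bounds_B
  exact MemLp.of_bound (hd.target.1.continuousOn.aestronglyMeasurable hd.isOpen_B.measurableSet) C
    ((ae_restrict_iff' hd.isOpen_B.measurableSet).2 (ae_of_all _ fun x hx => (hC x hx).2.2.1))

theorem aestronglyMeasurable_weight (hd : d.Admissible) : AEStronglyMeasurable d.κ (volume.restrict d.B) :=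
  hd.weight.1.continuousOn.aestronglyMeasurable hd.isOpen_B.measurableSet

theorem memLp_restrict_B (hd : d.Admissible) {u : Field} (hu : MemLp u 2 (volume.restrict d.Ω)) :
    MemLp u 2 (volume.restrict d.B) := hu.mono_measure (Measure.restrict_mono_set _ hd.subset)

theorem memLp_misfit (hd : d.Admissible) (hE : MemLp E 2 (volume.restrict d.Ω)) :
    MemLp (fun x => d.κ x • (E x - d.Ed x)) 2 (volume.restrict d.B) := by
  obtain ⟨C, -, hC⟩ := hd.exists_bounds_B
  have h := (hd.memLp_restrict_B hE).sub hd.memLp_target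
  refine h.of_le_mul (c := C) (hd.aestronglyMeasurable_weight.smul h.1) ?_
  refine (ae_restrict_iff' hd.isOpen_B.measurableSet).2 (ae_of_all _ fun x hx => ?_)
  rw [norm_smul, Real.norm_eq_abs]
  exact mul_le_mul_of_nonneg_right (hC x hx).1 (norm_nonneg _)

theorem integral_stateOp (hd : d.Admissible) (hγ : 0 < γ) (hω : MeasurableSet ω) (hs : ω ⊆ d.Ω) {u v : Field}
    (hu : MemLp u 2 (volume.restrict d.Ω)) (hv : MemLp v 2 (volume.restrict d.Ω)) :
    ∫ x in d.Ω, ⟪d.stateOp γ ω x (u x), v x⟫_ℝ =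
      (∫ x in d.Ω, ⟪d.ε x (u x), v x⟫_ℝ) + ∫ x in ω, ⟪Lam d.jc γ (u x), v x⟫_ℝ := by
  obtain ⟨c, C, -, -, h⟩ := hd.permittivity.isMonotoneOp
  obtain ⟨m, L, -, -, hs', -⟩ := hd.exists_isMonotoneOp hγ
  rw [← setIntegral_chi_mul hω hs, ← integral_add (integrable_inner (h.memLp hu) hv)]
  · simp only [stateOp, inner_add_left, real_inner_smul_left]
  · have := (integrable_inner ((hs' ω hω).memLp hu) hv).sub (integrable_inner (h.memLp hu) hv)
    refine this.congr (ae_of_all _ fun x => ?_)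
    simp [stateOp, inner_add_left, real_inner_smul_left]

theorem integral_adjointOp (hd : d.Admissible) (hγ : 0 < γ) (hω : MeasurableSet ω) (hs : ω ⊆ d.Ω) {u v : Field}
    (hE : AEStronglyMeasurable E (volume.restrict d.Ω))
    (hu : MemLp u 2 (volume.restrict d.Ω)) (hv : MemLp v 2 (volume.restrict d.Ω)) :
    ∫ x in d.Ω, ⟪d.adjointOp γ ω E x (u x), v x⟫_ℝ =
      (∫ x in d.Ω, ⟪d.ε x (u x), v x⟫_ℝ) + ∫ x in ω, ⟪psi d.jc γ (E x) (u x), v x⟫_ℝ := by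
  obtain ⟨c, C, -, -, h⟩ := hd.permittivity.isMonotoneOp
  obtain ⟨m, L, -, -, -, hs'⟩ := hd.exists_isMonotoneOp hγ
  rw [← setIntegral_chi_mul hω hs, ← integral_add (integrable_inner (h.memLp hu) hv)]
  · simp only [adjointOp, inner_add_left, real_inner_smul_left]
  · have := (integrable_inner ((hs' ω E hω hE).memLp hu) hv).sub (integrable_inner (h.memLp hu) hv)
    refine this.congr (ae_of_all _ fun x => ?_)
    simp [adjointOp, inner_add_left, real_inner_smul_left]

/-- By symmetry of the materials, the adjoint equation, whose unknown is in the second slot of `a`,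
becomes an operator equation of the same form as the state equation. -/
theorem a_comm (hd : d.Admissible) (u v : Field) : d.a u v = d.a v u := by
  have key : ∀ {m : E3 → Tensor}, IsMaterial d.Ω d.B m → ∀ u v : Field,
      ∫ x in d.Ω, ⟪m x (u x), v x⟫_ℝ = ∫ x in d.Ω, ⟪m x (v x), u x⟫_ℝ := by
    intro m hm u v
    refine integral_congr_ae ?_
    filter_upwards [hm.2.2.1] with x hx
    rw [← inner_transp_right, hx, real_inner_comm]
  rw [a, a, key hd.reluctivity, key hd.permittivity]

/-- The form `a`, evaluated on pairs. -/
theorem a_eq (hd : d.Admissible) {u c v w : Field} (hu : H0Pair d.Ω u c) (hv : H0Pair d.Ω v w) :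
    d.a u v = (∫ x in d.Ω, ⟪d.ν x (c x), w x⟫_ℝ) + ∫ x in d.Ω, ⟪d.ε x (u x), v x⟫_ℝ := by
  rw [a]
  congr 1
  refine integral_congr_ae ?_
  filter_upwards [hu.weakCurl_ae_eq hd.isOpen_Ω, hv.weakCurl_ae_eq hd.isOpen_Ω] with x h1 h2
  rw [h1, h2]

theorem isState_iff (hd : d.Admissible) (hγ : 0 < γ) (hω : MeasurableSet ω) (hs : ω ⊆ d.Ω) {c : Field}
    (hE : H0Pair d.Ω E c) : d.IsState γ ω E ↔ ∀ v w : Field, H0Pair d.Ω v w →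
      (∫ x in d.Ω, ⟪d.ν x (c x), w x⟫_ℝ) + ∫ x in d.Ω, ⟪d.stateOp γ ω x (E x), v x⟫_ℝ =
        ∫ x in d.Ω, ⟪d.f x, v x⟫_ℝ := by
  constructor
  · intro h v w hv
    rw [hd.integral_stateOp hγ hω hs hE.1 hv.1, ← add_assoc, ← hd.a_eq hE hv]
    exact h.2 v (hv.memH0curl hd.isOpen_Ω)
  · intro h
    refine ⟨hE.memH0curl hd.isOpen_Ω, fun v hv => ?_⟩
    have := h _ _ hv.h0Pair
    rwa [hd.integral_stateOp hγ hω hs hE.1 hv.1.1, ← add_assoc, ← hd.a_eq hE hv.h0Pair] at this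

theorem isAdjoint_iff (hd : d.Admissible) (hγ : 0 < γ) (hω : MeasurableSet ω) (hs : ω ⊆ d.Ω)
    (hE : MemLp E 2 (volume.restrict d.Ω)) {c : Field}
    (hP : H0Pair d.Ω P c) : d.IsAdjoint γ ω E P ↔ ∀ v w : Field, H0Pair d.Ω v w →
      (∫ x in d.Ω, ⟪d.ν x (c x), w x⟫_ℝ) + ∫ x in d.Ω, ⟪d.adjointOp γ ω E x (P x), v x⟫_ℝ =
        - ∫ x in d.B, d.κ x * ⟪E x - d.Ed x, v x⟫_ℝ := by
  constructor
  · intro h v w hv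
    rw [hd.integral_adjointOp hγ hω hs hE.1 hP.1 hv.1, ← add_assoc, ← hd.a_eq hP hv, hd.a_comm]
    exact h.2 v (hv.memH0curl hd.isOpen_Ω)
  · intro h
    refine ⟨hP.memH0curl hd.isOpen_Ω, fun v hv => ?_⟩
    have := h _ _ hv.h0Pair
    rwa [hd.integral_adjointOp hγ hω hs hE.1 hP.1 hv.1.1, ← add_assoc, ← hd.a_eq hP hv.h0Pair,
      hd.a_comm] at this

theorem exists_isState (hd : d.Admissible) (hγ : 0 < γ) (hω : MeasurableSet ω) (hs : ω ⊆ d.Ω) :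
    ∃ E : Field, d.IsState γ ω E := by
  obtain ⟨m, L, hm, h2, h1, -⟩ := hd.exists_isMonotoneOp hγ
  obtain ⟨u, c, hu, h⟩ := exists_h0Pair_solution hm (h1 ω hω) h2 hd.source.1
  exact ⟨u, (hd.isState_iff hγ hω hs hu).2 h⟩

theorem exists_isAdjoint (hd : d.Admissible) (hγ : 0 < γ) (hω : MeasurableSet ω) (hs : ω ⊆ d.Ω)
    (hE : MemLp E 2 (volume.restrict d.Ω)) : ∃ P : Field, d.IsAdjoint γ ω E P := by
  obtain ⟨m, L, hm, h2, -, h1⟩ := hd.exists_isMonotoneOp hγ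
  have hB := hd.isOpen_B.measurableSet
  -- The misfit lives on `B`; extended by zero it is a square integrable source on `Ω`.
  have hg : MemLp (d.B.indicator fun x => -(d.κ x • (E x - d.Ed x))) 2 (volume.restrict d.Ω) := by
    rw [memLp_indicator_iff_restrict hB, Measure.restrict_restrict hB,
      Set.inter_eq_left.2 hd.subset]
    exact (hd.memLp_misfit hE).neg
  obtain ⟨u, c, hu, h⟩ := exists_h0Pair_solution hm (h1 ω E hω hE.1) h2 hg
  refine ⟨u, (hd.isAdjoint_iff hγ hω hs hE hu).2 fun v w hv => (h v w hv).trans ?_⟩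
  have : (fun x => ⟪d.B.indicator (fun x => -(d.κ x • (E x - d.Ed x))) x, v x⟫_ℝ) =
      d.B.indicator fun x => -(d.κ x * ⟪E x - d.Ed x, v x⟫_ℝ) := by
    funext x
    by_cases hx : x ∈ d.B <;> simp [hx, real_inner_smul_left]
  rw [this, setIntegral_indicator hB, Set.inter_eq_right.2 hd.subset, integral_neg]

theorem isState_unique (hd : d.Admissible) (hγ : 0 < γ) (hω : MeasurableSet ω) (hs : ω ⊆ d.Ω) {E₂ : Field}
    (h : d.IsState γ ω E) (h₂ : d.IsState γ ω E₂) : E =ᵐ[volume.restrict d.Ω] E₂ := by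
  obtain ⟨m, L, hm, hν, hN, -⟩ := hd.exists_isMonotoneOp hγ
  have p := h.1.h0Pair
  have p₂ := h₂.1.h0Pair
  exact ae_eq_of_isMonotoneOp hm (hN ω hω) hν p.1 p₂.1 p.2.1 p₂.2.1
    (((hd.isState_iff hγ hω hs p).1 h _ _ (p.sub p₂)).trans
      ((hd.isState_iff hγ hω hs p₂).1 h₂ _ _ (p.sub p₂)).symm)

theorem isAdjoint_unique (hd : d.Admissible) (hγ : 0 < γ) (hω : MeasurableSet ω) (hs : ω ⊆ d.Ω)
    (hE : MemLp E 2 (volume.restrict d.Ω)) {P₂ : Field}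
    (h : d.IsAdjoint γ ω E P) (h₂ : d.IsAdjoint γ ω E P₂) : P =ᵐ[volume.restrict d.Ω] P₂ := by
  obtain ⟨m, L, hm, hν, -, hN⟩ := hd.exists_isMonotoneOp hγ
  have p := h.1.h0Pair
  have p₂ := h₂.1.h0Pair
  exact ae_eq_of_isMonotoneOp hm (hN ω E hω hE.1) hν p.1 p₂.1 p.2.1 p₂.2.1
    (((hd.isAdjoint_iff hγ hω hs hE p).1 h _ _ (p.sub p₂)).trans
      ((hd.isAdjoint_iff hγ hω hs hE p₂).1 h₂ _ _ (p.sub p₂)).symm)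

end Admissible

end Data

end HTS

namespace HTS

open Data

/-! ### First order expansions along a sequence of parameters -/

section Expands

variable {V W Z : Type*} [NormedAddCommGroup V] [NormedSpace ℝ V] [NormedAddCommGroup W]
  [NormedSpace ℝ W] [NormedAddCommGroup Z] [NormedSpace ℝ Z]

/-- `a n = a₀ + t n • p n + o(t n)`, with bounds by `α`. -/
structure Expands (t : ℕ → ℝ) (a : ℕ → V) (a₀ : V) (p : ℕ → V) (α : ℝ) : Prop where
  bound : ∀ n, ‖a n‖ ≤ α
  bound_zero : ‖a₀‖ ≤ α
  near : ∀ n, ‖a n - a₀‖ ≤ α * t n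
  bound_deriv : ∀ n, ‖p n‖ ≤ α
  -- The first order coefficient may depend on `n`: the difference quotients of the derivative of
  -- the flow are bounded, and no pointwise limit for them is required.
  lim : Tendsto (fun n => (t n)⁻¹ • (a n - a₀) - p n) atTop (𝓝 0)

namespace Expands

variable {t : ℕ → ℝ} {a : ℕ → V} {a₀ : V} {p : ℕ → V} {α : ℝ} {b : ℕ → W} {b₀ : W} {q : ℕ → W}
  {β : ℝ}

theorem nonneg (h : Expands t a a₀ p α) : 0 ≤ α := (norm_nonneg _).trans h.bound_zero

theorem const (ht : ∀ n, 0 ≤ t n) (a₀ : V) : Expands t (fun _ => a₀) a₀ (fun _ => 0) ‖a₀‖ where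
  bound _ := le_rfl
  bound_zero := le_rfl
  near n := by simpa using mul_nonneg (norm_nonneg _) (ht n)
  bound_deriv n := by simp
  lim := by simp

theorem weaken (h : Expands t a a₀ p α) (ht : ∀ n, 0 ≤ t n) {α' : ℝ} (hα : α ≤ α') :
    Expands t a a₀ p α' where
  bound n := (h.bound n).trans hα
  bound_zero := h.bound_zero.trans hα
  near n := (h.near n).trans (mul_le_mul_of_nonneg_right hα (ht n))
  bound_deriv n := (h.bound_deriv n).trans hα
  lim := h.lim

theorem congr_deriv (h : Expands t a a₀ p α) {p' : ℕ → V} (hp : ∀ n, p n = p' n) :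
    Expands t a a₀ p' α := by
  rwa [← funext hp]

theorem norm_quotient_le (h : Expands t a a₀ p α) (ht : ∀ n, 0 < t n) (n : ℕ) :
    ‖(t n)⁻¹ • (a n - a₀)‖ ≤ α := by
  rw [norm_smul, norm_inv, Real.norm_of_nonneg (ht n).le, inv_mul_le_iff₀ (ht n), mul_comm]
  exact h.near n

theorem tendsto (h : Expands t a a₀ p α) (h0 : Tendsto t atTop (𝓝 0)) :
    Tendsto a atTop (𝓝 a₀) := by
  rw [tendsto_iff_norm_sub_tendsto_zero]
  have := h0.const_mul α
  rw [mul_zero] at this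
  exact squeeze_zero (fun n => norm_nonneg _) h.near this

theorem add (h : Expands t a a₀ p α) {b : ℕ → V} {b₀ : V} {q : ℕ → V} (h' : Expands t b b₀ q β) :
    Expands t (fun n => a n + b n) (a₀ + b₀) (fun n => p n + q n) (α + β) where
  bound n := (norm_add_le _ _).trans (add_le_add (h.bound n) (h'.bound n))
  bound_zero := (norm_add_le _ _).trans (add_le_add h.bound_zero h'.bound_zero)
  near n := by
    rw [add_sub_add_comm, add_mul]
    exact (norm_add_le _ _).trans (add_le_add (h.near n) (h'.near n))
  bound_deriv n := (norm_add_le _ _).trans (add_le_add (h.bound_deriv n) (h'.bound_deriv n))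
  lim := by
    have := h.lim.add h'.lim
    rw [add_zero] at this
    refine this.congr fun n => ?_
    rw [add_sub_add_comm, smul_add]
    abel

theorem neg (h : Expands t a a₀ p α) :
    Expands t (fun n => -a n) (-a₀) (fun n => -p n) α where
  bound n := by rw [norm_neg]; exact h.bound n
  bound_zero := by rw [norm_neg]; exact h.bound_zero
  near n := by rw [← neg_add', norm_neg, ← sub_eq_add_neg]; exact h.near n
  bound_deriv n := by rw [norm_neg]; exact h.bound_deriv n
  lim := by
    have := h.lim.neg
    rw [neg_zero] at this
    refine this.congr fun n => ?_
    simp only [smul_sub, smul_neg]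
    abel

theorem sub (h : Expands t a a₀ p α) {b : ℕ → V} {b₀ : V} {q : ℕ → V} (h' : Expands t b b₀ q β) :
    Expands t (fun n => a n - b n) (a₀ - b₀) (fun n => p n - q n) (α + β) := by
  simpa only [sub_eq_add_neg] using h.add h'.neg

/-- The product rule, from which the scalar, tensor, application and inner products below are
specialised. The factor 2 comes from its two terms. -/
theorem bilin (h : Expands t a a₀ p α) (h' : Expands t b b₀ q β) (ht : ∀ n, 0 < t n)
    (h0 : Tendsto t atTop (𝓝 0)) (B : V →L[ℝ] W →L[ℝ] Z) (hB : ∀ v w, ‖B v w‖ ≤ ‖v‖ * ‖w‖) :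
    Expands t (fun n => B (a n) (b n)) (B a₀ b₀) (fun n => B (p n) b₀ + B a₀ (q n))
      (2 * (α * β)) := by
  have hα := h.nonneg
  have hβ := h'.nonneg
  have hαβ : 0 ≤ α * β := mul_nonneg hα hβ
  have hle : ∀ {v : V} {w : W} {x y : ℝ}, ‖v‖ ≤ x → ‖w‖ ≤ y → ‖B v w‖ ≤ x * y := by
    intro v w x y hx hy
    exact (hB v w).trans (mul_le_mul hx hy (norm_nonneg _) ((norm_nonneg _).trans hx))
  have split : ∀ n, B (a n) (b n) - B a₀ b₀ = B (a n - a₀) (b n) + B a₀ (b n - b₀) := fun n => by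
    rw [map_sub, map_sub, _root_.sub_apply]; abel
  refine ⟨fun n => (hle (h.bound n) (h'.bound n)).trans (by linarith),
    (hle h.bound_zero h'.bound_zero).trans (by linarith), fun n => ?_, fun n => ?_, ?_⟩
  · rw [split]
    have e1 := hle (h.near n) (h'.bound n)
    have e2 := hle h.bound_zero (h'.near n)
    calc _ ≤ α * t n * β + α * (β * t n) := (norm_add_le _ _).trans (add_le_add e1 e2)
      _ = _ := by ring
  · have e1 := hle (h.bound_deriv n) h'.bound_zero
    have e2 := hle h.bound_zero (h'.bound_deriv n)
    calc _ ≤ α * β + α * β := (norm_add_le _ _).trans (add_le_add e1 e2)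
      _ = _ := by ring
  -- The error is one term of second order, a bounded quotient times a small increment, plus the two
  -- errors of the factors.
  · have e : ∀ n, (t n)⁻¹ • (B (a n) (b n) - B a₀ b₀) - (B (p n) b₀ + B a₀ (q n)) =
        B ((t n)⁻¹ • (a n - a₀)) (b n - b₀) + B ((t n)⁻¹ • (a n - a₀) - p n) b₀ +
          B a₀ ((t n)⁻¹ • (b n - b₀) - q n) := fun n => by
      rw [split]
      simp only [map_sub, map_smul, _root_.sub_apply, _root_.smul_apply, smul_add, smul_sub]
      abel
    simp only [e]
    have l1 : Tendsto (fun n => B ((t n)⁻¹ • (a n - a₀)) (b n - b₀)) atTop (𝓝 0) := by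
      have := h0.const_mul (α * β)
      rw [mul_zero] at this
      refine squeeze_zero_norm (fun n => ?_) this
      refine (hle (h.norm_quotient_le ht n) (h'.near n)).trans (by rw [mul_assoc])
    have l2 : Tendsto (fun n => B ((t n)⁻¹ • (a n - a₀) - p n) b₀) atTop (𝓝 0) := by
      have := h.lim.norm.mul_const ‖b₀‖
      rw [norm_zero, zero_mul] at this
      exact squeeze_zero_norm (fun n => hB _ _) this
    have l3 : Tendsto (fun n => B a₀ ((t n)⁻¹ • (b n - b₀) - q n)) atTop (𝓝 0) := by
      have := h'.lim.norm.const_mul ‖a₀‖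
      rw [norm_zero, mul_zero] at this
      exact squeeze_zero_norm (fun n => hB _ _) this
    simpa using (l1.add l2).add l3

theorem smul {a : ℕ → ℝ} {a₀ : ℝ} {p : ℕ → ℝ} (h : Expands t a a₀ p α) (h' : Expands t b b₀ q β)
    (ht : ∀ n, 0 < t n) (h0 : Tendsto t atTop (𝓝 0)) :
    Expands t (fun n => a n • b n) (a₀ • b₀) (fun n => p n • b₀ + a₀ • q n) (2 * (α * β)) :=
  h.bilin h' ht h0 (ContinuousLinearMap.lsmul ℝ ℝ) fun v w => (norm_smul v w).le

theorem mul {a b : ℕ → ℝ} {a₀ b₀ : ℝ} {p q : ℕ → ℝ} (h : Expands t a a₀ p α)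
    (h' : Expands t b b₀ q β) (ht : ∀ n, 0 < t n) (h0 : Tendsto t atTop (𝓝 0)) :
    Expands t (fun n => a n * b n) (a₀ * b₀) (fun n => p n * b₀ + a₀ * q n) (2 * (α * β)) :=
  h.bilin h' ht h0 (ContinuousLinearMap.lsmul ℝ ℝ) fun v w => (norm_smul v w).le

theorem apply {a : ℕ → V →L[ℝ] W} {a₀ : V →L[ℝ] W} {p : ℕ → V →L[ℝ] W} {b : ℕ → V} {b₀ : V}
    {q : ℕ → V} (h : Expands t a a₀ p α) (h' : Expands t b b₀ q β)
    (ht : ∀ n, 0 < t n) (h0 : Tendsto t atTop (𝓝 0)) :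
    Expands t (fun n => a n (b n)) (a₀ b₀) (fun n => p n b₀ + a₀ (q n)) (2 * (α * β)) :=
  h.bilin h' ht h0 (ContinuousLinearMap.id ℝ (V →L[ℝ] W)) fun v w => v.le_opNorm w

theorem inner {a b : ℕ → E3} {a₀ b₀ : E3} {p q : ℕ → E3} (h : Expands t a a₀ p α)
    (h' : Expands t b b₀ q β) (ht : ∀ n, 0 < t n) (h0 : Tendsto t atTop (𝓝 0)) :
    Expands t (fun n => ⟪a n, b n⟫_ℝ) ⟪a₀, b₀⟫_ℝ (fun n => ⟪p n, b₀⟫_ℝ + ⟪a₀, q n⟫_ℝ)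
      (2 * (α * β)) :=
  h.bilin h' ht h0 (innerSL ℝ) fun v w => norm_inner_le_norm v w

/-- Composition with a differentiable function with linear growth bounds along the sequence. -/
theorem comp (h : Expands t a a₀ p α) (ht : ∀ n, 0 < t n) (h0 : Tendsto t atTop (𝓝 0))
    {Φ : V → W} {Φ' : V →L[ℝ] W} (hΦ : HasFDerivAt Φ Φ' a₀) (hb : ∀ n, ‖Φ (a n)‖ ≤ β)
    (hb0 : ‖Φ a₀‖ ≤ β) (hb' : ‖Φ'‖ * α ≤ β) (hn : ∀ n, ‖Φ (a n) - Φ a₀‖ ≤ β * t n) :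
    Expands t (fun n => Φ (a n)) (Φ a₀) (fun n => Φ' (p n)) β where
  bound := hb
  bound_zero := hb0
  near := hn
  bound_deriv n := (Φ'.le_opNorm _).trans
    ((mul_le_mul_of_nonneg_left (h.bound_deriv n) (norm_nonneg _)).trans hb')
  lim := by
    have h1 := hΦ.isLittleO.comp_tendsto (h.tendsto h0)
    have h2 : (fun n => a n - a₀) =O[atTop] t :=
      Asymptotics.IsBigO.of_bound α (Eventually.of_forall fun n => by
        rw [Real.norm_of_nonneg (ht n).le]; exact h.near n)
    have h3 := h1.trans_isBigO h2
    have h4 : Tendsto (fun n => (t n)⁻¹ • (Φ (a n) - Φ a₀ - Φ' (a n - a₀))) atTop (𝓝 0) := by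
      have := h3.norm_left.tendsto_div_nhds_zero
      refine squeeze_zero_norm (fun n => ?_) this
      rw [norm_smul, norm_inv, Real.norm_of_nonneg (ht n).le, div_eq_inv_mul]
      rfl
    have h5 : Tendsto (fun n => Φ' ((t n)⁻¹ • (a n - a₀) - p n)) atTop (𝓝 0) := by
      have := (Φ'.continuous.tendsto 0).comp h.lim
      rwa [map_zero] at this
    have := h4.add h5
    rw [add_zero] at this
    refine this.congr fun n => ?_
    simp only [map_sub, map_smul, smul_sub]
    abel

end Expands

end Expands

/-! ### Expansions of functions of a tensor near the identity -/

/-- Through this identity the outer products in `S1` are matched with the first order terms of the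
Lagrangian. -/
theorem frob_outer_left (x y : E3) (A : Tensor) : frob (outer x y) A = ⟪x, A y⟫_ℝ := by
  have h : y = y 0 • e 0 + y 1 • e 1 + y 2 • e 2 := by
    ext i; fin_cases i <;> simp [e]
  conv_rhs => rw [h]
  simp only [frob, outer, InnerProductSpace.rankOne_apply, Fin.sum_univ_three,
    real_inner_smul_left, map_add, map_smul, inner_add_right, inner_smul_right]
  simp [e, EuclideanSpace.inner_single_right]

theorem frob_add_left (A B C : Tensor) : frob (A + B) C = frob A C + frob B C := by
  simp [frob, inner_add_left, Finset.sum_add_distrib]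

theorem frob_sub_left (A B C : Tensor) : frob (A - B) C = frob A C - frob B C := by
  simp [frob, inner_sub_left, Finset.sum_sub_distrib]

theorem frob_smul_left (c : ℝ) (A C : Tensor) : frob (c • A) C = c * frob A C := by
  simp [frob, real_inner_smul_left, Finset.mul_sum]

theorem frob_add_right (A B C : Tensor) : frob A (B + C) = frob A B + frob A C := by
  simp [frob, inner_add_right, Finset.sum_add_distrib]

theorem frob_smul_right (c : ℝ) (A C : Tensor) : frob A (c • C) = c * frob A C := by
  simp [frob, real_inner_smul_right, Finset.mul_sum]

theorem norm_e (j : Fin 3) : ‖e j‖ = 1 := by simp [e]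

theorem abs_frob_le (A B : Tensor) : |frob A B| ≤ 3 * (‖A‖ * ‖B‖) := by
  rw [frob]
  refine (Finset.abs_sum_le_sum_abs _ _).trans ?_
  have : ∀ j : Fin 3, |⟪A (e j), B (e j)⟫_ℝ| ≤ ‖A‖ * ‖B‖ := fun j => by
    refine (abs_real_inner_le_norm _ _).trans ?_
    have h1 := A.le_opNorm (e j)
    have h2 := B.le_opNorm (e j)
    rw [norm_e, mul_one] at h1 h2
    gcongr
  refine (Finset.sum_le_sum fun j _ => this j).trans ?_
  simp

/-- The trace. -/
noncomputable def trace (A : Tensor) : ℝ := frob (ContinuousLinearMap.id ℝ E3) A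

/-- The trace as a continuous linear map. -/
noncomputable def traceL : Tensor →L[ℝ] ℝ :=
  LinearMap.toContinuousLinearMap
    { toFun := trace
      map_add' := fun A B => frob_add_right _ A B
      map_smul' := fun c A => frob_smul_right c _ A }

theorem traceL_apply (A : Tensor) : traceL A = trace A := rfl

theorem hasFDerivAt_det_one : HasFDerivAt (fun A : Tensor => A.det) traceL 1 := by
  have hent : ∀ i j : Fin 3, HasFDerivAt (fun A : Tensor => A (e j) i)
      ((EuclideanSpace.proj i : E3 →L[ℝ] ℝ).comp (ContinuousLinearMap.apply ℝ E3 (e j))) 1 :=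
    fun i j => ((EuclideanSpace.proj i : E3 →L[ℝ] ℝ).comp
      (ContinuousLinearMap.apply ℝ E3 (e j))).hasFDerivAt
  have h : ∀ A : Tensor, A.det = A (e 0) 0 * (A (e 1) 1 * A (e 2) 2) -
      A (e 0) 0 * (A (e 2) 1 * A (e 1) 2) - A (e 1) 0 * (A (e 0) 1 * A (e 2) 2) +
      A (e 1) 0 * (A (e 2) 1 * A (e 0) 2) + A (e 2) 0 * (A (e 0) 1 * A (e 1) 2) -
      A (e 2) 0 * (A (e 1) 1 * A (e 0) 2) := fun A => by
    rw [det_eq, Matrix.det_fin_three]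
    simp only [toMat_apply]
    ring
  rw [show (fun A : Tensor => A.det) = _ from funext h]
  have h3 : ∀ i j k l m n : Fin 3, HasFDerivAt
      (fun A : Tensor => A (e i) j * (A (e k) l * A (e m) n)) _ 1 := fun i j k l m n =>
    (hent j i).mul ((hent l k).mul (hent n m))
  refine ((((((h3 0 0 1 1 2 2).sub (h3 0 0 2 1 1 2)).sub (h3 1 0 0 1 2 2)).add
    (h3 1 0 2 1 0 2)).add (h3 2 0 0 1 1 2)).sub (h3 2 0 1 1 0 2)).congr_fderiv ?_
  ext A
  rw [traceL_apply, trace, frob, Fin.sum_univ_three]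
  simp [e, EuclideanSpace.inner_single_left]
  ring

theorem det_one : (1 : Tensor).det = 1 := by
  rw [det_eq, map_one, Matrix.det_one]

/-- The inverse transpose. -/
noncomputable def invTransp (A : Tensor) : Tensor := transp (ContinuousLinearMap.inverse A)

theorem inverse_eq_of_mul_eq_one {A W : Tensor} (h1 : W * A = 1) (h2 : A * W = 1) :
    ContinuousLinearMap.inverse A = W := by
  have := ContinuousLinearMap.inverse_equiv (ContinuousLinearEquiv.equivOfInverse A W
    (fun x => congrArg (fun B : Tensor => B x) h1) (fun x => congrArg (fun B : Tensor => B x) h2))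
  exact this

theorem hasFDerivAt_invTransp_one : HasFDerivAt invTransp (-transpL) 1 := by
  have h1 := hasFDerivAt_ringInverse (𝕜 := ℝ) (1 : Tensorˣ)
  have h2 : (fun A : Tensor => Ring.inverse A) = ContinuousLinearMap.inverse :=
    ContinuousLinearMap.ringInverse_eq_inverse
  have h3 := transpL.hasFDerivAt.comp (1 : Tensor) h1
  have h4 : invTransp = transpL ∘ Ring.inverse := by
    funext A
    change transp (ContinuousLinearMap.inverse A) = transp (Ring.inverse A)
    rw [← h2]
  rw [h4]
  refine h3.congr_fderiv ?_
  ext1 A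
  simp

theorem invTransp_one : invTransp 1 = 1 := by
  rw [invTransp, inverse_eq_of_mul_eq_one (one_mul 1) (one_mul 1), transp_one]

/-- A neighbourhood of the identity on which determinant and inverse are controlled. -/
theorem exists_tensor_bounds : ∃ η D : ℝ, 0 < η ∧ 1 ≤ D ∧ ∀ A : Tensor, ‖A - 1‖ ≤ η →
    1 / 2 ≤ A.det ∧ |A.det - 1| ≤ D * ‖A - 1‖ ∧ |(A.det)⁻¹ - 1| ≤ D * ‖A - 1‖ ∧
    ‖invTransp A - 1‖ ≤ D * ‖A - 1‖ := by
  have h1 : ∀ᶠ A in 𝓝 (1 : Tensor), |A.det - 1| ≤ (‖traceL‖ + 1) * ‖A - 1‖ := by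
    have := hasFDerivAt_det_one.isLittleO.def one_pos
    filter_upwards [this] with A hA
    rw [det_one, one_mul] at hA
    have h2 := traceL.le_opNorm (A - 1)
    rw [Real.norm_eq_abs] at hA h2
    have h3 := abs_add_le (A.det - 1 - traceL (A - 1)) (traceL (A - 1))
    rw [sub_add_cancel] at h3
    linarith
  have h2 : ∀ᶠ A in 𝓝 (1 : Tensor), ‖invTransp A - 1‖ ≤ (‖transpL‖ + 1) * ‖A - 1‖ := by
    have := hasFDerivAt_invTransp_one.isLittleO.def one_pos
    filter_upwards [this] with A hA
    rw [invTransp_one, one_mul] at hA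
    have h2 := (-transpL).le_opNorm (A - 1)
    rw [norm_neg] at h2
    have h3 := norm_add_le (invTransp A - 1 - (-transpL) (A - 1)) ((-transpL) (A - 1))
    rw [sub_add_cancel] at h3
    linarith
  have h3 : ∀ᶠ A in 𝓝 (1 : Tensor), 1 / 2 ≤ A.det := by
    have := hasFDerivAt_det_one.continuousAt.tendsto
    rw [det_one] at this
    exact this.eventually (eventually_ge_nhds (by norm_num))
  obtain ⟨η, hη, hball⟩ := Metric.eventually_nhds_iff_ball.1 (h1.and (h2.and h3))
  have n1 : 0 ≤ ‖traceL‖ := norm_nonneg traceL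
  have n2 : 0 ≤ ‖transpL‖ := norm_nonneg transpL
  refine ⟨η / 2, 2 * (‖traceL‖ + 1) + ‖transpL‖, by linarith, by linarith, fun A hA => ?_⟩
  obtain ⟨k1, k2, k3⟩ := hball A (by rw [Metric.mem_ball, dist_eq_norm]; linarith)
  have n3 : 0 ≤ ‖A - 1‖ := norm_nonneg _
  have m1 : 0 ≤ ‖traceL‖ * ‖A - 1‖ := by positivity
  have m2 : 0 ≤ ‖transpL‖ * ‖A - 1‖ := by positivity
  refine ⟨k3, by linarith, ?_, by linarith⟩
  have hd : 0 < A.det := by linarith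
  have e : (A.det)⁻¹ - 1 = -((A.det - 1) * (A.det)⁻¹) := by field_simp; ring
  rw [e, abs_neg, abs_mul, abs_of_pos (inv_pos.2 hd)]
  have hi : (A.det)⁻¹ ≤ 2 := by
    rw [inv_le_comm₀ hd two_pos]; linarith
  have := mul_le_mul k1 hi (inv_pos.2 hd).le (by positivity)
  linarith

/-! ### Weak convergence of derivatives of Lipschitz functions -/

/-- Against a smooth compactly supported `g`, the derivative is moved onto `g` and dominated
convergence applies. A general integrable `s` is replaced by such a `g`, with an error bounded
uniformly in `n` by the common Lipschitz constant. -/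
theorem tendsto_integral_mul_lineDeriv {h : ℕ → E3 → ℝ} {h₀ : E3 → ℝ} {C : ℝ≥0} {M : ℝ}
    (hC : ∀ n, LipschitzWith C (h n)) (hC₀ : LipschitzWith C h₀) (hM : ∀ n x, |h n x| ≤ M)
    (hlim : ∀ x, Tendsto (fun n => h n x) atTop (𝓝 (h₀ x))) {s : E3 → ℝ} (hs : Integrable s)
    (v : E3) :
    Tendsto (fun n => ∫ x, s x * lineDeriv ℝ (h n) x v) atTop
      (𝓝 (∫ x, s x * lineDeriv ℝ h₀ x v)) := by
  have hb : ∀ {f : E3 → ℝ}, LipschitzWith C f → ∀ x, |lineDeriv ℝ f x v| ≤ C * ‖v‖ :=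
    fun hf x => norm_lineDeriv_le_of_lipschitz ℝ hf
  have hmeas : ∀ {f : E3 → ℝ}, LipschitzWith C f → Measurable fun x => lineDeriv ℝ f x v :=
    fun hf => measurable_lineDeriv hf.continuous
  have hint : ∀ {f : E3 → ℝ} {g : E3 → ℝ}, LipschitzWith C f → Integrable g →
      Integrable fun x => g x * lineDeriv ℝ f x v := fun hf hg =>
    hg.mul_bdd (c := C * ‖v‖) (hmeas hf).aestronglyMeasurable (ae_of_all _ (hb hf))
  have hdiff : ∀ {f : E3 → ℝ} {g : E3 → ℝ}, LipschitzWith C f → Integrable g →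
      |(∫ x, s x * lineDeriv ℝ f x v) - ∫ x, g x * lineDeriv ℝ f x v| ≤
        (C * ‖v‖) * ∫ x, |s x - g x| := by
    intro f g hf hg
    rw [← integral_sub (hint hf hs) (hint hf hg), ← integral_const_mul, ← Real.norm_eq_abs]
    refine norm_integral_le_of_norm_le ((hs.sub hg).norm.const_mul _) (ae_of_all _ fun x => ?_)
    rw [← sub_mul, norm_mul, mul_comm]
    exact mul_le_mul_of_nonneg_right (hb hf x) (norm_nonneg _)
  rw [Metric.tendsto_atTop]
  intro ε hε
  set κ : ℝ := C * ‖v‖ with hκ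
  have hκ0 : 0 ≤ κ := by positivity
  -- The tolerance makes each of the two replacement errors, weighted by `κ`, less than `ε / 4`; the
  -- `+ 1` covers `κ = 0`.
  obtain ⟨g, hg1, hg2, hg3⟩ := (memLp_one_iff_integrable.2 hs).exist_eLpNorm_sub_le
    ENNReal.one_ne_top le_rfl (ε := ε / (4 * (κ + 1))) (by positivity)
  have hgi : Integrable g := hg2.continuous.integrable_of_hasCompactSupport hg1
  have hsg : ∫ x, |s x - g x| ≤ ε / (4 * (κ + 1)) := by
    rw [eLpNorm_one_eq_lintegral_enorm] at hg3
    have := integral_norm_eq_lintegral_enorm (hs.sub hgi).aestronglyMeasurable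
    change ∫ x, ‖(s - g) x‖ ≤ _
    rw [this]
    exact ENNReal.toReal_le_of_le_ofReal (by positivity) hg3
  obtain ⟨D, hD⟩ := (hg2.of_le (by simp : (1 : WithTop ℕ∞) ≤ _)).lipschitzWith_of_hasCompactSupport
    hg1 one_ne_zero
  have hgl : Integrable fun x => lineDeriv ℝ g x (-v) := by
    have hc : Continuous fun x => lineDeriv ℝ g x (-v) := by
      have : (fun x => lineDeriv ℝ g x (-v)) = fun x => fderiv ℝ g x (-v) :=
        funext fun x => (hg2.differentiable (by simp) x).lineDeriv_eq_fderiv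
      rw [this]
      exact (hg2.continuous_fderiv (by simp)).clm_apply continuous_const
    refine hc.integrable_of_hasCompactSupport ?_
    have : (fun x => lineDeriv ℝ g x (-v)) = fun x => fderiv ℝ g x (-v) :=
      funext fun x => (hg2.differentiable (by simp) x).lineDeriv_eq_fderiv
    rw [this]
    exact (hg1.fderiv ℝ).comp_left (g := fun A : E3 →L[ℝ] ℝ => A (-v)) rfl
  have ibp : ∀ {f : E3 → ℝ}, LipschitzWith C f → ∫ x, g x * lineDeriv ℝ f x v =
      ∫ x, lineDeriv ℝ g x (-v) * f x := fun {f} hf => by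
    rw [← hf.integral_lineDeriv_mul_eq hD hg1 v]
    simp only [mul_comm]
  have hl : Tendsto (fun n => ∫ x, g x * lineDeriv ℝ (h n) x v) atTop
      (𝓝 (∫ x, g x * lineDeriv ℝ h₀ x v)) := by
    rw [ibp hC₀]
    simp only [fun n => ibp (hC n)]
    refine tendsto_integral_of_dominated_convergence (fun x => |lineDeriv ℝ g x (-v)| * M)
      (fun n => hgl.aestronglyMeasurable.mul (hC n).continuous.aestronglyMeasurable)
      (hgl.abs.mul_const M) (fun n => ae_of_all _ fun x => ?_) (ae_of_all _ fun x =>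
        (hlim x).const_mul _)
    rw [norm_mul]
    exact mul_le_mul_of_nonneg_left (hM n x) (norm_nonneg _)
  rw [Metric.tendsto_atTop] at hl
  obtain ⟨N, hN⟩ := hl (ε / 2) (by linarith)
  refine ⟨N, fun n hn => ?_⟩
  have k1 := hdiff (hC n) hgi
  have k2 := hdiff hC₀ hgi
  have k3 := hN n hn
  rw [Real.dist_eq] at k3 ⊢
  have k4 : κ * ∫ x, |s x - g x| < ε / 4 := by
    refine (mul_le_mul_of_nonneg_left hsg hκ0).trans_lt ?_
    rw [mul_div_assoc', div_lt_div_iff₀ (by positivity) (by norm_num)]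
    nlinarith
  rw [abs_le] at k1 k2
  rw [abs_lt] at k3 ⊢
  constructor <;> linarith [k1.1, k1.2, k2.1, k2.2, k3.1, k3.2]

end HTS

/-! ### Sequences of transformations close to the identity. -/

namespace HTS

open Data

/-- The radius in `exists_tensor_bounds`. -/
noncomputable def tensorRadius : ℝ := exists_tensor_bounds.choose

/-- The constant in `exists_tensor_bounds`. -/
noncomputable def tensorConst : ℝ := exists_tensor_bounds.choose_spec.choose

theorem tensorRadius_pos : 0 < tensorRadius := exists_tensor_bounds.choose_spec.choose_spec.1

theorem one_le_tensorConst : 1 ≤ tensorConst := exists_tensor_bounds.choose_spec.choose_spec.2.1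

theorem tensor_bounds {A : Tensor} (h : ‖A - 1‖ ≤ tensorRadius) : 1 / 2 ≤ A.det ∧
    |A.det - 1| ≤ tensorConst * ‖A - 1‖ ∧ |(A.det)⁻¹ - 1| ≤ tensorConst * ‖A - 1‖ ∧
    ‖invTransp A - 1‖ ≤ tensorConst * ‖A - 1‖ :=
  exists_tensor_bounds.choose_spec.choose_spec.2.2 A h

/-- A sequence of transformations `T n = id + t n • θ + o(t n)` supported in a compact subset `K`
of `B`, uniformly Lipschitz close to the identity. -/
structure NearIdSeq (B K : Set E3) (C M : ℝ) (θ : Field) (t : ℕ → ℝ) (T : ℕ → E3 → E3) :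
    Prop where
  compact : IsCompact K
  subset : K ⊆ B
  off : ∀ x ∉ K, θ x = 0
  C_nonneg : 0 ≤ C
  M_nonneg : 0 ≤ M
  pos : ∀ n, 0 < t n
  le_one : ∀ n, t n ≤ 1
  lim : Tendsto t atTop (𝓝 0)
  near : ∀ n, IsNearId K C M (t n) (T n)
  -- This bound gives invertibility of `T n`; the next keeps its derivative in the neighbourhood of
  -- the identity where determinant and inverse are controlled.
  small : ∀ n, C * t n ≤ 1 / 2
  small' : ∀ n, C * t n ≤ tensorRadius
  -- The segment from `x` to `T n x` stays in `B`, where the data are continuously differentiable,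
  -- so the mean value inequality can be used.
  ball : ∀ n, ∀ x ∈ K, Metric.closedBall x (M * t n) ⊆ B
  slope : ∀ x, Tendsto (fun n => (t n)⁻¹ • (T n x - x)) atTop (𝓝 (θ x))

namespace NearIdSeq

variable {B K : Set E3} {C M : ℝ} {θ : Field} {t : ℕ → ℝ} {T : ℕ → E3 → E3}

theorem isLipEquiv (h : NearIdSeq B K C M θ t T) (n : ℕ) :
    IsLipEquiv K (T n) (Function.invFun (T n)) :=
  (h.near n).isLipEquiv h.compact (mul_nonneg h.C_nonneg (h.pos n).le) (h.small n)

theorem norm_fderiv_sub_le (h : NearIdSeq B K C M θ t T) (n : ℕ) {x : E3}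
    (hx : DifferentiableAt ℝ (T n) x) : ‖fderiv ℝ (T n) x - 1‖ ≤ C * t n := by
  have hCt : 0 ≤ C * t n := mul_nonneg h.C_nonneg (h.pos n).le
  have h1 : HasFDerivAt (fun y => T n y - y) (fderiv ℝ (T n) x - 1) x :=
    hx.hasFDerivAt.sub (hasFDerivAt_id x)
  rw [← h1.fderiv]
  have : LipschitzWith ⟨C * t n, hCt⟩ fun y => T n y - y :=
    LipschitzWith.of_dist_le_mul fun a b => by
      rw [dist_eq_norm, dist_eq_norm]; exact (h.near n).lip a b
  exact norm_fderiv_le_of_lipschitz ℝ this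

theorem fderiv_eq_one (h : NearIdSeq B K C M θ t T) (n : ℕ) {x : E3} (hx : x ∉ K) :
    fderiv ℝ (T n) x = 1 := by
  have : T n =ᶠ[𝓝 x] id := by
    filter_upwards [h.compact.isClosed.isOpen_compl.mem_nhds hx] with y hy
    exact (h.near n).off y hy
  rw [this.fderiv_eq, fderiv_id]
  rfl

theorem ae_differentiableAt (h : NearIdSeq B K C M θ t T) :
    ∀ᵐ x, ∀ n, DifferentiableAt ℝ (T n) x :=
  ae_all_iff.2 fun n => (h.isLipEquiv n).ae_differentiableAt

theorem norm_le (h : NearIdSeq B K C M θ t T) (x : E3) : ‖θ x‖ ≤ M := by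
  refine le_of_tendsto' (h.slope x).norm fun n => ?_
  rw [norm_smul, norm_inv, Real.norm_of_nonneg (h.pos n).le, inv_mul_le_iff₀ (h.pos n), mul_comm]
  exact (h.near n).disp x

variable {x : E3}

/-- The quotient is its own first order coefficient, so the remainder vanishes identically; the
content is the uniform bound. -/
theorem expands_fderiv (h : NearIdSeq B K C M θ t T) (hx : ∀ n, DifferentiableAt ℝ (T n) x) :
    Expands t (fun n => fderiv ℝ (T n) x) 1 (fun n => (t n)⁻¹ • (fderiv ℝ (T n) x - 1))
      (C + 2) where
  bound n := by
    have h1 := h.norm_fderiv_sub_le n (hx n)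
    have h2 := norm_le_norm_add_norm_sub' (fderiv ℝ (T n) x) 1
    have h3 : ‖(1 : Tensor)‖ ≤ 1 := ContinuousLinearMap.norm_id_le
    linarith [h.small n, h.C_nonneg]
  bound_zero := by
    have h3 : ‖(1 : Tensor)‖ ≤ 1 := ContinuousLinearMap.norm_id_le
    linarith [h.C_nonneg]
  near n := (h.norm_fderiv_sub_le n (hx n)).trans
    (mul_le_mul_of_nonneg_right (by linarith) (h.pos n).le)
  bound_deriv n := by
    rw [norm_smul, norm_inv, Real.norm_of_nonneg (h.pos n).le, inv_mul_le_iff₀ (h.pos n)]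
    have := h.norm_fderiv_sub_le n (hx n)
    nlinarith [h.pos n]
  lim := by simp

/-- Expansion of a function of the derivative. -/
theorem expands_comp_fderiv (h : NearIdSeq B K C M θ t T) {W : Type*} [NormedAddCommGroup W]
    [NormedSpace ℝ W] {Φ : Tensor → W} {Φ' : Tensor →L[ℝ] W} (hΦ : HasFDerivAt Φ Φ' 1)
    (hb : ∀ A : Tensor, ‖A - 1‖ ≤ tensorRadius → ‖Φ A - Φ 1‖ ≤ tensorConst * ‖A - 1‖)
    (hx : ∀ n, DifferentiableAt ℝ (T n) x) :
    Expands t (fun n => Φ (fderiv ℝ (T n) x)) (Φ 1)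
      (fun n => Φ' ((t n)⁻¹ • (fderiv ℝ (T n) x - 1)))
      (‖Φ 1‖ + tensorConst * (C + 1) + ‖Φ'‖ * (C + 2)) := by
  have hD := one_le_tensorConst
  have hC := h.C_nonneg
  have n1 : 0 ≤ ‖Φ'‖ := norm_nonneg Φ'
  have n2 : 0 ≤ ‖Φ 1‖ := norm_nonneg _
  have n3 : 0 ≤ tensorConst * C := by positivity
  have n4 : 0 ≤ ‖Φ'‖ * C := by positivity
  have key : ∀ n, ‖Φ (fderiv ℝ (T n) x) - Φ 1‖ ≤ tensorConst * (C * t n) := fun n => by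
    have h1 := h.norm_fderiv_sub_le n (hx n)
    exact (hb _ (h1.trans (h.small' n))).trans (mul_le_mul_of_nonneg_left h1 (by linarith))
  refine (h.expands_fderiv hx).comp h.pos h.lim hΦ (fun n => ?_) (by nlinarith) (by nlinarith)
    fun n => ?_
  · have h2 := norm_le_norm_add_norm_sub' (Φ (fderiv ℝ (T n) x)) (Φ 1)
    have h3 := mul_le_mul_of_nonneg_left (h.small n) (by linarith : 0 ≤ tensorConst)
    nlinarith [key n]
  · refine (key n).trans ?_
    rw [← mul_assoc]
    exact mul_le_mul_of_nonneg_right (by nlinarith) (h.pos n).le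

/-- The determinant, its inverse, and the inverse transpose of the derivative. -/
theorem exists_expands_fderiv (h : NearIdSeq B K C M θ t T) : ∃ D : ℝ, 0 ≤ D ∧
    ∀ x, (∀ n, DifferentiableAt ℝ (T n) x) →
      Expands t (fun n => fderiv ℝ (T n) x) 1 (fun n => (t n)⁻¹ • (fderiv ℝ (T n) x - 1)) D ∧
      Expands t (fun n => (fderiv ℝ (T n) x).det) 1
        (fun n => trace ((t n)⁻¹ • (fderiv ℝ (T n) x - 1))) D ∧
      Expands t (fun n => ((fderiv ℝ (T n) x).det)⁻¹) 1
        (fun n => -trace ((t n)⁻¹ • (fderiv ℝ (T n) x - 1))) D ∧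
      Expands t (fun n => invTransp (fderiv ℝ (T n) x)) 1
        (fun n => -transp ((t n)⁻¹ • (fderiv ℝ (T n) x - 1))) D := by
  have hC := h.C_nonneg
  have hD := one_le_tensorConst
  have hinv : HasFDerivAt (fun A : Tensor => (A.det)⁻¹) (-traceL) 1 := by
    have h1 : HasDerivAt (fun y : ℝ => y⁻¹) (-((1 : Tensor).det ^ 2)⁻¹) ((1 : Tensor).det) :=
      hasDerivAt_inv (by rw [det_one]; exact one_ne_zero)
    have := h1.comp_hasFDerivAt (1 : Tensor) hasFDerivAt_det_one
    refine this.congr_fderiv ?_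
    rw [det_one]
    simp
  refine ⟨(C + 2) + (1 + tensorConst * (C + 1) + (‖traceL‖ + ‖transpL‖) * (C + 2)) +
    ‖(1 : Tensor)‖, by positivity, fun x hx => ?_⟩
  have ht := fun n => (h.pos n).le
  have n1 : 0 ≤ tensorConst * (C + 1) := by positivity
  have n2 : 0 ≤ ‖traceL‖ * (C + 2) := by positivity
  have n3 : 0 ≤ ‖transpL‖ * (C + 2) := by positivity
  have n4 : 0 ≤ ‖(1 : Tensor)‖ := norm_nonneg _
  have e1 : ‖-traceL‖ = ‖traceL‖ := norm_neg traceL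
  have e2 : ‖-transpL‖ = ‖transpL‖ := norm_neg transpL
  refine ⟨(h.expands_fderiv hx).weaken ht (by nlinarith), ?_, ?_, ?_⟩
  · have := (h.expands_comp_fderiv hasFDerivAt_det_one (fun A hA => by
      rw [det_one]; exact (tensor_bounds hA).2.1) hx).weaken ht
      (α' := (C + 2) + (1 + tensorConst * (C + 1) + (‖traceL‖ + ‖transpL‖) * (C + 2)) +
        ‖(1 : Tensor)‖) (by rw [det_one, norm_one]; nlinarith)
    rw [det_one] at this
    exact this
  · have := (h.expands_comp_fderiv hinv (fun A hA => by
      rw [det_one, inv_one]; exact (tensor_bounds hA).2.2.1) hx).weaken ht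
      (α' := (C + 2) + (1 + tensorConst * (C + 1) + (‖traceL‖ + ‖transpL‖) * (C + 2)) +
        ‖(1 : Tensor)‖) (by rw [det_one, inv_one, norm_one, e1]; nlinarith)
    rw [det_one, inv_one] at this
    exact this
  · have := (h.expands_comp_fderiv hasFDerivAt_invTransp_one (fun A hA => by
      rw [invTransp_one]; exact (tensor_bounds hA).2.2.2) hx).weaken ht
      (α' := (C + 2) + (1 + tensorConst * (C + 1) + (‖traceL‖ + ‖transpL‖) * (C + 2)) +
        ‖(1 : Tensor)‖) (by rw [invTransp_one, e2]; nlinarith)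
    rw [invTransp_one] at this
    exact this

/-- Expansion of a function that is `C¹` on `B` along the transformations. -/
theorem expands_comp (h : NearIdSeq B K C M θ t T) {W : Type*} [NormedAddCommGroup W]
    [NormedSpace ℝ W] (hB : IsOpen B) {g : E3 → W} (hg : ContDiffOn ℝ 1 g B) {k : ℝ} (hk : 0 ≤ k)
    (hgk : ∀ y ∈ B, ‖fderiv ℝ g y‖ ≤ k) (x : E3) :
    Expands t (fun n => g (T n x)) (g x) (fun _ => fderiv ℝ g x (θ x)) (‖g x‖ + k * M) := by
  have hM := h.M_nonneg
  have hkM := mul_nonneg hk hM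
  by_cases hx : x ∈ K
  · have hdiff : ∀ y ∈ B, DifferentiableAt ℝ g y := fun y hy =>
      (hg.differentiableOn one_ne_zero).differentiableAt (hB.mem_nhds hy)
    have hy : Expands t (fun n => T n x - x) 0 (fun _ => θ x) M := by
      refine ⟨fun n => ((h.near n).disp x).trans (mul_le_of_le_one_right hM (h.le_one n)), ?_,
        fun n => ?_, fun _ => h.norm_le x, ?_⟩
      · simpa using hM
      · rw [sub_zero]; exact (h.near n).disp x
      · have := (h.slope x).sub_const (θ x)
        rw [sub_self] at this
        simpa using this
    have hΦ : HasFDerivAt (fun y => g (x + y)) (fderiv ℝ g x) 0 := by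
      have h1 := (hdiff x (h.subset hx)).hasFDerivAt
      have h2 : HasFDerivAt (fun y : E3 => x + y) (ContinuousLinearMap.id ℝ E3) 0 :=
        (hasFDerivAt_id (0 : E3)).const_add x
      rw [← add_zero x] at h1
      have := h1.comp (0 : E3) h2
      rw [ContinuousLinearMap.comp_id, add_zero] at this
      exact this
    have hn : ∀ n, ‖g (x + (T n x - x)) - g (x + 0)‖ ≤ k * (M * t n) := fun n => by
      have hb := h.ball n x hx
      have h1 : T n x ∈ Metric.closedBall x (M * t n) := by
        rw [Metric.mem_closedBall, dist_eq_norm]; exact (h.near n).disp x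
      have h2 : x ∈ Metric.closedBall x (M * t n) :=
        Metric.mem_closedBall_self (mul_nonneg hM (h.pos n).le)
      rw [add_sub_cancel, add_zero]
      refine ((convex_closedBall x (M * t n)).norm_image_sub_le_of_norm_fderiv_le
        (fun y hy => hdiff y (hb hy)) (fun y hy => hgk y (hb hy)) h2 h1).trans ?_
      exact mul_le_mul_of_nonneg_left ((h.near n).disp x) hk
    have n0 := norm_nonneg (g x)
    have := hy.comp h.pos h.lim hΦ (β := ‖g x‖ + k * M) (fun n => ?_) ?_ ?_ fun n => ?_
    · simpa using this
    · have h2 := norm_le_norm_add_norm_sub' (g (x + (T n x - x))) (g (x + 0))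
      have h3 := mul_le_mul_of_nonneg_left (h.le_one n) hkM
      rw [add_zero] at h2
      have h4 := hn n
      rw [add_zero] at h4
      linarith
    · rw [add_zero]; linarith
    · have := mul_le_mul_of_nonneg_right (hgk x (h.subset hx)) hM
      linarith
    · refine (hn n).trans ?_
      rw [← mul_assoc]
      exact mul_le_mul_of_nonneg_right (by linarith) (h.pos n).le
  -- Off `K` the transformation does nothing, so no regularity of the data outside `B` is needed.
  · have h1 : ∀ n, g (T n x) = g x := fun n => by rw [(h.near n).off x hx]
    simp only [h1, h.off x hx, map_zero]
    exact (Expands.const (fun n => (h.pos n).le) (g x)).weaken (fun n => (h.pos n).le)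
      (by linarith)

/-- The difference quotients of the derivatives converge weakly. -/
theorem tendsto_integral_frob (h : NearIdSeq B K C M θ t T) (hB : MeasurableSet B)
    (hθ : ∃ k : ℝ≥0, LipschitzWith k θ) {S : E3 → Tensor} (hS : IntegrableOn S B) :
    Tendsto (fun n => ∫ x in B, frob (S x) ((t n)⁻¹ • (fderiv ℝ (T n) x - 1))) atTop
      (𝓝 (∫ x in B, frob (S x) (fderiv ℝ θ x))) := by
  obtain ⟨k, hk⟩ := hθ
  set c : ℝ≥0 := max k ⟨C, h.C_nonneg⟩ with hc
  have hcoord : ∀ (u : E3) (i : Fin 3), |u i| ≤ ‖u‖ := fun u i => PiLp.norm_apply_le u i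
  let hn : Fin 3 → ℕ → E3 → ℝ := fun i n x => ((t n)⁻¹ • (T n x - x)) i
  have hsub : ∀ (i : Fin 3) n a b, |hn i n a - hn i n b| ≤ C * ‖a - b‖ := fun i n a b => by
    have e1 : hn i n a - hn i n b = ((t n)⁻¹ • ((T n a - a) - (T n b - b))) i := by
      simp only [hn, PiLp.smul_apply, PiLp.sub_apply, smul_eq_mul]; ring
    rw [e1]
    refine (hcoord _ i).trans ?_
    rw [norm_smul, norm_inv, Real.norm_of_nonneg (h.pos n).le, inv_mul_le_iff₀ (h.pos n)]
    exact ((h.near n).lip a b).trans (le_of_eq (by ring))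
  have hLip : ∀ i n, LipschitzWith c (hn i n) := fun i n =>
    LipschitzWith.of_dist_le_mul fun a b => by
      rw [Real.dist_eq, dist_eq_norm]
      refine (hsub i n a b).trans (mul_le_mul_of_nonneg_right ?_ (norm_nonneg _))
      exact NNReal.coe_le_coe.2 (le_max_right k ⟨C, h.C_nonneg⟩)
  have hLip₀ : ∀ i : Fin 3, LipschitzWith c fun x => θ x i := fun i =>
    LipschitzWith.of_dist_le_mul fun a b => by
      rw [Real.dist_eq, dist_eq_norm]
      have h1 := hk.dist_le_mul a b
      rw [dist_eq_norm, dist_eq_norm] at h1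
      refine (hcoord (θ a - θ b) i).trans (h1.trans
        (mul_le_mul_of_nonneg_right ?_ (norm_nonneg _)))
      exact NNReal.coe_le_coe.2 (le_max_left k ⟨C, h.C_nonneg⟩)
  have hbd : ∀ i n x, |hn i n x| ≤ M := fun i n x => by
    refine (hcoord _ i).trans ?_
    rw [norm_smul, norm_inv, Real.norm_of_nonneg (h.pos n).le, inv_mul_le_iff₀ (h.pos n)]
    exact ((h.near n).disp x).trans (le_of_eq (by ring))
  have hl : ∀ i x, Tendsto (fun n => hn i n x) atTop (𝓝 (θ x i)) := fun i x =>
    ((EuclideanSpace.proj i : E3 →L[ℝ] ℝ).continuous.tendsto (θ x)).comp (h.slope x)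
  have hs : ∀ i j : Fin 3, IntegrableOn (fun x => S x (e j) i) B := fun i j =>
    (((EuclideanSpace.proj i : E3 →L[ℝ] ℝ).comp
      (ContinuousLinearMap.apply ℝ E3 (e j))).integrable_comp hS)
  have key : ∀ i j : Fin 3, Tendsto
      (fun n => ∫ x in B, S x (e j) i * lineDeriv ℝ (hn i n) x (e j)) atTop
      (𝓝 (∫ x in B, S x (e j) i * lineDeriv ℝ (fun x => θ x i) x (e j))) := fun i j => by
    -- Weak convergence is shown entry by entry; the indicator extends the density by zero to the
    -- whole space, where the integration by parts takes place.
    have := tendsto_integral_mul_lineDeriv (hLip i) (hLip₀ i) (hbd i) (hl i)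
      ((integrable_indicator_iff hB).2 (hs i j)) (e j)
    have e1 : ∀ f : E3 → ℝ, ∫ x, B.indicator (fun x => S x (e j) i) x * lineDeriv ℝ f x (e j) =
        ∫ x in B, S x (e j) i * lineDeriv ℝ f x (e j) := fun f => by
      rw [← integral_indicator hB]
      refine integral_congr_ae (ae_of_all _ fun x => ?_)
      exact (Set.indicator_mul_left B (fun x => S x (e j) i)
        fun x => lineDeriv ℝ f x (e j)).symm
    simpa only [e1] using this
  have hint : ∀ (i j : Fin 3) {f : E3 → ℝ}, LipschitzWith c f →
      IntegrableOn (fun x => S x (e j) i * lineDeriv ℝ f x (e j)) B := fun i j f hf =>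
    (hs i j).mul_bdd (c := c * ‖e j‖) (measurable_lineDeriv hf.continuous).aestronglyMeasurable
      (ae_of_all _ fun x => norm_lineDeriv_le_of_lipschitz ℝ hf)
  have hsum : ∀ {g : Fin 3 → E3 → ℝ} {A : E3 → Tensor}, (∀ i, LipschitzWith c (g i)) →
      (∀ᵐ x, ∀ i j, lineDeriv ℝ (g i) x (e j) = A x (e j) i) →
      ∫ x in B, frob (S x) (A x) =
        ∑ j, ∑ i, ∫ x in B, S x (e j) i * lineDeriv ℝ (g i) x (e j) := fun {g A} hg hA => by
    have e1 : ∀ j, ∑ i, ∫ x in B, S x (e j) i * lineDeriv ℝ (g i) x (e j) =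
        ∫ x in B, ∑ i, S x (e j) i * lineDeriv ℝ (g i) x (e j) := fun j =>
      (integral_finsetSum _ fun i _ => hint i j (hg i)).symm
    simp only [e1]
    rw [← integral_finsetSum _ fun j _ => integrable_finsetSum _ fun i _ => hint i j (hg i)]
    refine integral_congr_ae (ae_restrict_of_ae (hA.mono fun x hx => ?_))
    simp only [frob, inner_eq_sum, Fin.sum_univ_three, hx]
  have e1 : ∀ n, ∫ x in B, frob (S x) ((t n)⁻¹ • (fderiv ℝ (T n) x - 1)) =
      ∑ j, ∑ i, ∫ x in B, S x (e j) i * lineDeriv ℝ (hn i n) x (e j) := fun n => by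
    refine hsum (hLip · n) ((h.isLipEquiv n).ae_differentiableAt.mono fun x hx i j => ?_)
    have h1 : HasFDerivAt (hn i n) ((EuclideanSpace.proj i : E3 →L[ℝ] ℝ).comp
        ((t n)⁻¹ • (fderiv ℝ (T n) x - 1))) x :=
      (EuclideanSpace.proj i : E3 →L[ℝ] ℝ).hasFDerivAt.comp x
        ((hx.hasFDerivAt.sub (hasFDerivAt_id x)).const_smul (t n)⁻¹)
    rw [h1.hasLineDerivAt (e j) |>.lineDeriv]
    rfl
  have e2 : ∫ x in B, frob (S x) (fderiv ℝ θ x) =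
      ∑ j, ∑ i, ∫ x in B, S x (e j) i * lineDeriv ℝ (fun x => θ x i) x (e j) := by
    refine hsum hLip₀ (hk.ae_differentiableAt.mono fun x hx i j => ?_)
    have h1 : HasFDerivAt (fun x => θ x i) ((EuclideanSpace.proj i : E3 →L[ℝ] ℝ).comp
        (fderiv ℝ θ x)) x :=
      (EuclideanSpace.proj i : E3 →L[ℝ] ℝ).hasFDerivAt.comp x hx.hasFDerivAt
    rw [h1.hasLineDerivAt (e j) |>.lineDeriv]
    rfl
  simp only [e1, e2]
  exact tendsto_finsetSum _ fun j _ => tendsto_finsetSum _ fun i _ => key i j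

end NearIdSeq

end HTS

/-! ### Transport of the Lagrangian to a fixed domain. -/

namespace HTS

open Data

theorem Expands.tensor_mul {t : ℕ → ℝ} {a b : ℕ → Tensor} {a₀ b₀ : Tensor} {p q : ℕ → Tensor}
    {α β : ℝ} (h : Expands t a a₀ p α) (h' : Expands t b b₀ q β) (ht : ∀ n, 0 < t n)
    (h0 : Tendsto t atTop (𝓝 0)) :
    Expands t (fun n => a n * b n) (a₀ * b₀) (fun n => p n * b₀ + a₀ * q n) (2 * (α * β)) :=
  h.bilin h' ht h0 (ContinuousLinearMap.compL ℝ E3 E3 E3) fun v w => v.opNorm_comp_le w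

theorem Expands.transp {t : ℕ → ℝ} {a : ℕ → Tensor} {a₀ : Tensor} {p : ℕ → Tensor} {α : ℝ}
    (h : Expands t a a₀ p α) :
    Expands t (fun n => transp (a n)) (transp a₀) (fun n => transp (p n)) α where
  bound n := by rw [norm_transp]; exact h.bound n
  bound_zero := by rw [norm_transp]; exact h.bound_zero
  near n := by
    rw [← transpL_apply, ← transpL_apply, ← map_sub, transpL_apply, norm_transp]; exact h.near n
  bound_deriv n := by rw [norm_transp]; exact h.bound_deriv n
  lim := by
    have := (transpL.continuous.tendsto 0).comp h.lim
    rw [map_zero] at this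
    refine this.congr fun n => ?_
    simp only [Function.comp_apply, map_sub, map_smul, transpL_apply]

theorem transp_neg (A : Tensor) : transp (-A) = -transp A := by
  simp only [← transpL_apply, map_neg]

theorem transp_transp (A : Tensor) : transp (transp A) = A := ContinuousLinearMap.adjoint_adjoint A

theorem tensor_mul_apply (A B : Tensor) (x : E3) : (A * B) x = A (B x) := rfl

theorem tensor_one_apply (x : E3) : (1 : Tensor) x = x := rfl

theorem tensor_mul_smul (c : ℝ) (A B : Tensor) : A * (c • B) = c • (A * B) := by
  ext1 x
  change A (c • B x) = c • A (B x)
  rw [map_smul]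

/-- The adjugate is continuous everywhere, so this formula gives the measurability of the inverse of
the derivative of a Lipschitz map. -/
theorem inverse_eq_inv_det_smul_adj {A : Tensor} (hA : A.det ≠ 0) :
    ContinuousLinearMap.inverse A = (A.det)⁻¹ • adj A := by
  have h1 : A * ((A.det)⁻¹ • adj A) = 1 := by
    rw [tensor_mul_smul, mul_adj, smul_smul, inv_mul_cancel₀ hA, one_smul]
  have h2 : ((A.det)⁻¹ • adj A) * A = 1 := by
    have h3 : toMat A * toMat ((A.det)⁻¹ • adj A) = 1 := by rw [← map_mul, h1, map_one]
    have h4 := mul_eq_one_comm.1 h3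
    apply toMat.injective
    change toMat _ = toMat _
    rw [map_mul, h4, map_one]
  exact inverse_eq_of_mul_eq_one h2 h1

theorem invTransp_mul_transp {A W : Tensor} (h1 : W * A = 1) (h2 : A * W = 1) :
    invTransp A = transp W := by
  rw [invTransp, inverse_eq_of_mul_eq_one h1 h2]

namespace Data

variable (d : Data) (γ : ℝ)

/-- The weight transported by `T`. -/
noncomputable def weightT (T : E3 → E3) (x : E3) : ℝ := (fderiv ℝ T x).det * d.κ (T x)

/-- The reluctivity transported by `T`. -/
noncomputable def reluctivityT (T : E3 → E3) (x : E3) : Tensor :=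
  ((fderiv ℝ T x).det)⁻¹ • (transp (fderiv ℝ T x) * (d.ν (T x) * fderiv ℝ T x))

/-- The permittivity transported by `T`. -/
noncomputable def permittivityT (T : E3 → E3) (x : E3) : Tensor :=
  (fderiv ℝ T x).det •
    (transp (invTransp (fderiv ℝ T x)) * (d.ε (T x) * invTransp (fderiv ℝ T x)))

/-- The nonlinearity transported by `T`. -/
noncomputable def LamT (T : E3 → E3) (x a : E3) : E3 :=
  (fderiv ℝ T x).det • transp (invTransp (fderiv ℝ T x))
    (Lam d.jc γ (invTransp (fderiv ℝ T x) a))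

/-- The source transported by `T`. -/
noncomputable def sourceT (T : E3 → E3) (x : E3) : E3 :=
  (fderiv ℝ T x).det • transp (invTransp (fderiv ℝ T x)) (d.f (T x))

/-- The misfit of the transported field. -/
noncomputable def misfitT (T : E3 → E3) (u : Field) (x : E3) : E3 :=
  invTransp (fderiv ℝ T x) (u x) - d.Ed (T x)

/-- The Lagrangian on the transported domain, written on the fixed domain. The fields `c` and `w`
stand for the curls of `u` and `v`. -/
noncomputable def lagrangianT (ω : Set E3) (T : E3 → E3) (u c v w : Field) : ℝ :=
  1 / 2 * (∫ x in d.B, d.weightT T x * ‖d.misfitT T u x‖ ^ 2) + (∫ x in ω, (fderiv ℝ T x).det) +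
    ((∫ x in d.Ω, ⟪d.reluctivityT T x (c x), w x⟫_ℝ) +
      ∫ x in d.Ω, ⟪d.permittivityT T x (u x), v x⟫_ℝ) +
    (∫ x in ω, ⟪d.LamT γ T x (u x), v x⟫_ℝ) - ∫ x in d.Ω, ⟪d.sourceT T x, v x⟫_ℝ

end Data

/-! ### Transported pairs -/

/-- The pair `(U, W)` of a field and its curl is the covariant transport by `T` of `(u, c)`. -/
structure IsTransport (Ω : Set E3) (T : E3 → E3) (u c U W : Field) : Prop where
  h0 : H0Pair Ω u c
  h0' : H0Pair Ω U W
  field : ∀ᵐ x ∂(volume.restrict Ω), U (T x) = invTransp (fderiv ℝ T x) (u x)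
  curl : ∀ᵐ x ∂(volume.restrict Ω), W (T x) = ((fderiv ℝ T x).det)⁻¹ • fderiv ℝ T x (c x)

namespace IsLipEquiv

variable {K Ω : Set E3} {T S : E3 → E3} {u c U W : Field}

theorem det_ne_zero {A W : Tensor} (h : A * W = 1) : A.det ≠ 0 := by
  have h1 : (toMat A).det * (toMat W).det = 1 := by
    rw [← Matrix.det_mul, ← map_mul, h, map_one, Matrix.det_one]
  rw [det_eq]
  exact left_ne_zero_of_mul_eq_one h1

/-- The covariant transform by `T` is the pullback by the inverse `S`, so it preserves H₀(curl). For
the curl, `adj DS = det DS • DT = (det DT)⁻¹ • DT` at corresponding points. -/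
theorem isTransport_covariant (h : IsLipEquiv K T S) (hK : K ⊆ Ω) (hΩ : IsOpen Ω)
    (hb : Bornology.IsBounded Ω) (hu : H0Pair Ω u c) :
    IsTransport Ω T u c (covariant T u) (pullbackCurl S c) where
  h0 := hu
  h0' := by
    refine (h.symm.h0Pair_pullback hK hΩ hb hu).congr ?_ EventuallyEq.rfl
    refine ae_restrict_of_ae (h.symm.ae_fderiv_mul_fderiv.mono fun y hy => ?_)
    rw [pullback, covariant, h.invFun_eq, inverse_eq_of_mul_eq_one hy.2 hy.1]
  field := ae_of_all _ fun x => by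
    rw [covariant, h.invFun_eq, h.left, invTransp]
  curl := by
    refine ae_restrict_of_ae (h.ae_fderiv_mul_fderiv.mono fun x hx => ?_)
    rw [pullbackCurl, h.left, adj_eq_of_mul_eq_one hx.2]
    have h1 : (toMat (fderiv ℝ S (T x))).det * (toMat (fderiv ℝ T x)).det = 1 := by
      rw [← Matrix.det_mul, ← map_mul, hx.1, map_one, Matrix.det_one]
    rw [← det_eq, ← det_eq] at h1
    rw [eq_inv_of_mul_eq_one_left h1]
    rfl

/-- The converse direction: a pair on the moved configuration, in particular a state there, is the
transport of its own pullback. -/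
theorem isTransport_pullback (h : IsLipEquiv K T S) (hK : K ⊆ Ω) (hΩ : IsOpen Ω)
    (hb : Bornology.IsBounded Ω) (hu : H0Pair Ω U W) :
    IsTransport Ω T (pullback T U) (pullbackCurl T W) U W where
  h0 := h.h0Pair_pullback hK hΩ hb hu
  h0' := hu
  field := by
    refine ae_restrict_of_ae (h.ae_fderiv_mul_fderiv.mono fun x hx => ?_)
    rw [pullback, invTransp_mul_transp hx.1 hx.2]
    have : transp (fderiv ℝ S (T x)) * transp (fderiv ℝ T x) = 1 := by
      rw [← transp_mul, hx.2, transp_one]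
    exact (congrArg (fun A : Tensor => A (U (T x))) this).symm
  curl := by
    refine ae_restrict_of_ae (h.ae_fderiv_mul_fderiv.mono fun x hx => ?_)
    have h1 := mul_adj (fderiv ℝ T x)
    have h2 := congrArg (fun A : Tensor => A (W (T x))) h1
    change fderiv ℝ T x (adj (fderiv ℝ T x) (W (T x))) = (fderiv ℝ T x).det • W (T x) at h2
    rw [pullbackCurl, h2, smul_smul, inv_mul_cancel₀ (det_ne_zero hx.2), one_smul]

/-- Change of variables on a set fixed by the transformation. -/
theorem setIntegral_comp (h : IsLipEquiv K T S) (hdet : ∀ᵐ x, 0 < (fderiv ℝ T x).det)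
    {s : Set E3} (hs : MeasurableSet s) (g : E3 → ℝ) :
    ∫ x in T '' s, g x = ∫ x in s, (fderiv ℝ T x).det * g (T x) := by
  rw [h.setIntegral_image hs]
  refine integral_congr_ae (ae_restrict_of_ae (hdet.mono fun x hx => ?_))
  simp only [abs_of_pos hx]

theorem measurableSet_image (h : IsLipEquiv K T S) {s : Set E3} (hs : MeasurableSet s) :
    MeasurableSet (T '' s) := by
  rw [h.image_eq_preimage]
  exact h.symm.continuous.measurable hs

end IsLipEquiv

namespace IsTransport

variable {d : Data} {γ : ℝ} {K ω : Set E3} {T S : E3 → E3} {u c U W v w V Z : Field}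

/-- Each curl carries a factor `(det DT)⁻¹`; the volume element cancels one of the two, which leaves
the single inverse determinant in `reluctivityT`. No such factor is present in the zero order terms.
-/
theorem integral_reluctivity (hu : IsTransport d.Ω T u c U W) (hv : IsTransport d.Ω T v w V Z)
    (hd : d.Admissible) (h : IsLipEquiv K T S) (hK : K ⊆ d.B)
    (hdet : ∀ᵐ x, 0 < (fderiv ℝ T x).det) :
    ∫ x in d.Ω, ⟪d.ν x (W x), Z x⟫_ℝ = ∫ x in d.Ω, ⟪d.reluctivityT T x (c x), w x⟫_ℝ := by
  have e := h.setIntegral_comp hdet hd.isOpen_Ω.measurableSet fun x => ⟪d.ν x (W x), Z x⟫_ℝ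
  rw [h.image_eq (hK.trans hd.subset)] at e
  rw [e]
  refine integral_congr_ae ?_
  filter_upwards [hu.curl, hv.curl, ae_restrict_of_ae hdet] with x h1 h2 h3
  rw [h1, h2, reluctivityT]
  simp only [_root_.smul_apply, tensor_mul_apply, map_smul,
    real_inner_smul_left, real_inner_smul_right, inner_transp_left]
  field_simp

theorem integral_permittivity (hu : IsTransport d.Ω T u c U W) (hv : IsTransport d.Ω T v w V Z)
    (hd : d.Admissible) (h : IsLipEquiv K T S) (hK : K ⊆ d.B)
    (hdet : ∀ᵐ x, 0 < (fderiv ℝ T x).det) :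
    ∫ x in d.Ω, ⟪d.ε x (U x), V x⟫_ℝ = ∫ x in d.Ω, ⟪d.permittivityT T x (u x), v x⟫_ℝ := by
  have e := h.setIntegral_comp hdet hd.isOpen_Ω.measurableSet fun x => ⟪d.ε x (U x), V x⟫_ℝ
  rw [h.image_eq (hK.trans hd.subset)] at e
  rw [e]
  refine integral_congr_ae ?_
  filter_upwards [hu.field, hv.field] with x h1 h2
  rw [h1, h2, permittivityT]
  simp only [_root_.smul_apply, tensor_mul_apply,
    real_inner_smul_left, inner_transp_left]

theorem integral_Lam (hu : IsTransport d.Ω T u c U W) (hv : IsTransport d.Ω T v w V Z)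
    (h : IsLipEquiv K T S) (hdet : ∀ᵐ x, 0 < (fderiv ℝ T x).det)
    (hω : MeasurableSet ω) (hs : ω ⊆ d.Ω) :
    ∫ x in T '' ω, ⟪Lam d.jc γ (U x), V x⟫_ℝ = ∫ x in ω, ⟪d.LamT γ T x (u x), v x⟫_ℝ := by
  rw [h.setIntegral_comp hdet hω fun x => ⟪Lam d.jc γ (U x), V x⟫_ℝ]
  refine integral_congr_ae ?_
  filter_upwards [ae_restrict_of_ae_restrict_of_subset hs hu.field,
    ae_restrict_of_ae_restrict_of_subset hs hv.field] with x h1 h2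
  rw [h1, h2, LamT, real_inner_smul_left, inner_transp_left]

theorem integral_source (hv : IsTransport d.Ω T v w V Z)
    (hd : d.Admissible) (h : IsLipEquiv K T S) (hK : K ⊆ d.B)
    (hdet : ∀ᵐ x, 0 < (fderiv ℝ T x).det) :
    ∫ x in d.Ω, ⟪d.f x, V x⟫_ℝ = ∫ x in d.Ω, ⟪d.sourceT T x, v x⟫_ℝ := by
  have e := h.setIntegral_comp hdet hd.isOpen_Ω.measurableSet fun x => ⟪d.f x, V x⟫_ℝ
  rw [h.image_eq (hK.trans hd.subset)] at e
  rw [e]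
  refine integral_congr_ae ?_
  filter_upwards [hv.field] with x h2
  rw [h2, sourceT, real_inner_smul_left, inner_transp_left]

theorem tracking_eq (hu : IsTransport d.Ω T u c U W)
    (hd : d.Admissible) (h : IsLipEquiv K T S) (hK : K ⊆ d.B)
    (hdet : ∀ᵐ x, 0 < (fderiv ℝ T x).det) :
    d.tracking U = 1 / 2 * ∫ x in d.B, d.weightT T x * ‖d.misfitT T u x‖ ^ 2 := by
  have e := h.setIntegral_comp hdet hd.isOpen_B.measurableSet
    fun x => d.κ x * ‖U x - d.Ed x‖ ^ 2
  rw [h.image_eq hK] at e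
  rw [tracking, e]
  congr 1
  refine integral_congr_ae ?_
  filter_upwards [ae_restrict_of_ae_restrict_of_subset hd.subset hu.field] with x h1
  rw [h1, weightT, misfitT, mul_assoc]

/-- The Lagrangian of transported fields on the transported domain. -/
theorem lagrangian_image (hu : IsTransport d.Ω T u c U W) (hv : IsTransport d.Ω T v w V Z)
    (hd : d.Admissible) (h : IsLipEquiv K T S) (hK : K ⊆ d.B)
    (hdet : ∀ᵐ x, 0 < (fderiv ℝ T x).det) (hω : MeasurableSet ω) (hs : ω ⊆ d.Ω) :
    d.lagrangian γ (T '' ω) U V = d.lagrangianT γ ω T u c v w := by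
  have hvol : volume.real (T '' ω) = ∫ x in ω, (fderiv ℝ T x).det := by
    have := h.setIntegral_comp hdet hω fun _ => 1
    simpa using this
  rw [lagrangian, lagrangianT, hd.a_eq hu.h0' hv.h0', hu.integral_reluctivity hv hd h hK hdet,
    hu.integral_permittivity hv hd h hK hdet, hu.integral_Lam hv h hdet hω hs,
    hv.integral_source hd h hK hdet, hu.tracking_eq hd h hK hdet, hvol]

end IsTransport

/-! ### Expansions of the transported coefficients -/

namespace NearIdSeq

variable {d : Data} {γ : ℝ} {K : Set E3} {C M : ℝ} {θ : Field} {t : ℕ → ℝ} {T : ℕ → E3 → E3}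
  {B : Set E3}

theorem ae_det_pos (h : NearIdSeq B K C M θ t T) (n : ℕ) : ∀ᵐ x, 0 < (fderiv ℝ (T n) x).det :=
  h.ae_differentiableAt.mono fun x hx => by
    have := (tensor_bounds ((h.norm_fderiv_sub_le n (hx n)).trans (h.small' n))).1
    linarith

/-- The difference quotient of the derivative of the transformation. -/
noncomputable def quot (t : ℕ → ℝ) (T : ℕ → E3 → E3) (n : ℕ) (x : E3) : Tensor :=
  (t n)⁻¹ • (fderiv ℝ (T n) x - 1)

theorem quot_eq_zero (h : NearIdSeq B K C M θ t T) (n : ℕ) {x : E3} (hx : x ∉ K) :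
    quot t T n x = 0 := by
  rw [quot, h.fderiv_eq_one n hx, sub_self, smul_zero]

/-- The transported coefficients have first order expansions, with uniform constants. -/
theorem exists_expands_coeff (h : NearIdSeq d.B K C M θ t T) (hd : d.Admissible) (hγ : 0 < γ) :
    ∃ D : ℝ, 0 ≤ D ∧ ∀ᵐ x ∂(volume.restrict d.Ω),
      Expands t (fun n => (fderiv ℝ (T n) x).det) 1 (fun n => trace (quot t T n x)) D ∧
      Expands t (fun n => invTransp (fderiv ℝ (T n) x)) 1 (fun n => -transp (quot t T n x)) D ∧
      Expands t (fun n => d.reluctivityT (T n) x) (d.ν x) (fun n =>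
        -trace (quot t T n x) • d.ν x + (transp (quot t T n x) * d.ν x +
          (fderiv ℝ d.ν x (θ x) + d.ν x * quot t T n x))) D ∧
      Expands t (fun n => d.permittivityT (T n) x) (d.ε x) (fun n =>
        trace (quot t T n x) • d.ε x + (-quot t T n x * d.ε x +
          (fderiv ℝ d.ε x (θ x) + d.ε x * -transp (quot t T n x)))) D ∧
      (∀ a : E3, Expands t (fun n => d.LamT γ (T n) x a) (Lam d.jc γ a) (fun n =>
        trace (quot t T n x) • Lam d.jc γ a + (-quot t T n x (Lam d.jc γ a) +
          psi d.jc γ a (-transp (quot t T n x) a))) (D * ‖a‖)) ∧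
      Expands t (fun n => d.sourceT (T n) x) (d.f x) (fun n =>
        trace (quot t T n x) • d.f x + (-quot t T n x (d.f x) + fderiv ℝ d.f x (θ x)))
          (D * (‖d.f x‖ + 1)) ∧
      (x ∈ d.B → Expands t (fun n => d.weightT (T n) x) (d.κ x) (fun n =>
        trace (quot t T n x) * d.κ x + fderiv ℝ d.κ x (θ x)) D ∧
        Expands t (fun n => d.Ed (T n x)) (d.Ed x) (fun _ => fderiv ℝ d.Ed x (θ x)) D) := by
  obtain ⟨D, hD, hF⟩ := h.exists_expands_fderiv
  obtain ⟨k, hk, hB⟩ := hd.exists_bounds_B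
  obtain ⟨cε, hcε, hε⟩ := ae_norm_le_of_memLp_top hd.permittivity.1
  obtain ⟨cν, hcν, hν⟩ := ae_norm_le_of_memLp_top hd.reluctivity.1
  have hM := h.M_nonneg
  have hkM : 0 ≤ k * M := mul_nonneg hk hM
  have hj := hd.jc_pos
  have ht := h.pos
  have h0 := h.lim
  have ht' := fun n => (ht n).le
  set c := cε + cν + k + k * M with hc
  have hc0 : 0 ≤ c := by positivity
  have hjγ : 0 ≤ d.jc * γ := by positivity
  -- The sum of the constants that the nested product rules produce for the different coefficients,
  -- so that every expansion can be weakened to this one.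
  set D' := D + 2 * (D * (2 * (D * (2 * (c * D))))) + 2 * (D * c) + c +
    2 * (D * (2 * (D * (2 * (d.jc * γ) * (2 * D) )))) + 2 * (D * (2 * (D * (1 + k * M)))) with hD'
  have p1 : 0 ≤ 2 * (D * (2 * (D * (2 * (c * D))))) := by positivity
  have p2 : 0 ≤ 2 * (D * c) := by positivity
  have p3 : 0 ≤ 2 * (D * (2 * (D * (2 * (d.jc * γ) * (2 * D) )))) := by positivity
  have p4 : 0 ≤ 2 * (D * (2 * (D * (1 + k * M)))) := by positivity
  refine ⟨D', by positivity, ?_⟩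
  filter_upwards [hε, hν, ae_restrict_of_ae h.ae_differentiableAt] with x hεx hνx hdx
  obtain ⟨eF, ed, ei, eA⟩ := hF x hdx
  have eAt : Expands t (fun n => transp (invTransp (fderiv ℝ (T n) x))) 1
      (fun n => -quot t T n x) D := by
    have := eA.transp
    simp only [transp_neg, transp_transp, transp_one] at this
    exact this
  have eFt := eF.transp
  rw [transp_one] at eFt
  have eν := (h.expands_comp hd.isOpen_B hd.reluctivity.2.1.1 hk
    (fun y hy => (hB y hy).2.2.2.2.2.2.2.2) x).weaken ht' (α' := c) (by linarith)
  have eε := (h.expands_comp hd.isOpen_B hd.permittivity.2.1.1 hk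
    (fun y hy => (hB y hy).2.2.2.2.2.2.1) x).weaken ht' (α' := c) (by linarith)
  have ef := h.expands_comp hd.isOpen_B hd.source.2.1 hk
    (fun y hy => (hB y hy).2.2.2.2.1) x
  refine ⟨ed.weaken ht' (by linarith), eA.weaken ht' (by linarith), ?_, ?_, fun a => ?_, ?_,
    fun hx => ⟨?_, ?_⟩⟩
  · have := (ei.smul (eFt.tensor_mul (eν.tensor_mul eF ht h0) ht h0) ht h0).weaken ht'
      (α' := D') (by linarith)
    simpa only [reluctivityT, one_mul, mul_one, one_smul, quot] using this
  · have := (ed.smul (eAt.tensor_mul (eε.tensor_mul eA ht h0) ht h0) ht h0).weaken ht'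
      (α' := D') (by linarith)
    simpa only [permittivityT, one_mul, mul_one, one_smul, quot] using this
  · have ea : Expands t (fun n => invTransp (fderiv ℝ (T n) x) a) a
        (fun n => -transp (quot t T n x) a) (2 * (D * ‖a‖)) := by
      have := eA.apply (Expands.const ht' a) ht h0
      simpa only [map_zero, add_zero, quot, _root_.neg_apply, tensor_one_apply] using this
    have n0 := norm_nonneg a
    have hpsi : ‖psi d.jc γ a‖ ≤ 2 * (d.jc * γ) :=
      ContinuousLinearMap.opNorm_le_bound _ (by positivity) fun z => norm_psi_apply_le hj hγ a z
    -- The Lipschitz constant of `Lam` times the bound `2 * (D * ‖a‖)` of the argument. Homogeneity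
    -- in `‖a‖` is what later yields L² bounds.
    have eL := ea.comp ht h0 (hasFDerivAt_Lam hγ a) (β := 2 * (d.jc * γ) * (2 * D) * ‖a‖)
      (fun n => (norm_Lam_le hj hγ _).trans ?_) ((norm_Lam_le hj hγ a).trans ?_) ?_ fun n => ?_
    · have := (ed.smul (eAt.apply eL ht h0) ht h0).weaken ht' (α' := D' * ‖a‖) (by
        have : 0 ≤ (D' - 2 * (D * (2 * (D * (2 * (d.jc * γ) * (2 * D)))))) * ‖a‖ :=
          mul_nonneg (by rw [hD']; linarith) n0
        linarith)
      simpa only [LamT, one_smul, tensor_one_apply, _root_.neg_apply, quot] using this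
    · have := ea.bound n
      nlinarith
    · have := ea.bound_zero
      nlinarith
    · have := mul_le_mul_of_nonneg_right hpsi (by positivity : 0 ≤ 2 * (D * ‖a‖))
      linarith
    · refine (norm_Lam_sub_le hj hγ _ _).trans ?_
      have := mul_le_mul_of_nonneg_left (ea.near n) hjγ
      have h5 : 0 ≤ d.jc * γ * (2 * (D * ‖a‖) * t n) := by have := ht' n; positivity
      linarith
  · have n0 := norm_nonneg (d.f x)
    have := (ed.smul (eAt.apply ef ht h0) ht h0).weaken ht' (α' := D' * (‖d.f x‖ + 1)) (by
        have : 0 ≤ (D' - 2 * (D * (2 * (D * (1 + k * M))))) * (‖d.f x‖ + 1) :=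
          mul_nonneg (by rw [hD']; linarith) (by linarith)
        have h6 : 0 ≤ D * D * (k * M) * ‖d.f x‖ := by positivity
        have h7 : 0 ≤ D * D := by positivity
        linarith)
    simpa only [sourceT, one_smul, tensor_one_apply, _root_.neg_apply, quot] using this
  · have eκ := (h.expands_comp hd.isOpen_B hd.weight.1 hk
      (fun y hy => (hB y hy).2.1) x).weaken ht' (α' := c) (by
        have := (hB x hx).1; rw [← Real.norm_eq_abs] at this; linarith)
    have := (ed.mul eκ ht h0).weaken ht' (α' := D') (by linarith)
    simpa only [weightT, one_mul, quot] using this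
  · exact (h.expands_comp hd.isOpen_B hd.target.1 hk
      (fun y hy => (hB y hy).2.2.2.1) x).weaken ht' (by have := (hB x hx).2.2.1; linarith)

end NearIdSeq

end HTS

namespace HTS

open Data

/-! ### Integrability of the shape gradient densities -/

theorem outer_smul_right (c : ℝ) (x y : E3) : outer x (c • y) = c • outer x y := by
  ext1 z
  simp [outer, InnerProductSpace.rankOne_apply, smul_smul]

theorem norm_outer (x y : E3) : ‖outer x y‖ = ‖x‖ * ‖y‖ := by
  rw [outer, InnerProductSpace.norm_rankOne]

theorem continuous_outer : Continuous fun p : E3 × E3 => outer p.1 p.2 := by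
  exact (InnerProductSpace.rankOne ℝ (E := E3) (F := E3)).continuous₂

theorem integrable_outer {μ : Measure E3} {u v : Field} (hu : MemLp u 2 μ) (hv : MemLp v 2 μ) :
    Integrable (fun x => outer (u x) (v x)) μ := by
  have hm : AEStronglyMeasurable (fun x => outer (u x) (v x)) μ :=
    Continuous.comp_aestronglyMeasurable (g := fun p : E3 × E3 => outer p.1 p.2)
      (f := fun x => (u x, v x)) continuous_outer (AEStronglyMeasurable.prodMk hu.1 hv.1)
  exact (integrable_norm_mul_norm hu hv).mono' hm (ae_of_all _ fun x => (norm_outer _ _).le)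

theorem inner_transp3 (A : E3 →L[ℝ] Tensor) (x y z : E3) :
    ⟪transp3 A x y, z⟫_ℝ = ⟪A z x, y⟫_ℝ := by
  rw [transp3, ContinuousLinearMap.adjoint_inner_left, real_inner_comm]
  rfl

theorem norm_transp3_le (A : E3 →L[ℝ] Tensor) (x y : E3) :
    ‖transp3 A x y‖ ≤ ‖A‖ * (‖x‖ * ‖y‖) := by
  have h1 := (transp (A.flip x)).le_opNorm y
  rw [norm_transp] at h1
  have h2 := A.flip.le_opNorm x
  rw [ContinuousLinearMap.opNorm_flip] at h2
  refine h1.trans ?_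
  rw [← mul_assoc]
  exact mul_le_mul_of_nonneg_right h2 (norm_nonneg _)

theorem aestronglyMeasurable_transp3 {μ : Measure E3} {A : E3 → E3 →L[ℝ] Tensor} {u v : Field}
    (hA : AEStronglyMeasurable A μ) (hu : AEStronglyMeasurable u μ)
    (hv : AEStronglyMeasurable v μ) :
    AEStronglyMeasurable (fun x => transp3 (A x) (u x) (v x)) μ := by
  have h1 : AEStronglyMeasurable (fun x => (A x).flip) μ :=
    (ContinuousLinearMap.flipₗᵢ ℝ E3 E3 E3).continuous.comp_aestronglyMeasurable hA
  have h2 : AEStronglyMeasurable (fun x => (A x).flip (u x)) μ :=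
    isBoundedBilinearMap_apply.continuous.comp_aestronglyMeasurable (h1.prodMk hu)
  exact aestronglyMeasurable_apply (aestronglyMeasurable_transp h2) hv

theorem memLp_of_norm_le {μ : Measure E3} {u v : Field} {C : ℝ} (hu : MemLp u 2 μ)
    (hv : AEStronglyMeasurable v μ) (h : ∀ᵐ x ∂μ, ‖v x‖ ≤ C * ‖u x‖) : MemLp v 2 μ :=
  hu.of_le_mul hv h

theorem integrable_chi {Ω ω : Set E3} [IsFiniteMeasure (volume.restrict Ω)]
    (hω : MeasurableSet ω) : IntegrableOn (chi ω) Ω :=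
  Integrable.of_bound (measurable_chi hω).aestronglyMeasurable 1
    (ae_of_all _ (norm_chi_le_one ω))

namespace Data.Admissible

variable {d : Data} {γ : ℝ} {ω : Set E3} {E P : Field}

theorem memLp_reluctivity (hd : d.Admissible) {c : Field} (hc : MemLp c 2 (volume.restrict d.Ω)) :
    MemLp (fun x => d.ν x (c x)) 2 (volume.restrict d.Ω) := by
  obtain ⟨_, _, _, _, h⟩ := hd.reluctivity.isMonotoneOp
  exact h.memLp hc

theorem memLp_permittivity (hd : d.Admissible) {c : Field}
    (hc : MemLp c 2 (volume.restrict d.Ω)) :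
    MemLp (fun x => d.ε x (c x)) 2 (volume.restrict d.Ω) := by
  obtain ⟨_, _, _, _, h⟩ := hd.permittivity.isMonotoneOp
  exact h.memLp hc

theorem memLp_chi_Lam (hd : d.Admissible) (hγ : 0 < γ) (hω : MeasurableSet ω) {μ : Measure E3}
    {u : Field} (hu : MemLp u 2 μ) : MemLp (fun x => chi ω x • Lam d.jc γ (u x)) 2 μ := by
  refine memLp_of_norm_le (C := 2 * (d.jc * γ)) hu ((measurable_chi hω).aestronglyMeasurable.smul
    ((continuous_Lam hγ).comp_aestronglyMeasurable hu.1)) (ae_of_all _ fun x => ?_)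
  rw [norm_smul]
  have h1 := norm_Lam_le hd.jc_pos hγ (u x)
  have h2 := norm_chi_le_one ω x
  nlinarith [norm_nonneg (Lam d.jc γ (u x))]

theorem memLp_chi_psi (hd : d.Admissible) (hγ : 0 < γ) (hω : MeasurableSet ω) {μ : Measure E3}
    {u v : Field} (hu : AEStronglyMeasurable u μ) (hv : MemLp v 2 μ) :
    MemLp (fun x => chi ω x • psi d.jc γ (u x) (v x)) 2 μ := by
  refine memLp_of_norm_le (C := 2 * (d.jc * γ)) hv ((measurable_chi hω).aestronglyMeasurable.smul
    (aestronglyMeasurable_apply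
      ((measurable_psi hγ).comp_aemeasurable hu.aemeasurable).aestronglyMeasurable hv.1))
    (ae_of_all _ fun x => ?_)
  rw [norm_smul]
  have h1 := norm_psi_apply_le hd.jc_pos hγ (u x) (v x)
  have h2 := norm_chi_le_one ω x
  nlinarith [norm_nonneg (psi d.jc γ (u x) (v x))]

/-- Every quadratic term is a product of two square integrable fields, and the characteristic
function is integrable on the bounded `B`. Transposed materials are replaced by the materials
themselves, to which they are equal almost everywhere. -/
theorem integrableOn_S1 (hd : d.Admissible) (hγ : 0 < γ) (hω : MeasurableSet ω)
    (hE : H0Pair d.Ω E (weakCurl d.Ω E)) (hP : H0Pair d.Ω P (weakCurl d.Ω P)) :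
    IntegrableOn (d.S1 γ ω E P) d.B := by
  have := hd.isFiniteMeasure_B
  have r := fun {u : Field} (hu : MemLp u 2 (volume.restrict d.Ω)) => hd.memLp_restrict_B hu
  have hE1 := r hE.1
  have hP1 := r hP.1
  have hE2 := r hE.2.1
  have hP2 := r hP.2.1
  have hf := r hd.source.1
  have hy : MemLp (fun x => E x - d.Ed x) 2 (volume.restrict d.B) := hE1.sub hd.memLp_target
  have hκ := hd.memLp_misfit hE.1
  have hν := r (hd.memLp_reluctivity hE.2.1)
  have hε := r (hd.memLp_permittivity hE.1)
  have hνt : MemLp (fun x => transp (d.ν x) (weakCurl d.Ω P x)) 2 (volume.restrict d.B) := by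
    refine r ((memLp_congr_ae ?_).2 (hd.memLp_reluctivity hP.2.1))
    filter_upwards [hd.reluctivity.2.2.1] with x hx
    rw [hx]
  have hεt : MemLp (fun x => transp (d.ε x) (P x)) 2 (volume.restrict d.B) := by
    refine r ((memLp_congr_ae ?_).2 (hd.memLp_permittivity hP.1))
    filter_upwards [hd.permittivity.2.2.1] with x hx
    rw [hx]
  have hΛ := hd.memLp_chi_Lam hγ hω hE1
  have hψ := hd.memLp_chi_psi hγ hω hE1.1 hP1
  have i1 : Integrable (fun x => d.κ x / 2 * ‖E x - d.Ed x‖ ^ 2) (volume.restrict d.B) := by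
    refine ((integrable_inner hκ hy).div_const 2).congr (ae_of_all _ fun x => ?_)
    simp only [real_inner_smul_left, real_inner_self_eq_norm_sq]
    ring
  have i2 : Integrable (fun x => chi ω x * ⟪Lam d.jc γ (E x), P x⟫_ℝ) (volume.restrict d.B) := by
    refine (integrable_inner hΛ hP1).congr (ae_of_all _ fun x => ?_)
    exact real_inner_smul_left _ _ _
  have i3 : Integrable (fun x => d.κ x • outer (E x) (E x - d.Ed x)) (volume.restrict d.B) :=
    (integrable_outer hE1 hκ).congr (ae_of_all _ fun x => outer_smul_right _ _ _)
  have i4 : Integrable (fun x => chi ω x • outer (P x) (Lam d.jc γ (E x)))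
      (volume.restrict d.B) :=
    (integrable_outer hP1 hΛ).congr (ae_of_all _ fun x => outer_smul_right _ _ _)
  have i5 : Integrable (fun x => chi ω x • outer (E x) (psi d.jc γ (E x) (P x)))
      (volume.restrict d.B) :=
    (integrable_outer hE1 hψ).congr (ae_of_all _ fun x => outer_smul_right _ _ _)
  exact (((((((((((((i1.add (integrable_chi hω)).sub (integrable_inner hν hP2)).add
    (integrable_inner hε hP1)).add i2).sub (integrable_inner hf hP1)).smul_const
    (ContinuousLinearMap.id ℝ E3)).sub i3).add (integrable_outer hν hP2)).add
    (integrable_outer hνt hE2)).sub (integrable_outer hP1 hε)).sub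
    (integrable_outer hE1 hεt)).add (integrable_outer hP1 hf)).sub i4).sub i5

theorem integrableOn_S0 (hd : d.Admissible)
    (hE : H0Pair d.Ω E (weakCurl d.Ω E)) (hP : H0Pair d.Ω P (weakCurl d.Ω P)) :
    IntegrableOn (d.S0 E P) d.B := by
  have := hd.isFiniteMeasure_B
  obtain ⟨k, hk, hb⟩ := hd.exists_bounds_B
  have r := fun {u : Field} (hu : MemLp u 2 (volume.restrict d.Ω)) => hd.memLp_restrict_B hu
  have hE1 := r hE.1
  have hP1 := r hP.1
  have hE2 := r hE.2.1
  have hP2 := r hP.2.1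
  have hy : MemLp (fun x => E x - d.Ed x) 2 (volume.restrict d.B) := hE1.sub hd.memLp_target
  have hκ := hd.memLp_misfit hE.1
  have hB : ∀ᵐ x ∂(volume.restrict d.B), x ∈ d.B := ae_restrict_mem hd.isOpen_B.measurableSet
  have m1 : AEStronglyMeasurable (gradient d.κ) (volume.restrict d.B) := by
    have : gradient d.κ = fun x => (InnerProductSpace.toDual ℝ E3).symm (fderiv ℝ d.κ x) := rfl
    rw [this]
    exact (InnerProductSpace.toDual ℝ E3).symm.continuous.comp_aestronglyMeasurable
      (measurable_fderiv ℝ d.κ).aestronglyMeasurable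
  have mt : ∀ g : Field, AEStronglyMeasurable (fun x => transp (fderiv ℝ g x))
      (volume.restrict d.B) := fun g =>
    aestronglyMeasurable_transp (measurable_fderiv ℝ g).aestronglyMeasurable
  have mq : AEStronglyMeasurable (fun x => ‖E x - d.Ed x‖ ^ 2 / 2) (volume.restrict d.B) :=
    Continuous.comp_aestronglyMeasurable (g := fun z : E3 => ‖z‖ ^ 2 / 2) (by fun_prop) hy.1
  have i1 : Integrable (fun x => (‖E x - d.Ed x‖ ^ 2 / 2) • gradient d.κ x)
      (volume.restrict d.B) := by
    refine ((integrable_norm_mul_norm hy hy).const_mul k).mono'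
      (mq.smul m1) ?_
    filter_upwards [hB] with x hx
    have h1 : ‖gradient d.κ x‖ ≤ k := by
      rw [gradient, LinearIsometryEquiv.norm_map]; exact (hb x hx).2.1
    rw [norm_smul, Real.norm_of_nonneg (by positivity)]
    nlinarith [sq_nonneg ‖E x - d.Ed x‖, norm_nonneg (gradient d.κ x)]
  have i2 : Integrable (fun x => d.κ x • transp (fderiv ℝ d.Ed x) (E x - d.Ed x))
      (volume.restrict d.B) := by
    refine ((hκ.integrable one_le_two).norm.const_mul k).mono'
      (hd.aestronglyMeasurable_weight.smul (aestronglyMeasurable_apply (mt d.Ed) hy.1)) ?_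
    filter_upwards [hB] with x hx
    rw [← map_smul]
    refine ((transp (fderiv ℝ d.Ed x)).le_opNorm _).trans ?_
    rw [norm_transp]
    exact mul_le_mul_of_nonneg_right (hb x hx).2.2.2.1 (norm_nonneg _)
  have i3 : Integrable (fun x => transp3 (fderiv ℝ d.ν x) (weakCurl d.Ω E x) (weakCurl d.Ω P x))
      (volume.restrict d.B) := by
    refine ((integrable_norm_mul_norm hE2 hP2).const_mul k).mono' (aestronglyMeasurable_transp3
      (measurable_fderiv ℝ d.ν).aestronglyMeasurable hE2.1 hP2.1) ?_
    filter_upwards [hB] with x hx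
    exact (norm_transp3_le _ _ _).trans (mul_le_mul_of_nonneg_right
      (hb x hx).2.2.2.2.2.2.2.2 (by positivity))
  have i4 : Integrable (fun x => transp3 (fderiv ℝ d.ε x) (E x) (P x))
      (volume.restrict d.B) := by
    refine ((integrable_norm_mul_norm hE1 hP1).const_mul k).mono' (aestronglyMeasurable_transp3
      (measurable_fderiv ℝ d.ε).aestronglyMeasurable hE1.1 hP1.1) ?_
    filter_upwards [hB] with x hx
    exact (norm_transp3_le _ _ _).trans (mul_le_mul_of_nonneg_right
      (hb x hx).2.2.2.2.2.2.1 (by positivity))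
  have i5 : Integrable (fun x => transp (fderiv ℝ d.f x) (P x)) (volume.restrict d.B) := by
    refine ((hP1.integrable one_le_two).norm.const_mul k).mono'
      (aestronglyMeasurable_apply (mt d.f) hP1.1) ?_
    filter_upwards [hB] with x hx
    refine ((transp (fderiv ℝ d.f x)).le_opNorm _).trans ?_
    rw [norm_transp]
    exact mul_le_mul_of_nonneg_right (hb x hx).2.2.2.2.1 (norm_nonneg _)
  exact (((i1.sub i2).add i3).add i4).sub i5

end Data.Admissible

/-! ### Measurability of the transported coefficients -/

namespace IsLipEquiv

variable {d : Data} {γ : ℝ} {K : Set E3} {T S : E3 → E3} {μ : Measure E3}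

theorem aestronglyMeasurable_fderiv (T : E3 → E3) : AEStronglyMeasurable (fderiv ℝ T) μ :=
  (measurable_fderiv ℝ T).aestronglyMeasurable

theorem aestronglyMeasurable_det (T : E3 → E3) :
    AEStronglyMeasurable (fun x => (fderiv ℝ T x).det) μ :=
  ContinuousLinearMap.continuous_det.comp_aestronglyMeasurable (aestronglyMeasurable_fderiv T)

theorem aestronglyMeasurable_tensor_mul {A A' : E3 → Tensor} (hA : AEStronglyMeasurable A μ)
    (hA' : AEStronglyMeasurable A' μ) : AEStronglyMeasurable (fun x => A x * A' x) μ :=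
  hA.mul hA'

theorem aestronglyMeasurable_invTransp {s : Set E3}
    (hdet : ∀ᵐ x, 0 < (fderiv ℝ T x).det) :
    AEStronglyMeasurable (fun x => invTransp (fderiv ℝ T x)) (volume.restrict s) := by
  have h1 : AEStronglyMeasurable
      (fun x => transp (((fderiv ℝ T x).det)⁻¹ • adj (fderiv ℝ T x))) (volume.restrict s) :=
    aestronglyMeasurable_transp ((aestronglyMeasurable_det T).aemeasurable.inv
      |>.aestronglyMeasurable.smul
        (continuous_adj.comp_aestronglyMeasurable (aestronglyMeasurable_fderiv T)))
  refine h1.congr (ae_restrict_of_ae (hdet.mono fun x hx => ?_))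
  simp only [invTransp, inverse_eq_inv_det_smul_adj hx.ne']

theorem aestronglyMeasurable_comp (h : IsLipEquiv K T S) (hd : d.Admissible) (hK : K ⊆ d.B)
    {F : Type*} [TopologicalSpace F] {g : E3 → F}
    (hg : AEStronglyMeasurable g (volume.restrict d.Ω)) :
    AEStronglyMeasurable (fun x => g (T x)) (volume.restrict d.Ω) :=
  hg.comp_quasiMeasurePreserving
    (h.quasiMeasurePreserving (hK.trans hd.subset) hd.isOpen_Ω.measurableSet)

theorem aestronglyMeasurable_comp_B (h : IsLipEquiv K T S) (hd : d.Admissible) (hK : K ⊆ d.B)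
    {F : Type*} [TopologicalSpace F] {g : E3 → F}
    (hg : AEStronglyMeasurable g (volume.restrict d.B)) :
    AEStronglyMeasurable (fun x => g (T x)) (volume.restrict d.B) :=
  hg.comp_quasiMeasurePreserving (h.quasiMeasurePreserving hK hd.isOpen_B.measurableSet)

theorem aestronglyMeasurable_reluctivityT (h : IsLipEquiv K T S) (hd : d.Admissible)
    (hK : K ⊆ d.B) : AEStronglyMeasurable (d.reluctivityT T) (volume.restrict d.Ω) :=
  ((aestronglyMeasurable_det T).aemeasurable.inv.aestronglyMeasurable).smul
    (aestronglyMeasurable_tensor_mul (aestronglyMeasurable_transp (aestronglyMeasurable_fderiv T))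
      (aestronglyMeasurable_tensor_mul (h.aestronglyMeasurable_comp hd hK hd.reluctivity.1.1)
        (aestronglyMeasurable_fderiv T)))

theorem aestronglyMeasurable_permittivityT (h : IsLipEquiv K T S) (hd : d.Admissible)
    (hK : K ⊆ d.B) (hdet : ∀ᵐ x, 0 < (fderiv ℝ T x).det) :
    AEStronglyMeasurable (d.permittivityT T) (volume.restrict d.Ω) :=
  (aestronglyMeasurable_det T).smul
    (aestronglyMeasurable_tensor_mul
      (aestronglyMeasurable_transp (aestronglyMeasurable_invTransp hdet))
      (aestronglyMeasurable_tensor_mul (h.aestronglyMeasurable_comp hd hK hd.permittivity.1.1)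
        (aestronglyMeasurable_invTransp hdet)))

theorem aestronglyMeasurable_LamT {s : Set E3} (hγ : 0 < γ)
    (hdet : ∀ᵐ x, 0 < (fderiv ℝ T x).det) {u : Field}
    (hu : AEStronglyMeasurable u (volume.restrict s)) :
    AEStronglyMeasurable (fun x => d.LamT γ T x (u x)) (volume.restrict s) :=
  (aestronglyMeasurable_det T).smul (aestronglyMeasurable_apply
    (aestronglyMeasurable_transp (aestronglyMeasurable_invTransp hdet))
    ((continuous_Lam hγ).comp_aestronglyMeasurable
      (aestronglyMeasurable_apply (aestronglyMeasurable_invTransp hdet) hu)))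

theorem aestronglyMeasurable_sourceT (h : IsLipEquiv K T S) (hd : d.Admissible)
    (hK : K ⊆ d.B) (hdet : ∀ᵐ x, 0 < (fderiv ℝ T x).det) :
    AEStronglyMeasurable (d.sourceT T) (volume.restrict d.Ω) :=
  (aestronglyMeasurable_det T).smul (aestronglyMeasurable_apply
    (aestronglyMeasurable_transp (aestronglyMeasurable_invTransp hdet))
    (h.aestronglyMeasurable_comp hd hK hd.source.1.1))

theorem aestronglyMeasurable_weightT (h : IsLipEquiv K T S) (hd : d.Admissible)
    (hK : K ⊆ d.B) : AEStronglyMeasurable (d.weightT T) (volume.restrict d.B) :=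
  (aestronglyMeasurable_det T).mul
    (h.aestronglyMeasurable_comp_B hd hK hd.aestronglyMeasurable_weight)

theorem aestronglyMeasurable_misfitT (h : IsLipEquiv K T S) (hd : d.Admissible)
    (hK : K ⊆ d.B) (hdet : ∀ᵐ x, 0 < (fderiv ℝ T x).det) {u : Field}
    (hu : AEStronglyMeasurable u (volume.restrict d.B)) :
    AEStronglyMeasurable (d.misfitT T u) (volume.restrict d.B) :=
  (aestronglyMeasurable_apply (aestronglyMeasurable_invTransp hdet) hu).sub
    (h.aestronglyMeasurable_comp_B hd hK hd.memLp_target.1)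

end IsLipEquiv

end HTS

namespace HTS

open Data

/-! ### Differentiation of integrals along expansions -/

theorem Expands.const_mul {t : ℕ → ℝ} {a : ℕ → ℝ} {a₀ : ℝ} {p : ℕ → ℝ} {α : ℝ}
    (h : Expands t a a₀ p α) {c : ℝ} (hc : |c| ≤ 1) :
    Expands t (fun n => c * a n) (c * a₀) (fun n => c * p n) α where
  bound n := by
    rw [norm_mul, Real.norm_eq_abs]
    exact (mul_le_of_le_one_left (norm_nonneg _) hc).trans (h.bound n)
  bound_zero := by
    rw [norm_mul, Real.norm_eq_abs]
    exact (mul_le_of_le_one_left (norm_nonneg _) hc).trans h.bound_zero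
  near n := by
    rw [← mul_sub, norm_mul, Real.norm_eq_abs]
    exact (mul_le_of_le_one_left (norm_nonneg _) hc).trans (h.near n)
  bound_deriv n := by
    rw [norm_mul, Real.norm_eq_abs]
    exact (mul_le_of_le_one_left (norm_nonneg _) hc).trans (h.bound_deriv n)
  lim := by
    have := h.lim.const_mul c
    rw [mul_zero] at this
    refine this.congr fun n => ?_
    simp only [smul_eq_mul]
    ring

section Integral

variable {μ : Measure E3} {t : ℕ → ℝ} {a : ℕ → E3 → ℝ} {a₀ α : E3 → ℝ} {p : ℕ → E3 → ℝ}

theorem integrable_of_expands (hα : Integrable α μ) (ha : ∀ n, AEStronglyMeasurable (a n) μ)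
    (h : ∀ᵐ x ∂μ, Expands t (fun n => a n x) (a₀ x) (fun n => p n x) (α x)) (n : ℕ) :
    Integrable (a n) μ :=
  hα.mono' (ha n) (h.mono fun _ hx => hx.bound n)

theorem integrable_zero_of_expands (hα : Integrable α μ) (ha₀ : AEStronglyMeasurable a₀ μ)
    (h : ∀ᵐ x ∂μ, Expands t (fun n => a n x) (a₀ x) (fun n => p n x) (α x)) :
    Integrable a₀ μ :=
  hα.mono' ha₀ (h.mono fun _ hx => hx.bound_zero)

/-- Dominated convergence with dominating function `2 α`. Since the coefficients `p n` need not
converge, only the difference between quotient and coefficient is claimed to vanish in the limit. -/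
theorem tendsto_integral_expands (ht : ∀ n, 0 < t n) (hα : Integrable α μ)
    (ha : ∀ n, Integrable (a n) μ) (ha₀ : Integrable a₀ μ)
    (hp : ∀ n, AEStronglyMeasurable (p n) μ)
    (h : ∀ᵐ x ∂μ, Expands t (fun n => a n x) (a₀ x) (fun n => p n x) (α x)) :
    Tendsto (fun n => (t n)⁻¹ * ((∫ x, a n x ∂μ) - ∫ x, a₀ x ∂μ) - ∫ x, p n x ∂μ) atTop
      (𝓝 0) := by
  have hpi : ∀ n, Integrable (p n) μ := fun n =>
    hα.mono' (hp n) (h.mono fun _ hx => hx.bound_deriv n)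
  have hai : ∀ n, Integrable (fun x => (t n)⁻¹ * (a n x - a₀ x)) μ := fun n =>
    ((ha n).sub ha₀).const_mul _
  have e : ∀ n, (t n)⁻¹ * ((∫ x, a n x ∂μ) - ∫ x, a₀ x ∂μ) - ∫ x, p n x ∂μ =
      ∫ x, ((t n)⁻¹ * (a n x - a₀ x) - p n x) ∂μ := fun n => by
    rw [integral_sub (hai n) (hpi n), integral_const_mul, integral_sub (ha n) ha₀]
  simp only [e]
  rw [← integral_zero E3 ℝ (μ := μ)]
  refine tendsto_integral_of_dominated_convergence (fun x => α x + α x)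
    (fun n => ((hai n).sub (hpi n)).1) (hα.add hα) (fun n => ?_) ?_
  · filter_upwards [h] with x hx
    refine (norm_sub_le _ _).trans (add_le_add ?_ (hx.bound_deriv n))
    exact hx.norm_quotient_le ht n
  · filter_upwards [h] with x hx
    exact hx.lim

end Integral

theorem aestronglyMeasurable_chi_mul {Ω ω : Set E3} (hω : MeasurableSet ω) (hs : ω ⊆ Ω)
    {g : E3 → ℝ} (hg : AEStronglyMeasurable g (volume.restrict ω)) :
    AEStronglyMeasurable (fun x => chi ω x * g x) (volume.restrict Ω) := by
  have : (fun x => chi ω x * g x) = ω.indicator g := by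
    funext x
    by_cases hx : x ∈ ω <;> simp [chi, hx]
  rw [this, aestronglyMeasurable_indicator_iff hω, Measure.restrict_restrict hω,
    Set.inter_eq_left.2 hs]
  exact hg

theorem aestronglyMeasurable_frob {μ : Measure E3} {A A' : E3 → Tensor}
    (hA : AEStronglyMeasurable A μ) (hA' : AEStronglyMeasurable A' μ) :
    AEStronglyMeasurable (fun x => frob (A x) (A' x)) μ := by
  have : (fun x => frob (A x) (A' x)) =
      fun x => ∑ j : Fin 3, ⟪A x (e j), A' x (e j)⟫_ℝ := rfl
  rw [this]
  exact Finset.aestronglyMeasurable_fun_sum _ fun j _ =>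
    (aestronglyMeasurable_apply hA aestronglyMeasurable_const).inner
      (aestronglyMeasurable_apply hA' aestronglyMeasurable_const)

/-! ### The shape derivative of the Lagrangian for fixed fields -/

theorem isLipEquiv_id (K : Set E3) (hK : IsCompact K) : IsLipEquiv K id id where
  left _ := rfl
  right _ := rfl
  lip := ⟨1, LipschitzWith.id⟩
  lip_inv := ⟨1, LipschitzWith.id⟩
  compact := hK
  off _ _ := rfl

namespace Data

variable (d : Data) (γ : ℝ)

theorem fderiv_id_tensor (x : E3) : fderiv ℝ (id : E3 → E3) x = 1 := fderiv_id

theorem weightT_id (x : E3) : d.weightT id x = d.κ x := by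
  rw [weightT, fderiv_id_tensor, det_one, one_mul, id]

theorem reluctivityT_id (x : E3) : d.reluctivityT id x = d.ν x := by
  rw [reluctivityT, fderiv_id_tensor, det_one, inv_one, one_smul, transp_one, one_mul, mul_one, id]

theorem permittivityT_id (x : E3) : d.permittivityT id x = d.ε x := by
  rw [permittivityT, fderiv_id_tensor, det_one, one_smul, invTransp_one, transp_one, one_mul,
    mul_one, id]

theorem LamT_id (x a : E3) : d.LamT γ id x a = Lam d.jc γ a := by
  rw [LamT, fderiv_id_tensor, det_one, one_smul, invTransp_one, transp_one]
  rfl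

theorem sourceT_id (x : E3) : d.sourceT id x = d.f x := by
  rw [sourceT, fderiv_id_tensor, det_one, one_smul, invTransp_one, transp_one]
  rfl

theorem misfitT_id (u : Field) (x : E3) : d.misfitT id u x = u x - d.Ed x := by
  rw [misfitT, fderiv_id_tensor, invTransp_one]
  rfl

/-- The integrand of `lagrangianT`. -/
noncomputable def lagrangianDensity (ω : Set E3) (T : E3 → E3) (u c v w : Field) (x : E3) : ℝ :=
  chi d.B x * (1 / 2 * (d.weightT T x * ⟪d.misfitT T u x, d.misfitT T u x⟫_ℝ)) +
    chi ω x * (fderiv ℝ T x).det +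
    ⟪d.reluctivityT T x (c x), w x⟫_ℝ + ⟪d.permittivityT T x (u x), v x⟫_ℝ +
    chi ω x * ⟪d.LamT γ T x (u x), v x⟫_ℝ - ⟪d.sourceT T x, v x⟫_ℝ

variable {d γ}

theorem integral_lagrangianDensity {ω : Set E3} (hd : d.Admissible) (hω : MeasurableSet ω)
    (hs : ω ⊆ d.Ω) {T : E3 → E3} {u c v w : Field}
    (i1 : IntegrableOn (fun x => chi d.B x *
      (1 / 2 * (d.weightT T x * ⟪d.misfitT T u x, d.misfitT T u x⟫_ℝ))) d.Ω)
    (i2 : IntegrableOn (fun x => chi ω x * (fderiv ℝ T x).det) d.Ω)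
    (i3 : IntegrableOn (fun x => ⟪d.reluctivityT T x (c x), w x⟫_ℝ) d.Ω)
    (i4 : IntegrableOn (fun x => ⟪d.permittivityT T x (u x), v x⟫_ℝ) d.Ω)
    (i5 : IntegrableOn (fun x => chi ω x * ⟪d.LamT γ T x (u x), v x⟫_ℝ) d.Ω)
    (i6 : IntegrableOn (fun x => ⟪d.sourceT T x, v x⟫_ℝ) d.Ω) :
    IntegrableOn (d.lagrangianDensity γ ω T u c v w) d.Ω ∧
    ∫ x in d.Ω, d.lagrangianDensity γ ω T u c v w x = d.lagrangianT γ ω T u c v w := by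
  refine ⟨((((i1.add i2).add i3).add i4).add i5).sub i6, ?_⟩
  simp only [lagrangianDensity]
  have e1 := setIntegral_chi_mul hd.isOpen_B.measurableSet hd.subset
    (fun x => 1 / 2 * (d.weightT T x * ⟪d.misfitT T u x, d.misfitT T u x⟫_ℝ))
  have e2 := setIntegral_chi_mul hω hs (fun x => (fderiv ℝ T x).det)
  have e5 := setIntegral_chi_mul hω hs (fun x => ⟪d.LamT γ T x (u x), v x⟫_ℝ)
  have e := integral_sub' ((((i1.add i2).add i3).add i4).add i5) i6
  rw [integral_add' (((i1.add i2).add i3).add i4) i5, integral_add' ((i1.add i2).add i3) i4,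
    integral_add' (i1.add i2) i3, integral_add' i1 i2, e1, e2, e5, integral_const_mul] at e
  refine Eq.trans e ?_
  rw [lagrangianT]
  simp only [real_inner_self_eq_norm_sq]
  ring

end Data

namespace NearIdSeq

variable {d : Data} {γ : ℝ} {K ω : Set E3} {C M : ℝ} {θ : Field} {t : ℕ → ℝ} {T : ℕ → E3 → E3}
  {E P : Field}

/-- The pointwise first order terms add up to the shape gradient. -/
theorem sum_deriv_eq (E P : Field) {x : E3} (hsν : transp (d.ν x) = d.ν x)
    (hsε : transp (d.ε x) = d.ε x) (κ' : fderiv ℝ d.κ x (θ x) = ⟪gradient d.κ x, θ x⟫_ℝ) (R : Tensor) :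
    1 / 2 * ((trace R * d.κ x + fderiv ℝ d.κ x (θ x)) * ⟪E x - d.Ed x, E x - d.Ed x⟫_ℝ +
        d.κ x * (⟪-transp R (E x) - fderiv ℝ d.Ed x (θ x), E x - d.Ed x⟫_ℝ +
          ⟪E x - d.Ed x, -transp R (E x) - fderiv ℝ d.Ed x (θ x)⟫_ℝ)) +
      chi ω x * trace R +
      ⟪(-trace R • d.ν x + (transp R * d.ν x + (fderiv ℝ d.ν x (θ x) + d.ν x * R)))
        (weakCurl d.Ω E x), weakCurl d.Ω P x⟫_ℝ +
      ⟪(trace R • d.ε x + (-R * d.ε x + (fderiv ℝ d.ε x (θ x) + d.ε x * -transp R))) (E x),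
        P x⟫_ℝ +
      chi ω x * ⟪trace R • Lam d.jc γ (E x) + (-R (Lam d.jc γ (E x)) +
        psi d.jc γ (E x) (-transp R (E x))), P x⟫_ℝ -
      ⟪trace R • d.f x + (-R (d.f x) + fderiv ℝ d.f x (θ x)), P x⟫_ℝ =
    frob (d.S1 γ ω E P x) R + ⟪d.S0 E P x, θ x⟫_ℝ := by
  have hν : ∀ y z, ⟪d.ν x y, z⟫_ℝ = ⟪y, d.ν x z⟫_ℝ := fun y z => by
    rw [← inner_transp_left, hsν]
  have hε : ∀ y z, ⟪d.ε x y, z⟫_ℝ = ⟪y, d.ε x z⟫_ℝ := fun y z => by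
    rw [← inner_transp_left, hsε]
  have htr : ∀ (c : ℝ), frob (c • ContinuousLinearMap.id ℝ E3) R = c * trace R := fun c =>
    frob_smul_left _ _ _
  have a3 : ⟪d.ν x (R (weakCurl d.Ω E x)), weakCurl d.Ω P x⟫_ℝ =
      ⟪d.ν x (weakCurl d.Ω P x), R (weakCurl d.Ω E x)⟫_ℝ := by rw [hν, real_inner_comm]
  have a5 : ⟪d.ε x (transp R (E x)), P x⟫_ℝ = ⟪E x, R (d.ε x (P x))⟫_ℝ := by
    rw [hε, inner_transp_left]
  simp only [S1, S0]
  -- Abstracting the misfit keeps the rules for inner products of differences from splitting it.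
  generalize E x - d.Ed x = y
  have a1 : ⟪y, transp R (E x)⟫_ℝ = ⟪E x, R y⟫_ℝ := by rw [inner_transp_right, real_inner_comm]
  simp only [frob_sub_left, frob_add_left, htr, frob_smul_left, frob_outer_left, hsν, hsε,
    inner_add_left, inner_sub_left, inner_transp3, real_inner_smul_left, inner_transp_left,
    _root_.add_apply, _root_.smul_apply, tensor_mul_apply, map_neg, _root_.neg_apply,
    inner_neg_left, inner_sub_right, inner_neg_right, inner_psi_comm, κ']
  rw [a1, a3, a5, real_inner_comm y (fderiv ℝ d.Ed x (θ x)), real_inner_comm (P x) (R (d.ε x (E x))),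
    real_inner_comm (P x) (R (Lam d.jc γ (E x))), real_inner_comm (P x) (R (d.f x)),
    real_inner_comm (P x) (fderiv ℝ d.f x (θ x)), real_inner_self_eq_norm_sq]
  ring

/-- Derivative of the transported Lagrangian with fixed fields. -/
theorem tendsto_lagrangianT_slope (h : NearIdSeq d.B K C M θ t T) (hd : d.Admissible)
    (hγ : 0 < γ) (hω : MeasurableSet ω) (hs : ω ⊆ d.B) (hθ : ∃ k : ℝ≥0, LipschitzWith k θ)
    (hE : H0Pair d.Ω E (weakCurl d.Ω E)) (hP : H0Pair d.Ω P (weakCurl d.Ω P)) :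
    Tendsto (fun n => (t n)⁻¹ *
      (d.lagrangianT γ ω (T n) E (weakCurl d.Ω E) P (weakCurl d.Ω P) -
        d.lagrangianT γ ω id E (weakCurl d.Ω E) P (weakCurl d.Ω P))) atTop
      (𝓝 (∫ x in d.B, (frob (d.S1 γ ω E P x) (fderiv ℝ θ x) + ⟪d.S0 E P x, θ x⟫_ℝ))) := by
  have := hd.isFiniteMeasure
  have := hd.isFiniteMeasure_B
  obtain ⟨D, hD, hex⟩ := h.exists_expands_coeff hd hγ
  have ht := h.pos
  have h0 := h.lim
  have ht' := fun n => (ht n).le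
  have hsΩ := hs.trans hd.subset
  have hBm := hd.isOpen_B.measurableSet
  set c := weakCurl d.Ω E with hc
  set w := weakCurl d.Ω P with hw
  have hdet : ∀ n, ∀ᵐ x, 0 < (fderiv ℝ (T n) x).det := h.ae_det_pos
  have hdet₀ : ∀ᵐ x : E3, 0 < (fderiv ℝ (id : E3 → E3) x).det := ae_of_all _ fun x => by
    rw [fderiv_id_tensor, det_one]; exact one_pos
  have hid := isLipEquiv_id K h.compact
  have hEB := hd.memLp_restrict_B hE.1
  -- expansions of the six terms
  have x1 : ∀ᵐ x ∂(volume.restrict d.Ω), Expands t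
      (fun n => chi d.B x * (1 / 2 * (d.weightT (T n) x *
        ⟪d.misfitT (T n) E x, d.misfitT (T n) E x⟫_ℝ)))
      (chi d.B x * (1 / 2 * (d.weightT id x * ⟪d.misfitT id E x, d.misfitT id E x⟫_ℝ)))
      (fun n => chi d.B x * (1 / 2 *
        ((trace (quot t T n x) * d.κ x + fderiv ℝ d.κ x (θ x)) *
            ⟪E x - d.Ed x, E x - d.Ed x⟫_ℝ +
          d.κ x * (⟪-transp (quot t T n x) (E x) - fderiv ℝ d.Ed x (θ x), E x - d.Ed x⟫_ℝ +
            ⟪E x - d.Ed x, -transp (quot t T n x) (E x) - fderiv ℝ d.Ed x (θ x)⟫_ℝ))))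
      (2 * (D * (2 * ((2 * (D * ‖E x‖) + D) * (2 * (D * ‖E x‖) + D))))) := by
    filter_upwards [hex] with x ⟨_, eA, _, _, _, _, eB⟩
    rw [weightT_id, misfitT_id]
    by_cases hx : x ∈ d.B
    · obtain ⟨eκ, eEd⟩ := eB hx
      have ey := (eA.apply (Expands.const ht' (E x)) ht h0).sub eEd
      have := eκ.mul (ey.inner ey ht h0) ht h0
      have h2 := this.const_mul (c := 1 / 2) (by norm_num)
      have h3 := h2.const_mul (c := chi d.B x) (norm_chi_le_one d.B x)
      simpa only [map_zero, add_zero, tensor_one_apply, _root_.neg_apply, misfitT] using h3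
    · have e : chi d.B x = 0 := by simp [chi, hx]
      have := (Expands.const ht' (0 : ℝ)).weaken ht'
        (α' := 2 * (D * (2 * ((2 * (D * ‖E x‖) + D) * (2 * (D * ‖E x‖) + D)))))
        (by rw [norm_zero]; positivity)
      simpa only [e, zero_mul] using this
  have x2 : ∀ᵐ x ∂(volume.restrict d.Ω), Expands t
      (fun n => chi ω x * (fderiv ℝ (T n) x).det) (chi ω x * (fderiv ℝ (id : E3 → E3) x).det)
      (fun n => chi ω x * trace (quot t T n x)) D := by
    filter_upwards [hex] with x ⟨ed, _⟩
    rw [fderiv_id_tensor, det_one]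
    exact ed.const_mul (norm_chi_le_one ω x)
  have x3 : ∀ᵐ x ∂(volume.restrict d.Ω), Expands t
      (fun n => ⟪d.reluctivityT (T n) x (c x), w x⟫_ℝ) ⟪d.reluctivityT id x (c x), w x⟫_ℝ
      (fun n => ⟪(-trace (quot t T n x) • d.ν x + (transp (quot t T n x) * d.ν x +
          (fderiv ℝ d.ν x (θ x) + d.ν x * quot t T n x))) (c x), w x⟫_ℝ)
      (2 * (2 * (D * ‖c x‖) * ‖w x‖)) := by
    filter_upwards [hex] with x ⟨_, _, eν, _⟩
    rw [reluctivityT_id]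
    have := (eν.apply (Expands.const ht' (c x)) ht h0).inner (Expands.const ht' (w x)) ht h0
    simpa only [map_zero, add_zero, inner_zero_right] using this
  have x4 : ∀ᵐ x ∂(volume.restrict d.Ω), Expands t
      (fun n => ⟪d.permittivityT (T n) x (E x), P x⟫_ℝ) ⟪d.permittivityT id x (E x), P x⟫_ℝ
      (fun n => ⟪(trace (quot t T n x) • d.ε x + (-quot t T n x * d.ε x +
          (fderiv ℝ d.ε x (θ x) + d.ε x * -transp (quot t T n x)))) (E x), P x⟫_ℝ)
      (2 * (2 * (D * ‖E x‖) * ‖P x‖)) := by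
    filter_upwards [hex] with x ⟨_, _, _, eε, _⟩
    rw [permittivityT_id]
    have := (eε.apply (Expands.const ht' (E x)) ht h0).inner (Expands.const ht' (P x)) ht h0
    simpa only [map_zero, add_zero, inner_zero_right] using this
  have x5 : ∀ᵐ x ∂(volume.restrict d.Ω), Expands t
      (fun n => chi ω x * ⟪d.LamT γ (T n) x (E x), P x⟫_ℝ)
      (chi ω x * ⟪d.LamT γ id x (E x), P x⟫_ℝ)
      (fun n => chi ω x * ⟪trace (quot t T n x) • Lam d.jc γ (E x) +
        (-quot t T n x (Lam d.jc γ (E x)) +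
          psi d.jc γ (E x) (-transp (quot t T n x) (E x))), P x⟫_ℝ)
      (2 * (D * ‖E x‖ * ‖P x‖)) := by
    filter_upwards [hex] with x ⟨_, _, _, _, eΛ, _⟩
    rw [LamT_id]
    have := ((eΛ (E x)).inner (Expands.const ht' (P x)) ht h0).const_mul (norm_chi_le_one ω x)
    simpa only [inner_zero_right, add_zero] using this
  have x6 : ∀ᵐ x ∂(volume.restrict d.Ω), Expands t
      (fun n => ⟪d.sourceT (T n) x, P x⟫_ℝ) ⟪d.sourceT id x, P x⟫_ℝ
      (fun n => ⟪trace (quot t T n x) • d.f x + (-quot t T n x (d.f x) +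
        fderiv ℝ d.f x (θ x)), P x⟫_ℝ)
      (2 * (D * (‖d.f x‖ + 1) * ‖P x‖)) := by
    filter_upwards [hex] with x ⟨_, _, _, _, _, ef, _⟩
    rw [sourceT_id]
    have := ef.inner (Expands.const ht' (P x)) ht h0
    simpa only [inner_zero_right, add_zero] using this
  -- integrability of the bounds
  have α1 : IntegrableOn
      (fun x => 2 * (D * (2 * ((2 * (D * ‖E x‖) + D) * (2 * (D * ‖E x‖) + D))))) d.Ω := by
    have m : MemLp (fun x => 2 * (D * ‖E x‖) + D) 2 (volume.restrict d.Ω) :=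
      ((hE.1.norm.const_mul D).const_mul 2).add (memLp_const D)
    refine (m.integrable_sq.const_mul (4 * D)).congr (ae_of_all _ fun x => ?_)
    ring
  have α2 : IntegrableOn (fun _ : E3 => D) d.Ω := integrable_const D
  have α3 : IntegrableOn (fun x => 2 * (2 * (D * ‖c x‖) * ‖w x‖)) d.Ω := by
    refine ((integrable_norm_mul_norm hE.2.1 hP.2.1).const_mul (4 * D)).congr
      (ae_of_all _ fun x => ?_)
    ring
  have α4 : IntegrableOn (fun x => 2 * (2 * (D * ‖E x‖) * ‖P x‖)) d.Ω := by
    refine ((integrable_norm_mul_norm hE.1 hP.1).const_mul (4 * D)).congr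
      (ae_of_all _ fun x => ?_)
    ring
  have α5 : IntegrableOn (fun x => 2 * (D * ‖E x‖ * ‖P x‖)) d.Ω := by
    refine ((integrable_norm_mul_norm hE.1 hP.1).const_mul (2 * D)).congr
      (ae_of_all _ fun x => ?_)
    ring
  have α6 : IntegrableOn (fun x => 2 * (D * (‖d.f x‖ + 1) * ‖P x‖)) d.Ω := by
    refine (((integrable_norm_mul_norm hd.source.1 hP.1).add
      (hP.1.integrable one_le_two).norm).const_mul (2 * D)).congr (ae_of_all _ fun x => ?_)
    simp only [Pi.add_apply]
    ring
  -- measurability of the six terms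
  have key : ∀ {T' S' : E3 → E3}, IsLipEquiv K T' S' → (∀ᵐ x, 0 < (fderiv ℝ T' x).det) →
      AEStronglyMeasurable (fun x => chi d.B x * (1 / 2 * (d.weightT T' x *
        ⟪d.misfitT T' E x, d.misfitT T' E x⟫_ℝ))) (volume.restrict d.Ω) ∧
      AEStronglyMeasurable (fun x => chi ω x * (fderiv ℝ T' x).det) (volume.restrict d.Ω) ∧
      AEStronglyMeasurable (fun x => ⟪d.reluctivityT T' x (c x), w x⟫_ℝ)
        (volume.restrict d.Ω) ∧
      AEStronglyMeasurable (fun x => ⟪d.permittivityT T' x (E x), P x⟫_ℝ)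
        (volume.restrict d.Ω) ∧
      AEStronglyMeasurable (fun x => chi ω x * ⟪d.LamT γ T' x (E x), P x⟫_ℝ)
        (volume.restrict d.Ω) ∧
      AEStronglyMeasurable (fun x => ⟪d.sourceT T' x, P x⟫_ℝ) (volume.restrict d.Ω) := by
    intro T' S' hT' hdet'
    have my := hT'.aestronglyMeasurable_misfitT hd h.subset hdet' hEB.1
    have mω := (measurable_chi hω).aestronglyMeasurable (μ := volume.restrict d.Ω)
    exact ⟨aestronglyMeasurable_chi_mul hBm hd.subset (aestronglyMeasurable_const.mul
        ((hT'.aestronglyMeasurable_weightT hd h.subset).mul (my.inner my))),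
      mω.mul (IsLipEquiv.aestronglyMeasurable_det T'),
      (aestronglyMeasurable_apply (hT'.aestronglyMeasurable_reluctivityT hd h.subset)
        hE.2.1.1).inner hP.2.1.1,
      (aestronglyMeasurable_apply (hT'.aestronglyMeasurable_permittivityT hd h.subset hdet')
        hE.1.1).inner hP.1.1,
      mω.mul ((IsLipEquiv.aestronglyMeasurable_LamT hγ hdet' hE.1.1).inner hP.1.1),
      (hT'.aestronglyMeasurable_sourceT hd h.subset hdet').inner hP.1.1⟩
  have kn := fun n => key (h.isLipEquiv n) (hdet n)
  have k0 := key hid hdet₀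
  have In := fun n => integral_lagrangianDensity (γ := γ) hd hω hsΩ
    (integrable_of_expands α1 (fun n => (kn n).1) x1 n)
    (integrable_of_expands α2 (fun n => (kn n).2.1) x2 n)
    (integrable_of_expands α3 (fun n => (kn n).2.2.1) x3 n)
    (integrable_of_expands α4 (fun n => (kn n).2.2.2.1) x4 n)
    (integrable_of_expands α5 (fun n => (kn n).2.2.2.2.1) x5 n)
    (integrable_of_expands α6 (fun n => (kn n).2.2.2.2.2) x6 n)
  have I0 := integral_lagrangianDensity (γ := γ) hd hω hsΩ
    (integrable_zero_of_expands α1 k0.1 x1)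
    (integrable_zero_of_expands α2 k0.2.1 x2)
    (integrable_zero_of_expands α3 k0.2.2.1 x3)
    (integrable_zero_of_expands α4 k0.2.2.2.1 x4)
    (integrable_zero_of_expands α5 k0.2.2.2.2.1 x5)
    (integrable_zero_of_expands α6 k0.2.2.2.2.2 x6)
  have iS1 := hd.integrableOn_S1 hγ hω hE hP
  have iS0 := hd.integrableOn_S0 hE hP
  obtain ⟨kθ, hkθ⟩ := hθ
  have mS0 : AEStronglyMeasurable (fun x => ⟪d.S0 E P x, θ x⟫_ℝ) (volume.restrict d.B) :=
    iS0.1.inner hkθ.continuous.aestronglyMeasurable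
  have mR : ∀ n, AEStronglyMeasurable (quot t T n) (volume.restrict d.B) := fun n =>
    ((IsLipEquiv.aestronglyMeasurable_fderiv (T n)).sub
      (aestronglyMeasurable_const (b := (1 : Tensor)))).const_smul (t n)⁻¹
  have xx : ∀ᵐ x ∂(volume.restrict d.Ω), Expands t
      (fun n => d.lagrangianDensity γ ω (T n) E c P w x) (d.lagrangianDensity γ ω id E c P w x)
      (fun n => chi d.B x * (frob (d.S1 γ ω E P x) (quot t T n x) + ⟪d.S0 E P x, θ x⟫_ℝ))
      (2 * (D * (2 * ((2 * (D * ‖E x‖) + D) * (2 * (D * ‖E x‖) + D)))) + D +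
        2 * (2 * (D * ‖c x‖) * ‖w x‖) + 2 * (2 * (D * ‖E x‖) * ‖P x‖) +
        2 * (D * ‖E x‖ * ‖P x‖) + 2 * (D * (‖d.f x‖ + 1) * ‖P x‖)) := by
    filter_upwards [x1, x2, x3, x4, x5, x6, hd.reluctivity.2.2.1, hd.permittivity.2.2.1]
      with x y1 y2 y3 y4 y5 y6 hsν hsε
    refine (((((y1.add y2).add y3).add y4).add y5).sub y6).congr_deriv fun n => ?_
    by_cases hx : x ∈ d.B
    · have e : chi d.B x = 1 := by simp [chi, hx]
      have eκ : fderiv ℝ d.κ x (θ x) = ⟪gradient d.κ x, θ x⟫_ℝ := by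
        rw [gradient, InnerProductSpace.toDual_symm_apply]
      have := sum_deriv_eq (γ := γ) (ω := ω) E P hsν hsε eκ (quot t T n x)
      rw [← hc, ← hw] at this
      rw [e, one_mul, one_mul]
      exact this
    -- Outside `B` both the quotient and `θ` vanish, so every first order term does too.
    · have hxK : x ∉ K := fun hK => hx (h.subset hK)
      have e : chi d.B x = 0 := by simp [chi, hx]
      have et : trace (0 : Tensor) = 0 := by rw [← traceL_apply, map_zero]
      have et' : transp (0 : Tensor) = 0 := by rw [← transpL_apply, map_zero]
      rw [e, h.quot_eq_zero n hxK, h.off x hxK, et, et']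
      simp
  have mp : ∀ n, AEStronglyMeasurable (fun x => chi d.B x *
      (frob (d.S1 γ ω E P x) (quot t T n x) + ⟪d.S0 E P x, θ x⟫_ℝ)) (volume.restrict d.Ω) :=
    fun n => aestronglyMeasurable_chi_mul hBm hd.subset
      ((aestronglyMeasurable_frob iS1.1 (mR n)).add mS0)
  have hlim := tendsto_integral_expands ht (((((α1.add α2).add α3).add α4).add α5).add α6)
    (fun n => (In n).1) I0.1 mp xx
  have hweak := h.tendsto_integral_frob hBm ⟨kθ, hkθ⟩ iS1
  have iS0θ : IntegrableOn (fun x => ⟪d.S0 E P x, θ x⟫_ℝ) d.B := by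
    refine (iS0.norm.mul_const M).mono' mS0 (ae_of_all _ fun x => ?_)
    exact (norm_inner_le_norm _ _).trans
      (mul_le_mul_of_nonneg_left (h.norm_le x) (norm_nonneg _))
  have iS1n : ∀ {A : E3 → Tensor} {b : ℝ}, AEStronglyMeasurable A (volume.restrict d.B) →
      (∀ᵐ x ∂(volume.restrict d.B), ‖A x‖ ≤ b) →
      IntegrableOn (fun x => frob (d.S1 γ ω E P x) (A x)) d.B := fun {A b} hA hb => by
    refine ((iS1.norm.mul_const b).const_mul 3).mono' (aestronglyMeasurable_frob iS1.1 hA)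
      (hb.mono fun x hx => ?_)
    refine (abs_frob_le _ _).trans ?_
    gcongr
  have eB : ∀ n, ∫ x in d.Ω, chi d.B x *
      (frob (d.S1 γ ω E P x) (quot t T n x) + ⟪d.S0 E P x, θ x⟫_ℝ) =
      (∫ x in d.B, frob (d.S1 γ ω E P x) (quot t T n x)) + ∫ x in d.B, ⟪d.S0 E P x, θ x⟫_ℝ :=
    fun n => by
      rw [setIntegral_chi_mul hBm hd.subset
        (fun x => frob (d.S1 γ ω E P x) (quot t T n x) + ⟪d.S0 E P x, θ x⟫_ℝ)]
      refine integral_add (iS1n (b := C + 2) (mR n) ?_) iS0θ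
      refine ae_restrict_of_ae (h.ae_differentiableAt.mono fun x hx => ?_)
      exact (h.expands_fderiv hx).bound_deriv n
  have e0 : ∫ x in d.B, (frob (d.S1 γ ω E P x) (fderiv ℝ θ x) + ⟪d.S0 E P x, θ x⟫_ℝ) =
      (∫ x in d.B, frob (d.S1 γ ω E P x) (fderiv ℝ θ x)) + ∫ x in d.B, ⟪d.S0 E P x, θ x⟫_ℝ :=
    integral_add (iS1n (b := kθ) (measurable_fderiv ℝ θ).aestronglyMeasurable
      (ae_of_all _ fun x => norm_fderiv_le_of_lipschitz ℝ hkθ)) iS0θ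
  rw [e0]
  -- The strong limit of the remainder is combined with the weak limit of the quotients against
  -- `S1`.
  have := hlim.add (hweak.add_const (∫ x in d.B, ⟪d.S0 E P x, θ x⟫_ℝ))
  rw [zero_add] at this
  refine this.congr fun n => ?_
  rw [(In n).2, I0.2, eB n]
  simp only [quot]
  ring

end NearIdSeq

end HTS

namespace HTS

open Data

/-! ### Lipschitz dependence of the transported state on the transformation -/

/-- The coefficients transported by `T` are `D * s`-close to the original ones at `x`. -/
structure CoeffNearAt (d : Data) (γ : ℝ) (T : E3 → E3) (s D : ℝ) (x : E3) : Prop where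
  det : |(fderiv ℝ T x).det| ≤ D
  invTransp : ‖invTransp (fderiv ℝ T x)‖ ≤ D
  reluctivity : ‖d.reluctivityT T x‖ ≤ D
  reluctivity_sub : ‖d.reluctivityT T x - d.ν x‖ ≤ D * s
  permittivity : ‖d.permittivityT T x‖ ≤ D
  permittivity_sub : ‖d.permittivityT T x - d.ε x‖ ≤ D * s
  Lam : ∀ a, ‖d.LamT γ T x a‖ ≤ D * ‖a‖
  Lam_sub : ∀ a, ‖d.LamT γ T x a - HTS.Lam d.jc γ a‖ ≤ D * s * ‖a‖
  source : ‖d.sourceT T x‖ ≤ D * (‖d.f x‖ + 1)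
  source_sub : ‖d.sourceT T x - d.f x‖ ≤ D * s * (‖d.f x‖ + 1)
  weight : x ∈ d.B → |d.weightT T x| ≤ D
  target : x ∈ d.B → ‖d.Ed (T x)‖ ≤ D

theorem NearIdSeq.exists_coeffNearAt {d : Data} {γ : ℝ} {K : Set E3} {C M : ℝ} {θ : Field}
    {t : ℕ → ℝ} {T : ℕ → E3 → E3} (h : NearIdSeq d.B K C M θ t T) (hd : d.Admissible)
    (hγ : 0 < γ) : ∃ D : ℝ, 0 ≤ D ∧ ∀ n, ∀ᵐ x ∂(volume.restrict d.Ω),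
      CoeffNearAt d γ (T n) (t n) D x := by
  obtain ⟨D, hD, hex⟩ := h.exists_expands_coeff hd hγ
  refine ⟨D, hD, fun n => ?_⟩
  filter_upwards [hex] with x ⟨ed, eA, eν, eε, eΛ, ef, eB⟩
  exact
    { det := ed.bound n
      invTransp := eA.bound n
      reluctivity := eν.bound n
      reluctivity_sub := eν.near n
      permittivity := eε.bound n
      permittivity_sub := eε.near n
      Lam := fun a => (eΛ a).bound n
      Lam_sub := fun a => ((eΛ a).near n).trans (le_of_eq (by ring))
      source := ef.bound n
      source_sub := (ef.near n).trans (le_of_eq (by ring))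
      weight := fun hx => (eB hx).1.bound n
      target := fun hx => (eB hx).2.bound n }

theorem abs_integral_sub_le_l2 {α F G : Type*} [MeasurableSpace α] {μ : Measure α}
    [NormedAddCommGroup F] [NormedAddCommGroup G] {f : α → F} {g : α → G} {b b' : α → ℝ} {C : ℝ}
    (hC : 0 ≤ C) (hf : MemLp f 2 μ) (hg : MemLp g 2 μ) (hb : Integrable b μ)
    (hb' : Integrable b' μ) (h : ∀ᵐ x ∂μ, |b x - b' x| ≤ C * (‖f x‖ * ‖g x‖)) :
    |(∫ x, b x ∂μ) - ∫ x, b' x ∂μ| ≤ C * (l2 μ f * l2 μ g) := by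
  rw [← integral_sub hb hb']
  exact abs_integral_le_l2 hC hf hg h

theorem abs_inner_sub_inner_le {a b z : E3} {C p : ℝ} (h : ‖a - b‖ ≤ C * p) :
    |⟪a, z⟫_ℝ - ⟪b, z⟫_ℝ| ≤ C * (p * ‖z‖) := by
  rw [← inner_sub_left, ← mul_assoc]
  exact (abs_real_inner_le_norm _ _).trans (mul_le_mul_of_nonneg_right h (norm_nonneg _))

theorem integrable_chi_mul {μ : Measure E3} {ω : Set E3} (hω : MeasurableSet ω) {g : E3 → ℝ}
    (hg : Integrable g μ) : Integrable (fun x => chi ω x * g x) μ := by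
  refine hg.norm.mono' ((measurable_chi hω).aestronglyMeasurable.mul hg.1)
    (ae_of_all _ fun x => ?_)
  rw [norm_mul]
  exact mul_le_of_le_one_left (norm_nonneg _) (norm_chi_le_one ω x)

section MemLp

variable {d : Data} {γ : ℝ} {K ω : Set E3} {T S : E3 → E3} {s D : ℝ} {u : Field}

theorem memLp_reluctivityT (h : IsLipEquiv K T S) (hd : d.Admissible) (hK : K ⊆ d.B)
    (hc : ∀ᵐ x ∂(volume.restrict d.Ω), CoeffNearAt d γ T s D x)
    (hu : MemLp u 2 (volume.restrict d.Ω)) :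
    MemLp (fun x => d.reluctivityT T x (u x)) 2 (volume.restrict d.Ω) :=
  memLp_of_norm_le (C := D) hu
    (aestronglyMeasurable_apply (h.aestronglyMeasurable_reluctivityT hd hK) hu.1)
    (hc.mono fun x hx => (d.reluctivityT T x).le_of_opNorm_le hx.reluctivity _)

theorem memLp_permittivityT (h : IsLipEquiv K T S) (hd : d.Admissible) (hK : K ⊆ d.B)
    (hdet : ∀ᵐ x, 0 < (fderiv ℝ T x).det)
    (hc : ∀ᵐ x ∂(volume.restrict d.Ω), CoeffNearAt d γ T s D x)
    (hu : MemLp u 2 (volume.restrict d.Ω)) :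
    MemLp (fun x => d.permittivityT T x (u x)) 2 (volume.restrict d.Ω) :=
  memLp_of_norm_le (C := D) hu
    (aestronglyMeasurable_apply (h.aestronglyMeasurable_permittivityT hd hK hdet) hu.1)
    (hc.mono fun x hx => (d.permittivityT T x).le_of_opNorm_le hx.permittivity _)

theorem memLp_LamT (hγ : 0 < γ) (hdet : ∀ᵐ x, 0 < (fderiv ℝ T x).det)
    (hc : ∀ᵐ x ∂(volume.restrict d.Ω), CoeffNearAt d γ T s D x)
    (hu : MemLp u 2 (volume.restrict d.Ω)) :
    MemLp (fun x => d.LamT γ T x (u x)) 2 (volume.restrict d.Ω) :=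
  memLp_of_norm_le (C := D) hu
    (IsLipEquiv.aestronglyMeasurable_LamT hγ hdet hu.1) (hc.mono fun _ hx => hx.Lam _)

theorem memLp_sourceT (h : IsLipEquiv K T S) (hd : d.Admissible) (hK : K ⊆ d.B)
    (hdet : ∀ᵐ x, 0 < (fderiv ℝ T x).det)
    (hc : ∀ᵐ x ∂(volume.restrict d.Ω), CoeffNearAt d γ T s D x) :
    MemLp (d.sourceT T) 2 (volume.restrict d.Ω) := by
  have := hd.isFiniteMeasure
  have h1 : MemLp (fun x => ‖d.f x‖ + 1) 2 (volume.restrict d.Ω) :=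
    hd.source.1.norm.add (memLp_const 1)
  refine h1.of_le_mul (c := D) (h.aestronglyMeasurable_sourceT hd hK hdet)
    (hc.mono fun x hx => ?_)
  rw [Real.norm_of_nonneg (by positivity)]
  exact hx.source

end MemLp

/-- The absorption step of the stability estimate: `x` and `y` are the errors of field and curl,
`q`, `p`, `F` the sizes of curl, field and source, and `A` the distance of the coefficients. The
quadratic terms on the right are at most `2 A (x² + y²) ≤ (m / 4)(x² + y²)`, and one factor `x + y`
is then cancelled. -/
theorem le_of_sq_le {m A x y p q F : ℝ} (hm : 0 < m) (hx : 0 ≤ x) (hy : 0 ≤ y) (hA : 0 ≤ A)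
    (hp : 0 ≤ p) (hq : 0 ≤ q) (hF : 0 ≤ F) (hsmall : 8 * A ≤ m)
    (h : m * (x ^ 2 + y ^ 2) ≤ A * ((q + y) * y) + A * ((p + x) * x) + A * ((p + x) * x) +
      A * (F * x)) : x + y ≤ 4 * (q + 2 * p + F) / m * A := by
  rcases eq_or_lt_of_le (add_nonneg hx hy) with h0 | h0
  · rw [← h0]; positivity
  have h1 : m / 4 * (x + y) * (x + y) ≤ A * (q + 2 * p + F) * (x + y) := by
    have e1 : 0 ≤ A * q * x := by positivity
    have e2 : 0 ≤ A * p * y := by positivity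
    have e3 : 0 ≤ A * F * y := by positivity
    have e4 : 8 * A * (x ^ 2 + y ^ 2) ≤ m * (x ^ 2 + y ^ 2) :=
      mul_le_mul_of_nonneg_right hsmall (by positivity)
    have e5 : 0 ≤ m * (x - y) ^ 2 := by positivity
    have e6 : 0 ≤ A * y ^ 2 := by positivity
    have e7 : 0 ≤ m * (x ^ 2 + y ^ 2) := by positivity
    nlinarith
  have h2 := le_of_mul_le_mul_right h1 h0
  rw [div_mul_eq_mul_div, le_div_iff₀ hm]
  linarith

section Transported

variable {d : Data} {γ : ℝ} {K ω : Set E3} {T S : E3 → E3} {s D m L : ℝ}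
  {E c u cu U W : Field}

/-- The state equation of the transported domain on the fixed domain. -/
theorem transported_state_eq (h : IsLipEquiv K T S) (hd : d.Admissible) (hK : K ⊆ d.B)
    (hdet : ∀ᵐ x, 0 < (fderiv ℝ T x).det) (hω : MeasurableSet ω) (hs : ω ⊆ d.Ω)
    (hU : d.IsState γ (T '' ω) U) (hu : IsTransport d.Ω T u cu U W) {v w : Field}
    (hv : H0Pair d.Ω v w) :
    (∫ x in d.Ω, ⟪d.reluctivityT T x (cu x), w x⟫_ℝ) +
        (∫ x in d.Ω, ⟪d.permittivityT T x (u x), v x⟫_ℝ) +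
        (∫ x in ω, ⟪d.LamT γ T x (u x), v x⟫_ℝ) = ∫ x in d.Ω, ⟪d.sourceT T x, v x⟫_ℝ := by
  have hV := h.isTransport_covariant (hK.trans hd.subset) hd.isOpen_Ω hd.bounded hv
  have := hU.2 _ (hV.h0'.memH0curl hd.isOpen_Ω)
  rw [hd.a_eq hu.h0' hV.h0', hu.integral_reluctivity hV hd h hK hdet,
    hu.integral_permittivity hV hd h hK hdet, hu.integral_Lam hV h hdet hω hs,
    hV.integral_source hd h hK hdet] at this
  exact this

/-- Both equations are tested with `u - E`. Strong monotonicity bounds the squared error by the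
effect of the `D * s` perturbation of the coefficients acting on `u`, whose norm is at most that of
`E` plus the error itself; this is why the perturbation must be small for absorption. -/
theorem transported_state_sub_le (h : IsLipEquiv K T S) (hd : d.Admissible) (hγ : 0 < γ)
    (hK : K ⊆ d.B)
    (hdet : ∀ᵐ x, 0 < (fderiv ℝ T x).det) (hω : MeasurableSet ω) (hs : ω ⊆ d.Ω) (hs0 : 0 ≤ s)
    (hD : 0 ≤ D) (hc : ∀ᵐ x ∂(volume.restrict d.Ω), CoeffNearAt d γ T s D x)
    (hm : 0 < m) (hν : IsMonotoneOp (volume.restrict d.Ω) (fun x a => d.ν x a) m L)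
    (hop : IsMonotoneOp (volume.restrict d.Ω) (d.stateOp γ ω) m L)
    (hE : d.IsState γ ω E) (hE0 : H0Pair d.Ω E c)
    (hU : d.IsState γ (T '' ω) U) (hu : IsTransport d.Ω T u cu U W) (hsmall : 8 * (D * s) ≤ m) :
    l2 (volume.restrict d.Ω) (u - E) + l2 (volume.restrict d.Ω) (cu - c) ≤
      4 * (l2 (volume.restrict d.Ω) c + 2 * l2 (volume.restrict d.Ω) E +
        l2 (volume.restrict d.Ω) (fun x => ‖d.f x‖ + 1)) / m * (D * s) := by
  have := hd.isFiniteMeasure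
  have hδ : H0Pair d.Ω (u - E) (cu - c) := hu.h0.sub hE0
  have hDs : 0 ≤ D * s := mul_nonneg hD hs0
  have f1 : MemLp (fun x => ‖d.f x‖ + 1) 2 (volume.restrict d.Ω) :=
    hd.source.1.norm.add (memLp_const 1)
  have stab := hop.stability hν hu.h0.1 hE0.1 hu.h0.2.1 hE0.2.1
  rw [(hd.isState_iff hγ hω hs hE0).1 hE _ _ hδ,
    hd.integral_stateOp hγ hω hs hu.h0.1 hδ.1] at stab
  have eq := transported_state_eq h hd hK hdet hω hs hU hu hδ
  have r1 := abs_integral_sub_le_l2 hDs hu.h0.2.1 hδ.2.1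
    (integrable_inner (hd.memLp_reluctivity hu.h0.2.1) hδ.2.1)
    (integrable_inner (memLp_reluctivityT h hd hK hc hu.h0.2.1) hδ.2.1)
    (hc.mono fun x hx => abs_inner_sub_inner_le (by
      rw [norm_sub_rev, ← _root_.sub_apply]
      exact (d.reluctivityT T x - d.ν x).le_of_opNorm_le hx.reluctivity_sub _))
  have r2 := abs_integral_sub_le_l2 hDs hu.h0.1 hδ.1
    (integrable_inner (hd.memLp_permittivity hu.h0.1) hδ.1)
    (integrable_inner (memLp_permittivityT h hd hK hdet hc hu.h0.1) hδ.1)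
    (hc.mono fun x hx => abs_inner_sub_inner_le (by
      rw [norm_sub_rev, ← _root_.sub_apply]
      exact (d.permittivityT T x - d.ε x).le_of_opNorm_le hx.permittivity_sub _))
  have mΛ : MemLp (fun x => Lam d.jc γ (u x)) 2 (volume.restrict d.Ω) :=
    memLp_of_norm_le (C := 2 * (d.jc * γ)) hu.h0.1
      ((continuous_Lam hγ).comp_aestronglyMeasurable hu.h0.1.1)
      (ae_of_all _ fun x => norm_Lam_le hd.jc_pos hγ (u x))
  have r3 := abs_integral_sub_le_l2 hDs hu.h0.1 hδ.1
    (integrable_chi_mul hω (integrable_inner mΛ hδ.1))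
    (integrable_chi_mul hω (integrable_inner (memLp_LamT hγ hdet hc hu.h0.1) hδ.1))
    (hc.mono fun x hx => by
      rw [← mul_sub, abs_mul]
      refine (mul_le_of_le_one_left (abs_nonneg _) (norm_chi_le_one ω x)).trans
        (abs_inner_sub_inner_le ?_)
      rw [norm_sub_rev]
      exact hx.Lam_sub _)
  rw [setIntegral_chi_mul hω hs fun x => ⟪Lam d.jc γ (u x), (u - E) x⟫_ℝ,
    setIntegral_chi_mul hω hs fun x => ⟪d.LamT γ T x (u x), (u - E) x⟫_ℝ] at r3
  have r4 := abs_integral_sub_le_l2 hDs f1 hδ.1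
    (integrable_inner (memLp_sourceT h hd hK hdet hc) hδ.1)
    (integrable_inner hd.source.1 hδ.1)
    (hc.mono fun x hx => abs_inner_sub_inner_le (by
      rw [Real.norm_of_nonneg (by positivity)]
      exact hx.source_sub))
  have lu : l2 (volume.restrict d.Ω) u ≤
      l2 (volume.restrict d.Ω) E + l2 (volume.restrict d.Ω) (u - E) := by
    have := l2_add_le hE0.1 hδ.1
    rwa [add_sub_cancel] at this
  have lc : l2 (volume.restrict d.Ω) cu ≤
      l2 (volume.restrict d.Ω) c + l2 (volume.restrict d.Ω) (cu - c) := by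
    have := l2_add_le hE0.2.1 hδ.2.1
    rwa [add_sub_cancel] at this
  have n1 := l2_nonneg (μ := volume.restrict d.Ω) (u - E)
  have n2 := l2_nonneg (μ := volume.restrict d.Ω) (cu - c)
  refine le_of_sq_le hm n1 n2 hDs (l2_nonneg _) (l2_nonneg _) (l2_nonneg _) hsmall ?_
  have b1 := mul_le_mul_of_nonneg_left (mul_le_mul_of_nonneg_right lc n2) hDs
  have b2 := mul_le_mul_of_nonneg_left (mul_le_mul_of_nonneg_right lu n1) hDs
  have q1 := (abs_le.1 r1).2
  have q2 := (abs_le.1 r2).2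
  have q3 := (abs_le.1 r3).2
  have q4 := (abs_le.1 r4).2
  linarith

end Transported

end HTS

namespace HTS

open Data

/-! ### The Lagrangian at the transported states -/

section L2

variable {α F : Type*} [MeasurableSpace α] {μ : Measure α} [NormedAddCommGroup F]

theorem l2_const_mul_norm (f : α → F) {c : ℝ} (hc : 0 ≤ c) :
    l2 μ (fun x => c * ‖f x‖) = c * l2 μ f := by
  have : (fun x => c * ‖f x‖) = c • fun x => ‖f x‖ := rfl
  rw [l2, l2, this, eLpNorm_const_smul, eLpNorm_norm, ENNReal.toReal_mul, toReal_enorm,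
    Real.norm_of_nonneg hc]

theorem l2_mono_measure {ν : Measure α} (h : ν ≤ μ) {f : α → F} (hf : MemLp f 2 μ) :
    l2 ν f ≤ l2 μ f :=
  ENNReal.toReal_mono hf.2.ne (eLpNorm_mono_measure f h)

end L2

/-- The remainder of the transported nonlinearity is small compared to its increments. -/
theorem tendsto_Lam_remainder {jc γ : ℝ} (hγ : 0 < γ) {t b : ℕ → ℝ} {A : ℕ → Tensor}
    {D : ℝ} (hD : 0 ≤ D) (ht : ∀ n, 0 ≤ t n) (ht1 : ∀ n, t n ≤ 1) (h0 : Tendsto t atTop (𝓝 0))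
    (hA : ∀ n, ‖A n - 1‖ ≤ D * t n) (hb : Tendsto b atTop (𝓝 1)) (a : E3) {δ : ℕ → E3}
    (hδ : Tendsto δ atTop (𝓝 0)) :
    Tendsto (fun n => ‖b n • transp (A n) (Lam jc γ (A n (a + δ n))) -
      b n • transp (A n) (Lam jc γ (A n a)) - psi jc γ a (δ n)‖ / (t n * ‖a‖ + ‖δ n‖))
      atTop (𝓝 0) := by
  set g : ℕ → ℝ := fun n => t n * ‖a‖ + ‖δ n‖ with hg
  have hg0 : ∀ n, 0 ≤ g n := fun n => by have := ht n; positivity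
  have hA1 : Tendsto A atTop (𝓝 1) := by
    rw [tendsto_iff_norm_sub_tendsto_zero]
    have := h0.const_mul D
    rw [mul_zero] at this
    exact squeeze_zero (fun _ => norm_nonneg _) hA this
  -- `Lam` is differentiable at the single point `a`, so both `A n (a + δ n)` and `A n a` are
  -- expanded there. Their distance to `a` is of order `t n * ‖a‖ + ‖δ n‖`, which explains the
  -- denominator; the two cases are `η = δ` and `η = 0`.
  have step : ∀ {η : ℕ → E3}, (∀ n, ‖η n‖ ≤ ‖δ n‖) → Tendsto η atTop (𝓝 0) →
      (fun n => Lam jc γ (A n (a + η n)) - Lam jc γ a - psi jc γ a (A n (a + η n) - a))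
        =o[atTop] g := by
    intro η hη hη0
    have h1 : Tendsto (fun n => A n (a + η n)) atTop (𝓝 a) := by
      have h2 : Tendsto (fun n => a + η n) atTop (𝓝 a) := by
        simpa using hη0.const_add a
      exact tendsto_apply hA1 h2
    have h2 : (fun n => A n (a + η n) - a) =O[atTop] g := by
      refine Asymptotics.IsBigO.of_bound (2 * D + 1) (Eventually.of_forall fun n => ?_)
      have e : A n (a + η n) - a = (A n - 1) (a + η n) + η n := by
        rw [_root_.sub_apply, tensor_one_apply]; abel
      rw [e, Real.norm_of_nonneg (hg0 n)]
      have k1 := (A n - 1).le_of_opNorm_le (hA n) (a + η n)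
      have k2 := norm_add_le a (η n)
      have k3 := hη n
      have k4 : D * t n * ‖a + η n‖ ≤ D * t n * (‖a‖ + ‖δ n‖) :=
        mul_le_mul_of_nonneg_left (by linarith) (mul_nonneg hD (ht n))
      have k5 : D * t n * ‖δ n‖ ≤ D * ‖δ n‖ :=
        mul_le_mul_of_nonneg_right (mul_le_of_le_one_right hD (ht1 n)) (norm_nonneg _)
      have k6 : 0 ≤ D * (t n * ‖a‖) := by have := ht n; positivity
      have k7 : 0 ≤ t n * ‖a‖ := by have := ht n; positivity
      have k8 : 0 ≤ D * ‖δ n‖ := by positivity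
      refine (norm_add_le _ _).trans ?_
      simp only [hg]
      linarith
    exact ((hasFDerivAt_Lam hγ a).isLittleO.comp_tendsto h1).trans_isBigO h2
  have s1 := step (fun _ => le_rfl) hδ
  have s2 := step (η := fun _ => 0) (fun n => by simp) tendsto_const_nhds
  have s3 := s1.sub s2
  have hB : Tendsto (fun n => b n • transp (A n)) atTop (𝓝 1) := by
    have h1 : Tendsto (fun n => transp (A n)) atTop (𝓝 1) := by
      have := (transpL.continuous.tendsto 1).comp hA1
      rw [transpL_apply, transp_one] at this
      exact this
    have := hb.smul h1
    rwa [one_smul] at this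
  have s4 : (fun n => (b n • transp (A n)) (Lam jc γ (A n (a + δ n)) - Lam jc γ (A n a) -
      psi jc γ a (A n (δ n)))) =o[atTop] g := by
    refine Asymptotics.IsBigO.trans_isLittleO ?_ s3
    refine Asymptotics.IsBigO.of_bound 2 ?_
    have h1 := hB.norm.eventually (eventually_le_nhds
      (lt_of_le_of_lt ContinuousLinearMap.norm_id_le one_lt_two))
    filter_upwards [h1] with n hn
    refine ((b n • transp (A n)).le_of_opNorm_le hn _).trans (le_of_eq ?_)
    congr 2
    simp only [add_zero, map_sub, map_add]
    abel
  -- What remains is the conjugation of the derivative by factors tending to the identity: an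
  -- operator of norm o(1) applied to `δ n`.
  have s5 : (fun n => ((b n • transp (A n)) * psi jc γ a * A n - psi jc γ a) (δ n))
      =o[atTop] g := by
    have h1 : Tendsto (fun n => (b n • transp (A n)) * psi jc γ a * A n - psi jc γ a) atTop
        (𝓝 0) := by
      have := ((hB.mul_const (psi jc γ a)).mul hA1).sub_const (psi jc γ a)
      rwa [one_mul, mul_one, sub_self] at this
    have h2 : (fun n => ‖(b n • transp (A n)) * psi jc γ a * A n - psi jc γ a‖ * ‖δ n‖)
        =o[atTop] fun n => (1 : ℝ) * g n := by
      have h3 := h1.norm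
      rw [norm_zero] at h3
      refine ((Asymptotics.isLittleO_one_iff ℝ).2 h3).mul_isBigO
        (Asymptotics.IsBigO.of_bound 1 (Eventually.of_forall fun n => ?_))
      have := ht n
      rw [norm_norm, Real.norm_of_nonneg (hg0 n), one_mul]
      exact le_add_of_nonneg_left (by positivity)
    simp only [one_mul] at h2
    refine Asymptotics.IsBigO.trans_isLittleO (Asymptotics.IsBigO.of_bound 1
      (Eventually.of_forall fun n => ?_)) h2
    rw [norm_mul, norm_norm, norm_norm, one_mul]
    exact ContinuousLinearMap.le_opNorm _ _
  have s6 := s4.add s5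
  have s7 := s6.norm_left.tendsto_div_nhds_zero
  refine s7.congr fun n => ?_
  congr 2
  simp only [_root_.sub_apply, _root_.smul_apply, tensor_mul_apply, map_sub]
  abel

section Remainder

variable {d : Data} {γ : ℝ} {K ω : Set E3} {C M : ℝ} {θ : Field} {t : ℕ → ℝ} {T : ℕ → E3 → E3}
  {E P c w : Field} {D : ℝ} {u : ℕ → Field}

theorem norm_LamT_sub_le {T : E3 → E3} {x : E3} {s : ℝ} (hd : d.Admissible) (hγ : 0 < γ)
    (hD : 0 ≤ D) (h : CoeffNearAt d γ T s D x) (a a' : E3) :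
    ‖d.LamT γ T x a - d.LamT γ T x a'‖ ≤ D * (D * (2 * (d.jc * γ) * D)) * ‖a - a'‖ := by
  have hj : 0 ≤ d.jc * γ := mul_nonneg hd.jc_pos.le hγ.le
  rw [LamT, LamT, ← smul_sub, ← map_sub, norm_smul, Real.norm_eq_abs]
  have h1 := (invTransp (fderiv ℝ T x)).le_of_opNorm_le h.invTransp (a - a')
  have h2 := norm_Lam_sub_le hd.jc_pos hγ (invTransp (fderiv ℝ T x) a)
    (invTransp (fderiv ℝ T x) a')
  rw [← map_sub] at h2
  have h3 := (transp (invTransp (fderiv ℝ T x))).le_of_opNorm_le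
    ((norm_transp _).trans_le h.invTransp) (Lam d.jc γ (invTransp (fderiv ℝ T x) a) -
      Lam d.jc γ (invTransp (fderiv ℝ T x) a'))
  calc _ ≤ D * (D * (2 * (d.jc * γ) * (D * ‖a - a'‖))) := by
        refine mul_le_mul h.det (h3.trans ?_) (norm_nonneg _) hD
        refine mul_le_mul_of_nonneg_left (h2.trans ?_) hD
        exact mul_le_mul_of_nonneg_left h1 (by positivity)
    _ = _ := by ring

/-- The nonlinear part of the remainder. -/
theorem NearIdSeq.tendsto_integral_Lam_remainder (h : NearIdSeq d.B K C M θ t T)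
    (hd : d.Admissible) (hγ : 0 < γ) (hω : MeasurableSet ω) (hs : ω ⊆ d.Ω)
    (hE : MemLp E 2 (volume.restrict d.Ω)) (hP : MemLp P 2 (volume.restrict d.Ω))
    (hu : ∀ n, MemLp (u n) 2 (volume.restrict d.Ω)) {X : ℝ}
    (hX : ∀ n, l2 (volume.restrict d.Ω) (u n - E) ≤ X * t n) :
    Tendsto (fun n => (t n)⁻¹ * (((∫ x in ω, ⟪d.LamT γ (T n) x (u n x), P x⟫_ℝ) -
      ∫ x in ω, ⟪d.LamT γ (T n) x (E x), P x⟫_ℝ) -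
      ∫ x in ω, ⟪psi d.jc γ (E x) (P x), (u n - E) x⟫_ℝ)) atTop (𝓝 0) := by
  obtain ⟨D, hD, hc⟩ := h.exists_coeffNearAt hd hγ
  obtain ⟨D', hD', hex⟩ := h.exists_expands_coeff hd hγ
  have hj : 0 ≤ d.jc * γ := mul_nonneg hd.jc_pos.le hγ.le
  set μ := volume.restrict d.Ω with hμ
  have hδ : ∀ n, MemLp (u n - E) 2 μ := fun n => (hu n).sub hE
  let r : ℕ → Field := fun n x => d.LamT γ (T n) x (u n x) - d.LamT γ (T n) x (E x) -
    psi d.jc γ (E x) ((u n - E) x)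
  let g : ℕ → E3 → ℝ := fun n x => t n * ‖E x‖ + ‖(u n - E) x‖
  -- Factoring the remainder as `q * g` separates two roles: `g` has L² norm O(t), while `q` is
  -- uniformly bounded and tends to zero along almost everywhere convergent subsequences, so that `q
  -- • P` tends to zero in L² with a fixed multiple of `‖P‖` as dominating function.
  let q : ℕ → E3 → ℝ := fun n x => ‖r n x‖ / g n x
  have hg0 : ∀ n x, 0 ≤ g n x := fun n x => by have := (h.pos n).le; positivity
  have mψ : MemLp (fun x => psi d.jc γ (E x) (P x)) 2 μ :=
    memLp_of_norm_le (C := 2 * (d.jc * γ)) hP (aestronglyMeasurable_apply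
      ((measurable_psi hγ).comp_aemeasurable hE.1.aemeasurable).aestronglyMeasurable hP.1)
      (ae_of_all _ fun x => norm_psi_apply_le hd.jc_pos hγ _ _)
  have mΛu := fun n => memLp_LamT hγ (h.ae_det_pos n) (hc n) (hu n)
  have mΛE := fun n => memLp_LamT hγ (h.ae_det_pos n) (hc n) hE
  have mψδ : ∀ n, AEStronglyMeasurable (fun x => psi d.jc γ (E x) ((u n - E) x)) μ := fun n =>
    aestronglyMeasurable_apply
      ((measurable_psi hγ).comp_aemeasurable hE.1.aemeasurable).aestronglyMeasurable (hδ n).1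
  have mr : ∀ n, AEStronglyMeasurable (r n) μ := fun n =>
    ((mΛu n).1.sub (mΛE n).1).sub (mψδ n)
  have mg : ∀ n, MemLp (g n) 2 μ := fun n => (hE.norm.const_mul _).add (hδ n).norm
  set C' := D * (D * (2 * (d.jc * γ) * D)) + 2 * (d.jc * γ) with hC'
  have hC'0 : 0 ≤ C' := by positivity
  have hr : ∀ n, ∀ᵐ x ∂μ, ‖r n x‖ ≤ C' * ‖(u n - E) x‖ := fun n =>
    (hc n).mono fun x hx => by
      refine (norm_sub_le _ _).trans ?_
      rw [hC', add_mul]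
      exact add_le_add (norm_LamT_sub_le hd hγ hD hx _ _) (norm_psi_apply_le hd.jc_pos hγ _ _)
  have hrq : ∀ n, ∀ᵐ x ∂μ, ‖r n x‖ = q n x * g n x := fun n => (hr n).mono fun x hx => by
    -- Where the denominator vanishes, `u n = E` and the remainder vanishes as well, so the
    -- convention for division by zero is harmless.
    rcases eq_or_ne (g n x) 0 with h0 | h0
    · have h1 : ‖(u n - E) x‖ ≤ 0 := by
        rw [← h0]
        have := (h.pos n).le
        exact le_add_of_nonneg_left (by positivity)
      rw [h0, mul_zero]
      nlinarith [norm_nonneg (r n x), norm_nonneg ((u n - E) x)]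
    · exact (div_mul_cancel₀ _ h0).symm
  have hq0 : ∀ n x, 0 ≤ q n x := fun n x => div_nonneg (norm_nonneg _) (hg0 n x)
  have hqC : ∀ n, ∀ᵐ x ∂μ, q n x ≤ C' := fun n => (hr n).mono fun x hx => by
    refine div_le_of_le_mul₀ (hg0 n x) hC'0 (hx.trans ?_)
    have := (h.pos n).le
    exact mul_le_mul_of_nonneg_left (le_add_of_nonneg_left (by positivity)) hC'0
  have mq : ∀ n, AEStronglyMeasurable (q n) μ := fun n =>
    ((mr n).norm.aemeasurable.div (mg n).1.aemeasurable).aestronglyMeasurable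
  have mqP : ∀ n, MemLp (fun x => q n x • P x) 2 μ := fun n =>
    memLp_of_norm_le (C := C') hP ((mq n).smul hP.1) ((hqC n).mono fun x hx => by
      rw [norm_smul, Real.norm_of_nonneg (hq0 n x)]
      exact mul_le_mul_of_nonneg_right hx (norm_nonneg _))
  -- the weighted quotient tends to zero
  have hlim : Tendsto (fun n => l2 μ fun x => q n x • P x) atTop (𝓝 0) := by
    -- L² convergence of the states gives pointwise convergence only along subsequences; it suffices
    -- that every subsequence has a further one with the desired limit.
    refine tendsto_of_subseq_tendsto fun ns hns => ?_
    have hmeas : TendstoInMeasure μ (fun n => u (ns n) - E) atTop (fun _ => (0 : E3)) := by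
      refine tendstoInMeasure_of_tendsto_eLpNorm two_ne_zero (fun n => (hδ (ns n)).1)
        aestronglyMeasurable_const ?_
      have h1 : Tendsto (fun n => l2 μ (u (ns n) - E)) atTop (𝓝 0) := by
        have h2 := (h.lim.comp hns).const_mul X
        rw [mul_zero] at h2
        exact squeeze_zero (fun n => l2_nonneg _) (fun n => hX (ns n)) h2
      have h3 := ENNReal.tendsto_ofReal h1
      rw [ENNReal.ofReal_zero] at h3
      refine h3.congr fun n => ?_
      rw [← eLpNorm_eq_l2 (hδ (ns n))]
      congr 1
      funext x
      simp
    obtain ⟨ms, hms, hae⟩ := hmeas.exists_seq_tendsto_ae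
    have hns' := hns.comp hms.tendsto_atTop
    refine ⟨ms, tendsto_l2_zero (h := fun x => C' * ‖P x‖) (hP.norm.const_mul C')
      (fun n => (mqP (ns (ms n))).1) (fun n => (hqC (ns (ms n))).mono fun x hx => ?_) ?_⟩
    · rw [norm_smul, Real.norm_of_nonneg (hq0 (ns (ms n)) x)]
      exact mul_le_mul_of_nonneg_right hx (norm_nonneg _)
    · filter_upwards [hae, hex] with x hx ⟨ed, eA, _⟩
      have key := tendsto_Lam_remainder (jc := d.jc) hγ hD' (fun n => (h.pos (ns (ms n))).le)
        (fun n => h.le_one (ns (ms n))) (h.lim.comp hns') (fun n => eA.near (ns (ms n)))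
        ((ed.tendsto h.lim).comp hns') (E x) hx
      have h2 : Tendsto (fun n => q (ns (ms n)) x) atTop (𝓝 0) := by
        refine key.congr fun n => ?_
        simp only [q, r, g, LamT, Pi.sub_apply, add_sub_cancel, Function.comp_apply]
      have h3 := h2.smul_const (P x)
      rwa [zero_smul] at h3
  have hbound : ∀ n, |((∫ x in ω, ⟪d.LamT γ (T n) x (u n x), P x⟫_ℝ) -
      ∫ x in ω, ⟪d.LamT γ (T n) x (E x), P x⟫_ℝ) -
      ∫ x in ω, ⟪psi d.jc γ (E x) (P x), (u n - E) x⟫_ℝ| ≤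
      1 * (l2 μ (g n) * l2 μ fun x => q n x • P x) := fun n => by
    have i1 := integrable_chi_mul hω (integrable_inner (mΛu n) hP)
    have i2 := integrable_chi_mul hω (integrable_inner (mΛE n) hP)
    have i3 := integrable_chi_mul hω (integrable_inner mψ (hδ n))
    rw [← setIntegral_chi_mul hω hs fun x => ⟪d.LamT γ (T n) x (u n x), P x⟫_ℝ,
      ← setIntegral_chi_mul hω hs fun x => ⟪d.LamT γ (T n) x (E x), P x⟫_ℝ,
      ← setIntegral_chi_mul hω hs fun x => ⟪psi d.jc γ (E x) (P x), (u n - E) x⟫_ℝ,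
      ← integral_sub i1 i2]
    refine abs_integral_sub_le_l2 zero_le_one (mg n) (mqP n) (i1.sub i2) i3 ?_
    filter_upwards [hrq n] with x hx
    have e1 : chi ω x * ⟪d.LamT γ (T n) x (u n x), P x⟫_ℝ -
        chi ω x * ⟪d.LamT γ (T n) x (E x), P x⟫_ℝ -
        chi ω x * ⟪psi d.jc γ (E x) (P x), (u n - E) x⟫_ℝ = chi ω x * ⟪r n x, P x⟫_ℝ := by
      have e2 : ⟪psi d.jc γ (E x) (P x), (u n - E) x⟫_ℝ =
          ⟪psi d.jc γ (E x) ((u n - E) x), P x⟫_ℝ := by rw [inner_psi_comm, real_inner_comm]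
      simp only [r, inner_sub_left, e2]
      ring
    rw [e1, abs_mul, one_mul, norm_smul, Real.norm_of_nonneg (hg0 n x),
      Real.norm_of_nonneg (hq0 n x)]
    refine (mul_le_of_le_one_left (abs_nonneg _) (norm_chi_le_one ω x)).trans
      ((abs_real_inner_le_norm _ _).trans (le_of_eq ?_))
    rw [hx]
    ring
  have hgl : ∀ n, l2 μ (g n) ≤ (l2 μ E + X) * t n := fun n => by
    have h1 := l2_add_le (hE.norm.const_mul (t n)) (hδ n).norm
    have h2 := l2_const_mul_norm (μ := μ) E (h.pos n).le
    have h3 : l2 μ (fun x => ‖(u n - E) x‖) = l2 μ (u n - E) := by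
      have := l2_const_mul_norm (μ := μ) (u n - E) zero_le_one
      simpa only [one_mul] using this
    rw [h2, h3] at h1
    have := hX n
    refine h1.trans ?_
    linarith
  have hfin := hlim.const_mul (l2 μ E + X)
  rw [mul_zero] at hfin
  refine squeeze_zero_norm (fun n => ?_) hfin
  rw [norm_mul, norm_inv, Real.norm_of_nonneg (h.pos n).le, inv_mul_le_iff₀ (h.pos n)]
  refine (hbound n).trans ?_
  rw [one_mul]
  refine (mul_le_mul_of_nonneg_right (hgl n) (l2_nonneg _)).trans (le_of_eq (by ring))

end Remainder

end HTS

/-! ### Cancellation by the adjoint equation, and difference quotients along sequences. -/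

namespace HTS

open Data

namespace NearIdSeq

variable {d : Data} {γ : ℝ} {K ω : Set E3} {C M : ℝ} {θ : Field} {t : ℕ → ℝ} {T : ℕ → E3 → E3}
  {E P c w : Field} {u cu : ℕ → Field}

/-- The first variation of the transported tracking density at `a` in direction `z` is O(t)-close to
the original one. The quantifiers over `a` and `z` stay inside the almost everywhere statement, so
fields can be substituted. -/
theorem exists_misfit_near (h : NearIdSeq d.B K C M θ t T) (hd : d.Admissible) (hγ : 0 < γ) :
    ∃ D : ℝ, 0 ≤ D ∧ ∀ n, ∀ᵐ x ∂(volume.restrict d.B), ∀ a z : E3,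
      |d.weightT (T n) x * ⟪invTransp (fderiv ℝ (T n) x) a - d.Ed (T n x),
          invTransp (fderiv ℝ (T n) x) z⟫_ℝ - d.κ x * ⟪a - d.Ed x, z⟫_ℝ| ≤
        D * t n * ((‖a‖ + 1) * ‖z‖) := by
  obtain ⟨D, hD, hex⟩ := h.exists_expands_coeff hd hγ
  have ht' := fun n => (h.pos n).le
  -- The product rules give `8 * D ^ 3 * (2 * ‖a‖ + 1) * ‖z‖`.
  refine ⟨16 * D ^ 3, by positivity, fun n => ?_⟩
  filter_upwards [ae_restrict_of_ae_restrict_of_subset hd.subset hex,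
    ae_restrict_mem hd.isOpen_B.measurableSet] with x ⟨_, eA, _, _, _, _, eB⟩ hx a z
  obtain ⟨eκ, eEd⟩ := eB hx
  have ey := (eA.apply (Expands.const ht' a) h.pos h.lim).sub eEd
  have ez := eA.apply (Expands.const ht' z) h.pos h.lim
  have := (eκ.mul (ey.inner ez h.pos h.lim) h.pos h.lim).near n
  refine this.trans ?_
  have n1 : 0 ≤ D ^ 3 * ‖z‖ * t n := mul_nonneg (by positivity) (ht' n)
  linarith

/-- The misfit is affine in the field, so the expansion about `E` is exact: a linear term, compared
with the untransported one at cost O(t), and a term quadratic in `u - E`. -/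
theorem abs_tracking_remainder_le {T : E3 → E3} {S : E3 → E3} {s D D' : ℝ} {u : Field}
    (h : IsLipEquiv K T S) (hd : d.Admissible) (hK : K ⊆ d.B)
    (hdet : ∀ᵐ x, 0 < (fderiv ℝ T x).det) (hD : 0 ≤ D) (hD' : 0 ≤ D') (hs : 0 ≤ s)
    (hc : ∀ᵐ x ∂(volume.restrict d.Ω), CoeffNearAt d γ T s D x)
    (hnear : ∀ᵐ x ∂(volume.restrict d.B), ∀ a z : E3,
      |d.weightT T x * ⟪invTransp (fderiv ℝ T x) a - d.Ed (T x),
          invTransp (fderiv ℝ T x) z⟫_ℝ - d.κ x * ⟪a - d.Ed x, z⟫_ℝ| ≤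
        D' * s * ((‖a‖ + 1) * ‖z‖))
    (hE : MemLp E 2 (volume.restrict d.Ω)) (hu : MemLp u 2 (volume.restrict d.Ω)) :
    |1 / 2 * (∫ x in d.B, d.weightT T x * ‖d.misfitT T u x‖ ^ 2) -
      1 / 2 * (∫ x in d.B, d.weightT T x * ‖d.misfitT T E x‖ ^ 2) -
      ∫ x in d.B, d.κ x * ⟪E x - d.Ed x, (u - E) x⟫_ℝ| ≤
    D' * s * (l2 (volume.restrict d.Ω) (fun x => ‖E x‖ + 1) *
        l2 (volume.restrict d.Ω) (u - E)) +
      D ^ 3 * (l2 (volume.restrict d.Ω) (u - E) * l2 (volume.restrict d.Ω) (u - E)) := by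
  have := hd.isFiniteMeasure
  have := hd.isFiniteMeasure_B
  set μ := volume.restrict d.B with hμ
  have hle : μ ≤ volume.restrict d.Ω := Measure.restrict_mono hd.subset le_rfl
  have hδ : MemLp (u - E) 2 (volume.restrict d.Ω) := hu.sub hE
  have hEB := hd.memLp_restrict_B hE
  have hδB := hd.memLp_restrict_B hδ
  have hcB : ∀ᵐ x ∂μ, x ∈ d.B ∧ CoeffNearAt d γ T s D x :=
    (ae_restrict_mem hd.isOpen_B.measurableSet).and
      (ae_restrict_of_ae_restrict_of_subset hd.subset hc)
  have hF : MemLp (fun x => ‖E x‖ + 1) 2 μ := hEB.norm.add (memLp_const 1)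
  have hFΩ : MemLp (fun x => ‖E x‖ + 1) 2 (volume.restrict d.Ω) := hE.norm.add (memLp_const 1)
  have mw := h.aestronglyMeasurable_weightT hd hK
  have hy : MemLp (d.misfitT T E) 2 μ := by
    refine hF.of_le_mul (c := D) (h.aestronglyMeasurable_misfitT hd hK hdet hEB.1)
      (hcB.mono fun x hx => ?_)
    rw [Real.norm_of_nonneg (by positivity), mul_add, mul_one]
    exact (norm_sub_le _ _).trans (add_le_add
      ((invTransp (fderiv ℝ T x)).le_of_opNorm_le hx.2.invTransp _) (hx.2.target hx.1))
  have hz : MemLp (fun x => invTransp (fderiv ℝ T x) ((u - E) x)) 2 μ :=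
    memLp_of_norm_le (C := D) hδB
      (aestronglyMeasurable_apply (IsLipEquiv.aestronglyMeasurable_invTransp hdet) hδB.1)
      (hcB.mono fun x hx => (invTransp (fderiv ℝ T x)).le_of_opNorm_le hx.2.invTransp _)
  have hwint : ∀ {y z : Field}, MemLp y 2 μ → MemLp z 2 μ →
      Integrable (fun x => d.weightT T x * ⟪y x, z x⟫_ℝ) μ := fun hy hz =>
    integrable_of_abs_le (C := D) hy hz (mw.mul (hy.1.inner hz.1)) (hcB.mono fun x hx => by
      rw [abs_mul]
      exact mul_le_mul (hx.2.weight hx.1) (abs_real_inner_le_norm _ _) (abs_nonneg _) hD)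
  have i1 := hwint hy hy
  have i2 := hwint hy hz
  have i3 := hwint hz hz
  have i4 : Integrable (fun x => d.κ x * ⟪E x - d.Ed x, (u - E) x⟫_ℝ) μ :=
    (integrable_inner (hd.memLp_misfit hE) hδB).congr
      (ae_of_all _ fun x => real_inner_smul_left _ _ _)
  have split : ∫ x in d.B, d.weightT T x * ‖d.misfitT T u x‖ ^ 2 =
      (∫ x in d.B, d.weightT T x * ‖d.misfitT T E x‖ ^ 2) +
      2 * (∫ x in d.B, d.weightT T x * ⟪d.misfitT T E x, invTransp (fderiv ℝ T x) ((u - E) x)⟫_ℝ) +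
      ∫ x in d.B, d.weightT T x * ⟪invTransp (fderiv ℝ T x) ((u - E) x),
        invTransp (fderiv ℝ T x) ((u - E) x)⟫_ℝ := by
    simp only [← real_inner_self_eq_norm_sq]
    have e := integral_add' (i1.add (i2.const_mul 2)) i3
    rw [integral_add' i1 (i2.const_mul 2), integral_const_mul] at e
    refine Eq.trans (integral_congr_ae (ae_of_all _ fun x => ?_)) e
    have e : d.misfitT T u x = d.misfitT T E x + invTransp (fderiv ℝ T x) ((u - E) x) := by
      simp only [misfitT, Pi.sub_apply, map_sub]
      abel
    simp only [e, inner_add_left, inner_add_right, Pi.add_apply]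
    rw [real_inner_comm (d.misfitT T E x) (invTransp (fderiv ℝ T x) ((u - E) x))]
    ring
  have b1 := abs_integral_sub_le_l2 (mul_nonneg hD' hs) hF hδB i2 i4 (hnear.mono fun x hx => by
    rw [Real.norm_of_nonneg (by positivity)]
    exact hx (E x) ((u - E) x))
  have b2 := abs_integral_le_l2 (by positivity : 0 ≤ D ^ 3) hδB hδB (hcB.mono fun x hx => by
    have h1 := (invTransp (fderiv ℝ T x)).le_of_opNorm_le hx.2.invTransp ((u - E) x)
    have h2 : |d.weightT T x * ⟪invTransp (fderiv ℝ T x) ((u - E) x),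
        invTransp (fderiv ℝ T x) ((u - E) x)⟫_ℝ| ≤
        D * ((D * ‖(u - E) x‖) * (D * ‖(u - E) x‖)) := by
      rw [abs_mul]
      refine mul_le_mul (hx.2.weight hx.1) ((abs_real_inner_le_norm _ _).trans ?_)
        (abs_nonneg _) hD
      exact mul_le_mul h1 h1 (norm_nonneg _) (by positivity)
    exact h2.trans (le_of_eq (by ring)))
  have l1 := l2_mono_measure hle hFΩ
  have l2' := l2_mono_measure hle hδ
  have p1 := mul_le_mul_of_nonneg_left (mul_le_mul l1 l2' (l2_nonneg _) (l2_nonneg _))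
    (mul_nonneg hD' hs)
  have p2 := mul_le_mul_of_nonneg_left (mul_le_mul l2' l2' (l2_nonneg _) (l2_nonneg _))
    (by positivity : 0 ≤ D ^ 3)
  have p3 : 0 ≤ D ^ 3 * (l2 μ (u - E) * l2 μ (u - E)) :=
    mul_nonneg (by positivity) (mul_nonneg (l2_nonneg _) (l2_nonneg _))
  rw [split]
  rw [abs_le] at b1 b2 ⊢
  constructor <;> linarith [b1.1, b1.2, b2.1, b2.2]

/-- Replacing the fixed state by the transported states does not change the derivative. -/
theorem tendsto_lagrangianT_sub (h : NearIdSeq d.B K C M θ t T) (hd : d.Admissible)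
    (hγ : 0 < γ) (hω : MeasurableSet ω) (hs : ω ⊆ d.B)
    (hE : H0Pair d.Ω E c) (hPa : d.IsAdjoint γ ω E P) (hP : H0Pair d.Ω P w)
    (hu : ∀ n, H0Pair d.Ω (u n) (cu n)) {X : ℝ}
    (hX : ∀ n, l2 (volume.restrict d.Ω) (u n - E) + l2 (volume.restrict d.Ω) (cu n - c) ≤
      X * t n) :
    Tendsto (fun n => (t n)⁻¹ * (d.lagrangianT γ ω (T n) (u n) (cu n) P w -
      d.lagrangianT γ ω (T n) E c P w)) atTop (𝓝 0) := by
  obtain ⟨D, hD, hc⟩ := h.exists_coeffNearAt hd hγ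
  obtain ⟨D', hD', hnear⟩ := h.exists_misfit_near hd hγ
  have hsΩ := hs.trans hd.subset
  have hδ : ∀ n, H0Pair d.Ω (u n - E) (cu n - c) := fun n => (hu n).sub hE
  set μ := volume.restrict d.Ω with hμ
  have hX1 : ∀ n, l2 μ (u n - E) ≤ X * t n := fun n => by
    linarith [hX n, l2_nonneg (μ := μ) (cu n - c)]
  have hX2 : ∀ n, l2 μ (cu n - c) ≤ X * t n := fun n => by
    linarith [hX n, l2_nonneg (μ := μ) (u n - E)]
  have hX0 : ∀ n, 0 ≤ X * t n := fun n => (l2_nonneg _).trans (hX1 n)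
  have nonl := h.tendsto_integral_Lam_remainder hd hγ hω hsΩ hE.1 hP.1 (fun n => (hu n).1) hX1
  -- The tracking and bilinear remainders are of second order, products of the O(t) error in the
  -- coefficients and the O(t) error in the state, or squares of the latter. The nonlinear term is
  -- only o(t) and is treated separately.
  have small : ∀ (f : ℕ → ℝ) (Q : ℝ), (∀ n, |f n| ≤ Q * (t n * t n)) →
      Tendsto (fun n => (t n)⁻¹ * f n) atTop (𝓝 0) := fun f Q hf => by
    have := h.lim.const_mul Q
    rw [mul_zero] at this
    refine squeeze_zero_norm (fun n => ?_) this
    rw [norm_mul, norm_inv, Real.norm_of_nonneg (h.pos n).le, inv_mul_le_iff₀ (h.pos n)]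
    exact (hf n).trans (le_of_eq (by ring))
  have t1 := small _ (D' * (l2 μ (fun x => ‖E x‖ + 1) * X) + D ^ 3 * (X * X)) fun n => by
    refine (abs_tracking_remainder_le (h.isLipEquiv n) hd h.subset (h.ae_det_pos n) hD hD'
      (h.pos n).le (hc n) (hnear n) hE.1 (hu n).1).trans ?_
    have n1 := l2_nonneg (μ := μ) fun x => ‖E x‖ + 1
    have p1 := mul_le_mul_of_nonneg_left (mul_le_mul_of_nonneg_left (hX1 n) n1)
      (mul_nonneg hD' (h.pos n).le)
    have p2 := mul_le_mul_of_nonneg_left (mul_le_mul (hX1 n) (hX1 n) (l2_nonneg _) (hX0 n))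
      (by positivity : 0 ≤ D ^ 3)
    linarith
  have t2 := small (fun n => (∫ x in d.Ω, ⟪d.reluctivityT (T n) x (cu n x), w x⟫_ℝ) -
      (∫ x in d.Ω, ⟪d.reluctivityT (T n) x (c x), w x⟫_ℝ) -
      ∫ x in d.Ω, ⟪d.ν x ((cu n - c) x), w x⟫_ℝ) (D * (X * l2 μ w)) fun n => by
    have m1 := memLp_reluctivityT (h.isLipEquiv n) hd h.subset (hc n) (hu n).2.1
    have m2 := memLp_reluctivityT (h.isLipEquiv n) hd h.subset (hc n) hE.2.1
    have i1 := integrable_inner m1 hP.2.1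
    have i2 := integrable_inner m2 hP.2.1
    have hDt := mul_nonneg hD (h.pos n).le
    rw [← integral_sub i1 i2]
    refine (abs_integral_sub_le_l2 hDt (hδ n).2.1 hP.2.1 (i1.sub i2)
      (integrable_inner (hd.memLp_reluctivity (hδ n).2.1) hP.2.1) ((hc n).mono fun x hx => ?_)).trans ?_
    · change |⟪d.reluctivityT (T n) x (cu n x), w x⟫_ℝ - ⟪d.reluctivityT (T n) x (c x), w x⟫_ℝ -
        ⟪d.ν x ((cu n - c) x), w x⟫_ℝ| ≤ _
      rw [← inner_sub_left]
      refine abs_inner_sub_inner_le ?_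
      rw [← map_sub, ← Pi.sub_apply, ← _root_.sub_apply]
      exact (d.reluctivityT (T n) x - d.ν x).le_of_opNorm_le hx.reluctivity_sub _
    · have := mul_le_mul_of_nonneg_left
        (mul_le_mul_of_nonneg_right (hX2 n) (l2_nonneg (μ := μ) w)) hDt
      linarith
  have t3 := small (fun n => (∫ x in d.Ω, ⟪d.permittivityT (T n) x (u n x), P x⟫_ℝ) -
      (∫ x in d.Ω, ⟪d.permittivityT (T n) x (E x), P x⟫_ℝ) -
      ∫ x in d.Ω, ⟪d.ε x ((u n - E) x), P x⟫_ℝ) (D * (X * l2 μ P)) fun n => by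
    have m1 := memLp_permittivityT (h.isLipEquiv n) hd h.subset (h.ae_det_pos n) (hc n) (hu n).1
    have m2 := memLp_permittivityT (h.isLipEquiv n) hd h.subset (h.ae_det_pos n) (hc n) hE.1
    have i1 := integrable_inner m1 hP.1
    have i2 := integrable_inner m2 hP.1
    have hDt := mul_nonneg hD (h.pos n).le
    rw [← integral_sub i1 i2]
    refine (abs_integral_sub_le_l2 hDt (hδ n).1 hP.1 (i1.sub i2)
      (integrable_inner (hd.memLp_permittivity (hδ n).1) hP.1) ((hc n).mono fun x hx => ?_)).trans ?_
    · change |⟪d.permittivityT (T n) x (u n x), P x⟫_ℝ -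
        ⟪d.permittivityT (T n) x (E x), P x⟫_ℝ - ⟪d.ε x ((u n - E) x), P x⟫_ℝ| ≤ _
      rw [← inner_sub_left]
      refine abs_inner_sub_inner_le ?_
      rw [← map_sub, ← Pi.sub_apply, ← _root_.sub_apply]
      exact (d.permittivityT (T n) x - d.ε x).le_of_opNorm_le hx.permittivity_sub _
    · have := mul_le_mul_of_nonneg_left
        (mul_le_mul_of_nonneg_right (hX1 n) (l2_nonneg (μ := μ) P)) hDt
      linarith
  have hsum := ((t1.add t2).add t3).add nonl
  simp only [add_zero] at hsum
  refine hsum.congr fun n => ?_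
  -- The adjoint equation tested with `u n - E` says that the linear parts subtracted in the four
  -- limits sum to zero.
  have hadj := hPa.2 _ ((hδ n).memH0curl hd.isOpen_Ω)
  rw [hd.a_eq (hδ n) hP] at hadj
  simp only [← mul_add]
  congr 1
  simp only [lagrangianT]
  linarith

end NearIdSeq

/-! ### The derivative along a sequence of transformations -/

namespace Data

variable {d : Data} {γ : ℝ} {ω : Set E3} {E P : Field}

theorem tracking_congr (hd : d.Admissible) {E₂ : Field} (h : E =ᵐ[volume.restrict d.Ω] E₂) :
    d.tracking E = d.tracking E₂ := by
  rw [tracking, tracking]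
  congr 1
  refine integral_congr_ae ?_
  filter_upwards [ae_restrict_of_ae_restrict_of_subset hd.subset h] with x hx
  rw [hx]

/-- At a state, the part of the Lagrangian beyond the cost is the residual of the state equation
tested with `P`, hence zero for every `P`. Uniqueness makes the choice in `state` irrelevant to the
tracking term. -/
theorem J_eq_lagrangian (hd : d.Admissible) (hγ : 0 < γ) (hω : MeasurableSet ω) (hs : ω ⊆ d.Ω)
    (hE : d.IsState γ ω E) (hP : MemH0curl d.Ω P) : d.J γ ω = d.lagrangian γ ω E P := by
  have hst : d.IsState γ ω (d.state γ ω) := by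
    have hex : ∃ E, d.IsState γ ω E := ⟨E, hE⟩
    rw [state, dif_pos hex]
    exact hex.choose_spec
  rw [J, lagrangian, tracking_congr hd (hd.isState_unique hγ hω hs hst hE)]
  linarith [hE.2 P hP]

theorem lagrangian_eq_lagrangianT_id (hd : d.Admissible) (hω : MeasurableSet ω) (hs : ω ⊆ d.Ω)
    {c w : Field} (hE : H0Pair d.Ω E c) (hP : H0Pair d.Ω P w) :
    d.lagrangian γ ω E P = d.lagrangianT γ ω id E c P w := by
  have ht : ∀ {u v : Field}, H0Pair d.Ω u v → IsTransport d.Ω id u v u v := fun hu =>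
    ⟨hu, hu, ae_of_all _ fun x => by
      rw [fderiv_id_tensor, invTransp_one, id, tensor_one_apply], ae_of_all _ fun x => by
      rw [fderiv_id_tensor, det_one, inv_one, one_smul, id, tensor_one_apply]⟩
  have hdet : ∀ᵐ x : E3, 0 < (fderiv ℝ (id : E3 → E3) x).det := ae_of_all _ fun x => by
    rw [fderiv_id_tensor, det_one]; exact one_pos
  have := (ht hE).lagrangian_image (γ := γ) (ht hP) hd (isLipEquiv_id ∅ isCompact_empty)
    (Set.empty_subset _) hdet hω hs
  rwa [Set.image_id] at this

end Data

namespace NearIdSeq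

variable {d : Data} {γ : ℝ} {K ω : Set E3} {C M : ℝ} {θ : Field} {t : ℕ → ℝ} {T : ℕ → E3 → E3}
  {E P : Field}

theorem shift (h : NearIdSeq d.B K C M θ t T) (N : ℕ) :
    NearIdSeq d.B K C M θ (fun n => t (n + N)) (fun n => T (n + N)) where
  compact := h.compact
  subset := h.subset
  off := h.off
  C_nonneg := h.C_nonneg
  M_nonneg := h.M_nonneg
  pos _ := h.pos _
  le_one _ := h.le_one _
  lim := h.lim.comp (tendsto_add_atTop_nat N)
  near _ := h.near _
  small _ := h.small _
  small' _ := h.small' _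
  ball _ := h.ball _
  slope x := (h.slope x).comp (tendsto_add_atTop_nat N)

/-- The difference quotients of the shape Lagrangian. -/
theorem tendsto_slope_lagrangian (h : NearIdSeq d.B K C M θ t T) (hd : d.Admissible)
    (hγ : 0 < γ) (hω : MeasurableSet ω) (hs : ω ⊆ d.B) (hθ : ∃ k : ℝ≥0, LipschitzWith k θ)
    (hE : MemH0curl d.Ω E) (hP : MemH0curl d.Ω P) :
    Tendsto (fun n => (t n)⁻¹ * (d.lagrangian γ (T n '' ω) (covariant (T n) E)
      (covariant (T n) P) - d.lagrangian γ ω E P)) atTop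
      (𝓝 (∫ x in d.B, (frob (d.S1 γ ω E P x) (fderiv ℝ θ x) + ⟪d.S0 E P x, θ x⟫_ℝ))) := by
  have hsΩ := hs.trans hd.subset
  have hK := h.subset.trans hd.subset
  refine (h.tendsto_lagrangianT_slope hd hγ hω hs hθ hE.h0Pair hP.h0Pair).congr fun n => ?_
  have e1 := ((h.isLipEquiv n).isTransport_covariant hK hd.isOpen_Ω hd.bounded
    hE.h0Pair).lagrangian_image (γ := γ) ((h.isLipEquiv n).isTransport_covariant hK hd.isOpen_Ω
      hd.bounded hP.h0Pair) hd (h.isLipEquiv n) h.subset (h.ae_det_pos n) hω hsΩ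
  rw [e1, lagrangian_eq_lagrangianT_id hd hω hsΩ hE.h0Pair hP.h0Pair]

/-- The difference quotients of the cost functional. -/
theorem tendsto_slope_J (h : NearIdSeq d.B K C M θ t T) (hd : d.Admissible)
    (hγ : 0 < γ) (hω : MeasurableSet ω) (hs : ω ⊆ d.B) (hθ : ∃ k : ℝ≥0, LipschitzWith k θ)
    (hE : d.IsState γ ω E) (hP : d.IsAdjoint γ ω E P) :
    Tendsto (fun n => (t n)⁻¹ * (d.J γ (T n '' ω) - d.J γ ω)) atTop
      (𝓝 (∫ x in d.B, (frob (d.S1 γ ω E P x) (fderiv ℝ θ x) + ⟪d.S0 E P x, θ x⟫_ℝ))) := by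
  have hsΩ := hs.trans hd.subset
  have hK := h.subset.trans hd.subset
  have hE0 := hE.1.h0Pair
  have hP0 := hP.1.h0Pair
  obtain ⟨D, hD, hc⟩ := h.exists_coeffNearAt hd hγ
  obtain ⟨m, L, hm, hν, hop, -⟩ := hd.exists_isMonotoneOp hγ
  -- The smallness required by the absorption step holds from some index `N` on; the sequence is
  -- shifted by `N`.
  have hev : ∀ᶠ n in atTop, 8 * (D * t n) ≤ m := by
    have := (h.lim.const_mul D).const_mul 8
    rw [mul_zero, mul_zero] at this
    exact this.eventually (eventually_le_nhds hm)
  obtain ⟨N, hN⟩ := eventually_atTop.1 hev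
  rw [← tendsto_add_atTop_iff_nat N]
  have h' := h.shift N
  have himg : ∀ n, MeasurableSet (T n '' ω) := fun n => (h.isLipEquiv n).measurableSet_image hω
  have hsub : ∀ n, T n '' ω ⊆ d.Ω := fun n => by
    have := Set.image_mono (f := T n) hsΩ
    rwa [(h.isLipEquiv n).image_eq hK] at this
  choose U hU using fun n => hd.exists_isState hγ (himg n) (hsub n)
  have tr := fun n => (h.isLipEquiv n).isTransport_pullback hK hd.isOpen_Ω hd.bounded
    (hU n).1.h0Pair
  have trP := fun n => (h.isLipEquiv n).isTransport_covariant hK hd.isOpen_Ω hd.bounded hP0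
  have hX := fun n => transported_state_sub_le (h.isLipEquiv (n + N)) hd hγ h.subset
    (h.ae_det_pos (n + N)) hω hsΩ (h.pos (n + N)).le hD (hc (n + N)) hm hν (hop ω hω) hE hE0
    (hU (n + N)) (tr (n + N)) (hN _ (Nat.le_add_left N n))
  have hlim1 := h'.tendsto_lagrangianT_sub hd hγ hω hs hE0 hP hP0 (fun n => (tr (n + N)).h0)
    (X := 4 * (l2 (volume.restrict d.Ω) (weakCurl d.Ω E) + 2 * l2 (volume.restrict d.Ω) E +
        l2 (volume.restrict d.Ω) (fun x => ‖d.f x‖ + 1)) / m * D)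
    (fun n => (hX n).trans (le_of_eq (by ring)))
  have hlim2 := h'.tendsto_lagrangianT_slope hd hγ hω hs hθ hE0 hP0
  have := hlim1.add hlim2
  rw [zero_add] at this
  refine this.congr fun n => ?_
  -- On the moved shape the second argument is chosen as the transport of `P`, so that it pulls back
  -- to the fixed field `P`.
  have e1 : d.J γ (T (n + N) '' ω) = d.lagrangianT γ ω (T (n + N)) (pullback (T (n + N)) (U (n + N)))
      (pullbackCurl (T (n + N)) (weakCurl d.Ω (U (n + N)))) P (weakCurl d.Ω P) := by
    rw [J_eq_lagrangian hd hγ (himg _) (hsub _) (hU (n + N))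
      ((trP (n + N)).h0'.memH0curl hd.isOpen_Ω)]
    exact (tr (n + N)).lagrangian_image (trP (n + N)) hd (h.isLipEquiv _) h.subset
      (h.ae_det_pos _) hω hsΩ
  rw [e1, J_eq_lagrangian hd hγ hω hsΩ hE hP.1, lagrangian_eq_lagrangianT_id hd hω hsΩ hE0 hP0]
  ring

end NearIdSeq

end HTS

namespace HTS

open Data

/-! ### The shape derivative -/

/-- Transformations along a flow, at small positive times tending to zero. -/
theorem IsFlow.exists_nearIdSeq {B : Set E3} (hB : IsOpen B) {θ : Field} {k : ℝ≥0}
    (hθ : LipschitzWith k θ) (hc : HasCompactSupport θ) (hs : tsupport θ ⊆ B) {M : ℝ}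
    (hM : ∀ x, ‖θ x‖ ≤ M) {τ : ℝ} (hτ : 0 < τ) {T : ℝ → E3 → E3} (hT : IsFlow θ τ T) {s : ℕ → ℝ}
    (hs0 : Tendsto s atTop (𝓝[>] 0)) :
    ∃ N : ℕ, NearIdSeq B (tsupport θ) (k * Real.exp (k * τ)) M θ (fun n => s (n + N))
      (fun n => T (s (n + N))) := by
  have hM0 : 0 ≤ M := (norm_nonneg _).trans (hM 0)
  set C : ℝ := k * Real.exp (k * τ) with hC
  have hC0 : 0 ≤ C := by positivity
  obtain ⟨ρ, hρ, hρB⟩ := hc.isCompact.exists_cthickening_subset_open hB hs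
  have hlim : Tendsto s atTop (𝓝 0) := hs0.mono_right nhdsWithin_le_nhds
  have small : ∀ (Q q : ℝ), 0 < q → ∀ᶠ n in atTop, Q * s n ≤ q := fun Q q hq => by
    have := hlim.const_mul Q
    rw [mul_zero] at this
    exact this.eventually (eventually_le_nhds hq)
  have hpos : ∀ᶠ n in atTop, 0 < s n := hs0.eventually self_mem_nhdsWithin
  obtain ⟨N, hN⟩ := eventually_atTop.1 (hpos.and ((small 1 1 one_pos).and ((small 1 τ hτ).and
    ((small C (1 / 2) (by norm_num)).and ((small C tensorRadius tensorRadius_pos).and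
      (small M ρ hρ))))))
  have hN' := fun n => hN (n + N) (Nat.le_add_left N n)
  have hlim' := hlim.comp (tendsto_add_atTop_nat N)
  have hs0' := hs0.comp (tendsto_add_atTop_nat N)
  exact ⟨N,
    { compact := hc.isCompact
      subset := hs
      off := fun x hx => image_eq_zero_of_notMem_tsupport hx
      C_nonneg := hC0
      M_nonneg := hM0
      pos := fun n => (hN' n).1
      le_one := fun n => by simpa using (hN' n).2.1
      lim := hlim'
      near := fun n => hT.isNearId hθ hM ⟨(hN' n).1.le, by simpa using (hN' n).2.2.1⟩
      small := fun n => (hN' n).2.2.2.1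
      small' := fun n => (hN' n).2.2.2.2.1
      ball := fun n x hx => ((Metric.closedBall_subset_closedBall (hN' n).2.2.2.2.2).trans
        (Metric.closedBall_subset_cthickening hx ρ)).trans hρB
      slope := fun x => (hT.tendsto_slope hτ x).comp hs0' }⟩

theorem exists_norm_le_of_lipField {θ : Field} {k : ℝ≥0} (hθ : LipschitzWith k θ)
    (hc : HasCompactSupport θ) : ∃ M : ℝ≥0, ∀ x, ‖θ x‖ ≤ M := by
  obtain ⟨C, hC⟩ := hc.exists_bound_of_continuous hθ.continuous
  exact ⟨⟨C, (norm_nonneg _).trans (hC 0)⟩, hC⟩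

section

variable {B Ω : Set E3} {S₁ : E3 → Tensor} {S₀ : Field}

theorem integrableOn_frob_fderiv (h₁ : IntegrableOn S₁ B) {θ : Field} {k : ℝ≥0}
    (hθ : LipschitzWith k θ) : IntegrableOn (fun x => frob (S₁ x) (fderiv ℝ θ x)) B := by
  refine ((h₁.norm.mul_const (k : ℝ)).const_mul 3).mono'
    (aestronglyMeasurable_frob h₁.1 (measurable_fderiv ℝ θ).aestronglyMeasurable)
    (ae_of_all _ fun x => ?_)
  refine (abs_frob_le _ _).trans ?_
  have := norm_fderiv_le_of_lipschitz ℝ hθ (x₀ := x)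
  gcongr

theorem integrableOn_inner_field (h₀ : IntegrableOn S₀ B) {θ : Field} {k : ℝ≥0}
    (hθ : LipschitzWith k θ) {M : ℝ≥0} (hM : ∀ x, ‖θ x‖ ≤ M) :
    IntegrableOn (fun x => ⟪S₀ x, θ x⟫_ℝ) B := by
  refine (h₀.norm.mul_const (M : ℝ)).mono' (h₀.1.inner hθ.continuous.aestronglyMeasurable)
    (ae_of_all _ fun x => ?_)
  exact (norm_inner_le_norm _ _).trans (mul_le_mul_of_nonneg_left (hM x) (norm_nonneg _))

/-- The linear functional on Lipschitz fields with densities `S₁` and `S₀`. -/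
noncomputable def tensorFunctional (h₁ : IntegrableOn S₁ B) (h₀ : IntegrableOn S₀ B) :
    lipFields B →ₗ[ℝ] ℝ where
  toFun θ := ∫ x in B, (frob (S₁ x) (fderiv ℝ (θ : Field) x) + ⟪S₀ x, (θ : Field) x⟫_ℝ)
  map_add' := by
    rintro ⟨θ, ⟨k, hk⟩, hc, hs⟩ ⟨η, ⟨l, hl⟩, hc', hs'⟩
    obtain ⟨M, hM⟩ := exists_norm_le_of_lipField hk hc
    obtain ⟨M', hM'⟩ := exists_norm_le_of_lipField hl hc'
    have i1 := (integrableOn_frob_fderiv h₁ hk).add (integrableOn_inner_field h₀ hk hM)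
    have i2 := (integrableOn_frob_fderiv h₁ hl).add (integrableOn_inner_field h₀ hl hM')
    refine Eq.trans (integral_congr_ae ?_) (integral_add i1 i2)
    filter_upwards [ae_restrict_of_ae hk.ae_differentiableAt,
      ae_restrict_of_ae hl.ae_differentiableAt] with x h1 h2
    change frob (S₁ x) (fderiv ℝ (θ + η) x) + ⟪S₀ x, θ x + η x⟫_ℝ =
      frob (S₁ x) (fderiv ℝ θ x) + ⟪S₀ x, θ x⟫_ℝ + (frob (S₁ x) (fderiv ℝ η x) + ⟪S₀ x, η x⟫_ℝ)
    rw [fderiv_add h1 h2, frob_add_right, inner_add_right]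
    ring
  map_smul' := by
    rintro c ⟨θ, ⟨k, hk⟩, hc, hs⟩
    refine Eq.trans (integral_congr_ae ?_) (integral_const_mul c _)
    filter_upwards [ae_restrict_of_ae hk.ae_differentiableAt] with x h1
    change frob (S₁ x) (fderiv ℝ (c • θ) x) + ⟪S₀ x, c • θ x⟫_ℝ =
      c * (frob (S₁ x) (fderiv ℝ θ x) + ⟪S₀ x, θ x⟫_ℝ)
    rw [fderiv_const_smul h1, frob_smul_right, real_inner_smul_right]
    ring

theorem tensorFunctional_apply (h₁ : IntegrableOn S₁ B) (h₀ : IntegrableOn S₀ B)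
    (θ : lipFields B) : tensorFunctional h₁ h₀ θ =
      ∫ x in B, (frob (S₁ x) (fderiv ℝ (θ : Field) x) + ⟪S₀ x, (θ : Field) x⟫_ℝ) := rfl

/-- The constant is an L¹ bound for the two densities; the factor 3 comes from the three columns in
`frob`. -/
theorem exists_abs_tensorFunctional_le (hB : IsOpen B) (hBΩ : B ⊆ Ω)
    (h₁ : IntegrableOn S₁ B) (h₀ : IntegrableOn S₀ B) :
    ∃ C : ℝ, ∀ θ : lipFields B, |tensorFunctional h₁ h₀ θ| ≤ C * lipNorm Ω θ := by
  refine ⟨(∫ x in B, 3 * ‖S₁ x‖) + ∫ x in B, ‖S₀ x‖, ?_⟩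
  rintro ⟨θ, ⟨k, hk⟩, hc, hs⟩
  obtain ⟨M, hM⟩ := exists_norm_le_of_lipField hk hc
  change |∫ x in B, (frob (S₁ x) (fderiv ℝ θ x) + ⟪S₀ x, θ x⟫_ℝ)| ≤ _ * lipNorm Ω θ
  set A : ℝ := ⨆ x : Ω, ‖θ x‖ with hA
  set L : ℝ := ⨆ p : {p : E3 × E3 // p.1 ∈ Ω ∧ p.2 ∈ Ω ∧ p.1 ≠ p.2},
      ‖θ p.1.1 - θ p.1.2‖ / ‖p.1.1 - p.1.2‖ with hL
  have hA0 : 0 ≤ A := Real.iSup_nonneg fun x => norm_nonneg _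
  have hL0 : 0 ≤ L := Real.iSup_nonneg fun p => by positivity
  have hA1 : ∀ x ∈ B, ‖θ x‖ ≤ A := fun x hx =>
    le_ciSup (f := fun x : Ω => ‖θ x‖) ⟨M, by rintro _ ⟨y, rfl⟩; exact hM y⟩ ⟨x, hBΩ hx⟩
  have hL1 : ∀ x ∈ B, ∀ y ∈ B, ‖θ y - θ x‖ ≤ L * ‖y - x‖ := fun x hx y hy => by
    rcases eq_or_ne y x with rfl | hne
    · simp
    have h1 : ‖θ y - θ x‖ / ‖y - x‖ ≤ L :=
      le_ciSup (f := fun p : {p : E3 × E3 // p.1 ∈ Ω ∧ p.2 ∈ Ω ∧ p.1 ≠ p.2} =>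
        ‖θ p.1.1 - θ p.1.2‖ / ‖p.1.1 - p.1.2‖) ⟨k, by
          rintro _ ⟨p, rfl⟩
          refine div_le_of_le_mul₀ (norm_nonneg _) k.2 ?_
          have := hk.dist_le_mul p.1.1 p.1.2
          rwa [dist_eq_norm, dist_eq_norm] at this⟩ ⟨(y, x), hBΩ hy, hBΩ hx, hne⟩
    rwa [div_le_iff₀ (norm_pos_iff.2 (sub_ne_zero.2 hne))] at h1
  -- Since `B` is open and inside `Ω`, the supremum of difference quotients over `Ω` bounds the
  -- derivative at every point of `B`, including points where `θ` is not differentiable and `fderiv`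
  -- is zero.
  have hL2 : ∀ x ∈ B, ‖fderiv ℝ θ x‖ ≤ L := fun x hx =>
    norm_fderiv_le_of_lip' ℝ hL0 ((hB.mem_nhds hx : B ∈ 𝓝 x) |> fun h =>
      Filter.mem_of_superset h fun y hy => hL1 x hx y hy)
  have hbound : ∀ᵐ x ∂(volume.restrict B), ‖frob (S₁ x) (fderiv ℝ θ x) + ⟪S₀ x, θ x⟫_ℝ‖ ≤
      3 * ‖S₁ x‖ * (A + L) + ‖S₀ x‖ * (A + L) := by
    filter_upwards [ae_restrict_mem hB.measurableSet] with x hx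
    refine (norm_add_le _ _).trans (add_le_add ?_ ?_)
    · refine (abs_frob_le _ _).trans ?_
      rw [← mul_assoc]
      exact mul_le_mul_of_nonneg_left (by linarith [hL2 x hx]) (by positivity)
    · refine (norm_inner_le_norm _ _).trans ?_
      exact mul_le_mul_of_nonneg_left (by linarith [hA1 x hx]) (norm_nonneg _)
  have i1 : Integrable (fun x => 3 * ‖S₁ x‖ * (A + L)) (volume.restrict B) :=
    (h₁.norm.const_mul 3).mul_const _
  have i2 : Integrable (fun x => ‖S₀ x‖ * (A + L)) (volume.restrict B) := h₀.norm.mul_const _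
  have := norm_integral_le_of_norm_le (i1.add i2) hbound
  rw [integral_add' i1 i2, integral_mul_const, integral_mul_const, ← add_mul] at this
  exact this

end

namespace Data

variable {d : Data} {γ : ℝ} {ω : Set E3} {E P : Field}

theorem covariant_id (u : Field) : covariant id u = u := by
  funext x
  have : Function.invFun (id : E3 → E3) x = x :=
    Function.leftInverse_invFun Function.injective_id x
  rw [covariant, this, fderiv_id_tensor]
  exact congrArg (fun A : Tensor => A (u x)) invTransp_one

/-- The cost functional is differentiable along flows. -/
theorem tendsto_J_flow (hd : d.Admissible) (hγ : 0 < γ) (hω : MeasurableSet ω) (hs : ω ⊆ d.B)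
    (hE : d.IsState γ ω E) (hP : d.IsAdjoint γ ω E P) (θ : lipFields d.B) {τ : ℝ} (hτ : 0 < τ)
    {T : ℝ → E3 → E3} (hT : IsFlow θ τ T) :
    Tendsto (fun t => (d.J γ (T t '' ω) - d.J γ ω) / t) (𝓝[>] 0)
      (𝓝 (∫ x in d.B, (frob (d.S1 γ ω E P x) (fderiv ℝ (θ : Field) x) +
        ⟪d.S0 E P x, (θ : Field) x⟫_ℝ))) := by
  obtain ⟨⟨k, hk⟩, hc, hsupp⟩ := θ.2
  obtain ⟨M, hM⟩ := exists_norm_le_of_lipField hk hc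
  -- The one-sided limit is tested along sequences, to which the expansions of the previous parts
  -- apply after dropping finitely many terms.
  refine tendsto_of_seq_tendsto fun s hs0 => ?_
  obtain ⟨N, h⟩ := hT.exists_nearIdSeq hd.isOpen_B hk hc hsupp hM hτ hs0
  rw [← tendsto_add_atTop_iff_nat N]
  refine (h.tendsto_slope_J hd hγ hω hs ⟨k, hk⟩ hE hP).congr fun n => ?_
  exact (div_eq_inv_mul _ _).symm

/-- The shape Lagrangian is differentiable at time zero. -/
theorem hasDerivWithinAt_shapeLagrangian (hd : d.Admissible) (hγ : 0 < γ) (hω : MeasurableSet ω)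
    (hs : ω ⊆ d.B) (hE : MemH0curl d.Ω E) (hP : MemH0curl d.Ω P) (θ : lipFields d.B) {τ : ℝ}
    (hτ : 0 < τ) {T : ℝ → E3 → E3} (hT : IsFlow θ τ T) :
    HasDerivWithinAt (fun t => d.shapeLagrangian γ ω T t E P)
      (∫ x in d.B, (frob (d.S1 γ ω E P x) (fderiv ℝ (θ : Field) x) +
        ⟪d.S0 E P x, (θ : Field) x⟫_ℝ)) (Set.Ici 0) 0 := by
  obtain ⟨⟨k, hk⟩, hc, hsupp⟩ := θ.2
  obtain ⟨M, hM⟩ := exists_norm_le_of_lipField hk hc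
  have hT0 : T 0 = id := funext fun X => (hT X).1
  have h0 : d.shapeLagrangian γ ω T 0 E P = d.lagrangian γ ω E P := by
    rw [shapeLagrangian, hT0, Set.image_id, covariant_id, covariant_id]
  rw [← hasDerivWithinAt_Ioi_iff_Ici, hasDerivWithinAt_iff_tendsto_slope' Set.self_notMem_Ioi]
  refine tendsto_of_seq_tendsto fun s hs0 => ?_
  obtain ⟨N, h⟩ := hT.exists_nearIdSeq hd.isOpen_B hk hc hsupp hM hτ hs0
  rw [← tendsto_add_atTop_iff_nat N]
  refine (h.tendsto_slope_lagrangian hd hγ hω hs ⟨k, hk⟩ hE hP).congr fun n => ?_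
  rw [Function.comp_apply, slope_def_module, h0, sub_zero]
  rfl

theorem hasShapeDerivative_J (hd : d.Admissible) (hγ : 0 < γ) (hω : MeasurableSet ω)
    (hs : ω ⊆ d.B) (hE : d.IsState γ ω E) (hP : d.IsAdjoint γ ω E P) :
    HasShapeDerivative d.Ω d.B (d.J γ) ω (tensorFunctional
      (hd.integrableOn_S1 hγ hω hE.1.h0Pair hP.1.h0Pair)
      (hd.integrableOn_S0 hE.1.h0Pair hP.1.h0Pair)) := by
  refine ⟨fun θ => ?_, exists_abs_tensorFunctional_le hd.isOpen_B hd.subset _ _⟩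
  obtain ⟨⟨k, hk⟩, hc, hsupp⟩ := θ.2
  obtain ⟨M, hM⟩ := exists_norm_le_of_lipField hk hc
  obtain ⟨T, hT⟩ := exists_isFlow hk hM
  -- Any flow gives the same limit, so the one on the unit time interval serves as witness.
  exact ⟨1, one_pos, T, hT, tendsto_J_flow hd hγ hω hs hE hP θ one_pos hT⟩

end Data

end HTS

theorem theorem4p5 (d : HTS.Data) (hd : d.Admissible) (γ : ℝ) (hγ : 0 < γ) (L : ℝ≥0)
    (ω : Set HTS.E3) (hω : ω ∈ HTS.admissibleShapes d.B L) :
    -- the state equation is uniquely solvable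
    (∃ E : HTS.Field, d.IsState γ ω E) ∧
    (∀ E E₂ : HTS.Field, d.IsState γ ω E → d.IsState γ ω E₂ → E =ᵐ[volume.restrict d.Ω] E₂) ∧
    ∀ E : HTS.Field, d.IsState γ ω E →
      -- the adjoint equation is uniquely solvable
      (∃ P : HTS.Field, d.IsAdjoint γ ω E P) ∧
      (∀ P P₂ : HTS.Field, d.IsAdjoint γ ω E P → d.IsAdjoint γ ω E P₂ →
        P =ᵐ[volume.restrict d.Ω] P₂) ∧
      ∀ P : HTS.Field, d.IsAdjoint γ ω E P →
        IntegrableOn (d.S1 γ ω E P) d.B ∧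
        IntegrableOn (d.S0 E P) d.B ∧
        ∃ dJ : HTS.lipFields d.B →ₗ[ℝ] ℝ,
          HTS.HasShapeDerivative d.Ω d.B (d.J γ) ω dJ ∧
          ∀ θ : HTS.lipFields d.B,
            (∀ (τ : ℝ) (T : ℝ → HTS.E3 → HTS.E3), 0 < τ → HTS.IsFlow θ τ T →
              HasDerivWithinAt (fun t => d.shapeLagrangian γ ω T t E P) (dJ θ)
                (Set.Ici 0) 0) ∧
            dJ θ = ∫ x in d.B, (HTS.frob (d.S1 γ ω E P x) (fderiv ℝ (θ : HTS.Field) x) +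
              inner ℝ (d.S0 E P x) ((θ : HTS.Field) x)) := by
  have hm : MeasurableSet ω := hω.2.1.measurableSet
  have hs : ω ⊆ d.B := hω.1
  have hsΩ : ω ⊆ d.Ω := hs.trans hd.subset
  refine ⟨hd.exists_isState hγ hm hsΩ, fun E E₂ h h₂ => hd.isState_unique hγ hm hsΩ h h₂,
    fun E hE => ?_⟩
  have hE0 := hE.1.h0Pair
  refine ⟨hd.exists_isAdjoint hγ hm hsΩ hE0.1,
    fun P P₂ h h₂ => hd.isAdjoint_unique hγ hm hsΩ hE0.1 h h₂, fun P hP => ?_⟩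
  have hP0 := hP.1.h0Pair
  refine ⟨hd.integrableOn_S1 hγ hm hE0 hP0, hd.integrableOn_S0 hE0 hP0, _,
    HTS.Data.hasShapeDerivative_J hd hγ hm hs hE hP, fun θ => ⟨fun τ T hτ hT => ?_, ?_⟩⟩
  · exact HTS.Data.hasDerivWithinAt_shapeLagrangian hd hγ hm hs hE.1 hP.1 θ hτ hT
  · exact HTS.tensorFunctional_apply _ _ θ
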